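/- Let $\mathsf{Q}_{\mathsf{sing}}$ be the simple rank $3$ matroid on $\{1,\dots,12\}$ whose lines (rank $2$ flats with at least three elements) are $$\{1,2,6,8\},\ \{1,3,5,7\},\ \{1,9,12\},\ \{2,4,5,9\},\ \{2,7,11\},\ \{3,4,6\},$$ $$\{3,8,9\},\ \{3,10,12\},\ \{4,7,8\},\ \{4,10,11\},\ \{5,6,10\},\ \{8,11,12\}.$$ The free extension of a matroid $M$ on $E$ by a new element $a$ is the matroid on $E\sqcup\{a\}$ whose bases are the bases of $M$ and the sets $(\lambda\setminus b)\cup a$ with $\lambda$ a basis of $M$ and $b\in\lambda$; the free coextension of $M$ by $a$ is the dual of the free extension of the dual $M^\vee$ by $a$. Let $M$ be a connected matroid of rank $d$ on $[n]=\{1,\dots,n\}$ that has a circuit $\gamma=(\gamma_1,\dots,\gamma_{d+1})$ with $d+1$ elements. The realization space $\mathcal{R}(M;\mathbb{C})$, which parameterizes the arrangements of $n$ hyperplanes in $\mathbb{P}^{d-1}_{\mathbb{C}}$ realizing $M$ up to $\mathrm{PGL}_d(\mathbb{C})$, is the affine scheme $\mathrm{Spec}(U^{-1}B/I)$ defined as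 follows. Consider the $d\times n$ matrix $A$ whose columns at $\gamma_1,\dots,\gamma_d$ are the unit vectors, whose column at $\gamma_{d+1}$ is $(1,\dots,1)^T$, and whose entry in row $i$ of the column at any other element $e$ is $0$ if $\{\gamma_1,\dots,\gamma_d\}\setminus\gamma_i\cup e$ is not a basis of $M$, is $1$ if $i$ is the largest index for which this set is a basis, and is an independent variable $x_{i,e}$ otherwise. Then $B$ is the polynomial ring over $\mathbb{C}$ in these variables, $I$ is the ideal generated by the maximal minors of $A$ on the $d$-subsets that are not bases of $M$, and $U$ is the multiplicative set generated by the maximal minors of $A$ on the bases of $M$. A finite type affine scheme $X$ over $\mathbb{C}$ is said to have nodal singularities if it has a closed point at which it is not smooth over $\mathbb{C}$, and every such point $p$ is a nodal singularity: for some $m\ge 0$, the pointed scheme $(X,p)$ and $\mathrm{Spec}\,\mathbb{C}[u,v,z_1,\dots,z_m]/(uv)$, pointed at the origin, have a common étale neighbourhood. **Theorem.** Let $d,n$ be integers with $3\le d\le n/2$ such that $(d,n)$ is not one of the pairs $$(3,6),(3,7),(3,8),(3,9),(3,10),(3,11),(4,8),(4,9),(4,10),(4,11),(4,12),$$ $$(5,10),(5,11),(5,12),(5,13),(6,12),(6,13),(6,14),(7,14),(7,15),(8,16).$$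 Let $\mathsf{Q}_{d,n,\mathsf{sing}}$ be obtained from $\mathsf{Q}_{\mathsf{sing}}$ by $d-3$ free coextensions followed by $n-(d+9)$ free extensions, by the new elements $13,14,\dots,n$ in this order. Then $\mathsf{Q}_{d,n,\mathsf{sing}}$ is a connected matroid of rank $d$ on $[n]$ that has a circuit with $d+1$ elements, and (for every choice and ordering of such a circuit) its realization space $\mathcal{R}(\mathsf{Q}_{d,n,\mathsf{sing}};\mathbb{C})$ has nodal singularities. In particular, for every $n\ge 12$ there is a connected rank $3$ matroid on $[n]$, with a circuit of $4$ elements, whose realization space over $\mathbb{C}$ has nodal singularities; in particular this realization space is singular. -/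

import Mathlib

open Set

namespace Matroid

variable {α : Type*}

/-- The free extension of a matroid by a new element `a`. For `a ∉ M.E` (then `M ＼ {a} = M`) this is
the matroid on `M.E ∪ {a}` whose bases are the bases of `M` together with the sets `(B \ {b}) ∪ {a}`
for `B` a base of `M` and `b ∈ B`; see `Matroid.freeExtension_isBase_iff`. It is given here by its
independent sets. -/
def freeExtension (M : Matroid α) (a : α) : Matroid α :=
  IndepMatroid.matroid
    { E := insert a M.E
      Indep := fun I => (M ＼ {a}).Indep (I \ {a}) ∧ (a ∈ I → ¬ (M ＼ {a}).IsBase (I \ {a}))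
      indep_empty := by simp
      indep_subset := by
        rintro I J ⟨hJ, hJa⟩ hIJ
        have hsub : I \ {a} ⊆ J \ {a} := sdiff_subset_sdiff_left hIJ
        refine ⟨hJ.subset hsub, fun ha hB => hJa (hIJ ha) ?_⟩
        rwa [← hB.eq_of_subset_indep hJ hsub]
      indep_aug := by
        set N := M ＼ {a} with hN
        have haN : a ∉ N.E := by simp [hN]
        rintro I B ⟨hI, hIa⟩ hImax ⟨⟨hB, hBa⟩, hBmax⟩
        have hIbase : ¬ N.IsBase (I \ {a}) := by
          intro hb
          have haI : a ∉ I := fun h => hIa h hb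
          refine hImax ⟨⟨hI, hIa⟩, ?_⟩
          rintro J ⟨hJ, hJa⟩ hIJ
          have hEq := hb.eq_of_subset_indep hJ (sdiff_subset_sdiff_left hIJ)
          have haJ : a ∉ J := fun h => hJa h (hEq ▸ hb)
          rw [sdiff_singleton_eq_self haI, sdiff_singleton_eq_self haJ] at hEq
          exact hEq.symm.subset
        by_cases haI : a ∈ I
        · obtain ⟨z, hzI, hz⟩ : ∃ z, z ∉ I ∧ N.Indep (insert z (I \ {a})) ∧
              ¬ N.IsBase (insert z (I \ {a})) := by
            by_contra! hcon
            refine hImax ⟨⟨hI, hIa⟩, ?_⟩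
            rintro J ⟨hJ, hJa⟩ hIJ
            intro z hzJ
            by_contra hzI
            have hza : z ≠ a := fun h => hzI (h ▸ haI)
            have hsub : insert z (I \ {a}) ⊆ J \ {a} :=
              insert_subset ⟨hzJ, hza⟩ (sdiff_subset_sdiff_left hIJ)
            have hb := hcon z hzI (hJ.subset hsub)
            exact hJa (hIJ haI) (hb.eq_of_subset_indep hJ hsub ▸ hb)
          have key : ∀ x, x ≠ a → x ∉ I → N.Indep (insert x (I \ {a})) →
              ¬ N.IsBase (insert x (I \ {a})) := fun x _ hx _ hb =>
            hz.2 (insert_isBase_of_insert_indep (fun h => hx h.1) (fun h => hzI h.1) hb hz.1)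
          have fin : ∀ x ∈ B, x ∉ I → N.Indep (insert x (I \ {a})) →
              ∃ x ∈ B \ I, N.Indep (insert x I \ {a}) ∧
                (a ∈ insert x I → ¬ N.IsBase (insert x I \ {a})) := by
            intro x hxB hxI hx
            have hxa : x ≠ a := fun h => hxI (h ▸ haI)
            refine ⟨x, ⟨hxB, hxI⟩, ?_⟩
            rw [← insert_sdiff_singleton_comm hxa]
            exact ⟨hx, fun _ => key x hxa hxI hx⟩
          by_cases haB : a ∈ B
          · obtain ⟨C, hC, hBC⟩ := hB.exists_isBase_superset
            obtain ⟨w, hwC, hwB⟩ := exists_of_ssubset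
              (hBC.ssubset_of_ne (by rintro h; exact hBa haB (h ▸ hC)))
            have hwa : w ≠ a := fun h => haN (h ▸ hC.subset_ground hwC)
            have hwB' : w ∉ B := fun h => hwB ⟨h, hwa⟩
            have hCw : C = insert w (B \ {a}) := by
              by_contra hne
              have hss : insert w (B \ {a}) ⊆ C := insert_subset hwC hBC
              have hnb : ¬ N.IsBase (insert w (B \ {a})) := fun h =>
                hne (h.eq_of_subset_isBase hC hss).symm
              refine hwB' (hBmax (y := insert w B) ⟨?_, ?_⟩ (subset_insert _ _) (mem_insert _ _))
              · rw [← insert_sdiff_singleton_comm hwa]; exact hC.indep.subset hss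
              · rw [← insert_sdiff_singleton_comm hwa]; exact fun _ => hnb
            obtain ⟨x, ⟨hxC, hxI⟩, hx⟩ := hI.exists_insert_of_not_isBase hIbase hC
            have hxa : x ≠ a := fun h => haN (h ▸ hC.subset_ground hxC)
            have hxI' : x ∉ I := fun h => hxI ⟨h, hxa⟩
            by_cases hxw : x = w
            · obtain ⟨x', ⟨hxC', hxI2⟩, hx'⟩ :=
                hx.exists_insert_of_not_isBase (key x hxa hxI' hx) hC
              have hxa' : x' ≠ a := fun h => haN (h ▸ hC.subset_ground hxC')
              have hx'w : x' ≠ w := fun h => hxI2 (by simp [h, hxw])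
              rw [hCw] at hxC'
              refine fin x' (hxC'.resolve_left hx'w).1 (fun h => hxI2 (Or.inr ⟨h, hxa'⟩))
                (hx'.subset (insert_subset_insert (subset_insert _ _)))
            · rw [hCw] at hxC
              exact fin x (hxC.resolve_left hxw).1 hxI' hx
          · rw [sdiff_singleton_eq_self haB] at hB
            have hBb : N.IsBase B := by
              obtain ⟨C, hC, hBC⟩ := hB.exists_isBase_superset
              have haC : a ∉ C := fun h => haN (hC.subset_ground h)
              have : C ⊆ B := hBmax (y := C)
                ⟨by rw [sdiff_singleton_eq_self haC]; exact hC.indep, fun h => absurd h haC⟩ hBC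
              rwa [hBC.antisymm this]
            obtain ⟨x, ⟨hxB, hxI⟩, hx⟩ := hI.exists_insert_of_not_isBase hIbase hBb
            have hxa : x ≠ a := fun h => haB (h ▸ hxB)
            exact fin x hxB (fun h => hxI ⟨h, hxa⟩) hx
        · by_cases haB : a ∈ B
          · refine ⟨a, ⟨haB, haI⟩, ?_⟩
            rw [sdiff_singleton_eq_self haI] at hI hIbase
            rw [insert_sdiff_of_mem _ (mem_singleton a), sdiff_singleton_eq_self haI]
            exact ⟨hI, fun _ => hIbase⟩
          · rw [sdiff_singleton_eq_self haB] at hB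
            have hBb : N.IsBase B := by
              obtain ⟨C, hC, hBC⟩ := hB.exists_isBase_superset
              have haC : a ∉ C := fun h => haN (hC.subset_ground h)
              have : C ⊆ B := hBmax (y := C)
                ⟨by rw [sdiff_singleton_eq_self haC]; exact hC.indep, fun h => absurd h haC⟩ hBC
              rwa [hBC.antisymm this]
            rw [sdiff_singleton_eq_self haI] at hI hIbase
            obtain ⟨x, ⟨hxB, hxI⟩, hx⟩ := hI.exists_insert_of_not_isBase hIbase hBb
            have hxa : x ≠ a := fun h => haB (h ▸ hxB)
            have haxI : a ∉ insert x I := by simp [haI, Ne.symm hxa]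
            refine ⟨x, ⟨hxB, hxI⟩, ?_, fun h => absurd h haxI⟩
            rwa [sdiff_singleton_eq_self haxI]
      indep_maximal := by
        set N := M ＼ {a} with hN
        have haN : a ∉ N.E := by simp [hN]
        rintro X - I ⟨hI, hIa⟩ hIX
        obtain ⟨J, hJ, hIJ⟩ := hI.subset_isBasis'_of_subset
          (sdiff_subset_sdiff_left (t := {a}) hIX)
        have haJ : a ∉ J := fun h => haN (hJ.indep.subset_ground h)
        have hJX : J ⊆ X := hJ.subset.trans sdiff_subset
        have hmaxJ : ∀ K, N.Indep K → K ⊆ X → J ⊆ K → a ∉ K → K = J := by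
          intro K hK hKX hJK haK
          exact (hJ.eq_of_subset_indep hK hJK (subset_sdiff_singleton hKX haK)).symm
        by_cases hJb : N.IsBase J
        · by_cases haI : a ∈ I
          · have hne : I \ {a} ≠ J := fun h => hIa haI (h ▸ hJb)
            obtain ⟨x, hxJ, hxI⟩ := exists_of_ssubset (hIJ.ssubset_of_ne hne)
            have hJx : ¬ N.IsBase (J \ {x}) := fun h =>
              ((h.eq_of_subset_isBase hJb sdiff_subset).symm.subset hxJ).2 rfl
            have haJx : a ∉ J \ {x} := fun h => haJ h.1
            have e1 : insert a (J \ {x}) \ {a} = J \ {x} := by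
              rw [insert_sdiff_of_mem _ (mem_singleton a), sdiff_singleton_eq_self haJx]
            refine ⟨insert a (J \ {x}), ?_, ⟨⟨?_, ?_⟩, ?_⟩, ?_⟩
            · intro y hy
              by_cases hya : y = a
              · exact Or.inl hya
              · exact Or.inr ⟨hIJ ⟨hy, hya⟩, fun h => hxI (h ▸ ⟨hy, hya⟩)⟩
            · rw [e1]; exact hJb.indep.subset sdiff_subset
            · rw [e1]; exact fun _ => hJx
            · exact insert_subset (hIX haI) (sdiff_subset.trans hJX)
            · rintro K ⟨⟨hK, hKa⟩, hKX⟩ hle y hy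
              by_contra hyn
              have hya : y ≠ a := fun h => hyn (Or.inl h)
              have hyJx : y ∉ J \ {x} := fun h => hyn (Or.inr h)
              have haK : a ∈ K := hle (mem_insert _ _)
              have hss : insert y (J \ {x}) ⊆ K \ {a} :=
                insert_subset ⟨hy, hya⟩ fun w hw => ⟨hle (Or.inr hw), fun h => haJ (h ▸ hw.1)⟩
              have hb : N.IsBase (insert y (J \ {x})) :=
                insert_isBase_of_insert_indep (e := x) (by simp) hyJx
                  (by rwa [insert_sdiff_singleton, insert_eq_of_mem hxJ]) (hK.subset hss)
              exact hKa haK (hb.eq_of_subset_indep hK hss ▸ hb)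
          · refine ⟨J, ?_, ⟨⟨?_, ?_⟩, hJX⟩, ?_⟩
            · rwa [sdiff_singleton_eq_self haI] at hIJ
            · rw [sdiff_singleton_eq_self haJ]; exact hJ.indep
            · exact fun h => absurd h haJ
            · rintro K ⟨⟨hK, hKa⟩, hKX⟩ hle
              have hle' : J ⊆ K \ {a} := subset_sdiff_singleton hle haJ
              have hEq := hJb.eq_of_subset_indep hK hle'
              have haK : a ∉ K := fun h => hKa h (hEq ▸ hJb)
              rw [sdiff_singleton_eq_self haK] at hEq
              exact hEq.symm.subset
        · by_cases haX : a ∈ X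
          · have e1 : insert a J \ {a} = J := by
              rw [insert_sdiff_of_mem _ (mem_singleton a), sdiff_singleton_eq_self haJ]
            refine ⟨insert a J, ?_, ⟨⟨?_, ?_⟩, ?_⟩, ?_⟩
            · intro y hy
              by_cases hya : y = a
              · exact Or.inl hya
              · exact Or.inr (hIJ ⟨hy, hya⟩)
            · rw [e1]; exact hJ.indep
            · rw [e1]; exact fun _ => hJb
            · exact insert_subset haX hJX
            · rintro K ⟨⟨hK, hKa⟩, hKX⟩ hle y hy
              by_cases hya : y = a
              · exact Or.inl hya
              · refine Or.inr ?_
                rw [← hmaxJ (K \ {a}) hK (sdiff_subset.trans hKX)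
                  (subset_sdiff_singleton ((subset_insert _ _).trans hle) haJ) (by simp)]
                exact ⟨hy, hya⟩
          · refine ⟨J, ?_, ⟨⟨?_, ?_⟩, hJX⟩, ?_⟩
            · rwa [sdiff_singleton_eq_self (fun h => haX (hIX h))] at hIJ
            · rw [sdiff_singleton_eq_self haJ]; exact hJ.indep
            · exact fun h => absurd h haJ
            · rintro K ⟨⟨hK, hKa⟩, hKX⟩ hle
              have haK : a ∉ K := fun h => haX (hKX h)
              rw [sdiff_singleton_eq_self haK] at hK
              exact (hmaxJ K hK hKX hle haK).subset
      subset_ground := by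
        rintro I ⟨hI, -⟩ x hx
        by_cases hxa : x = a
        · exact Or.inl hxa
        · exact Or.inr (hI.subset_ground ⟨hx, hxa⟩).1 }

theorem freeExtension_ground (M : Matroid α) (a : α) : (M.freeExtension a).E = insert a M.E := rfl

theorem freeExtension_indep_iff (M : Matroid α) (a : α) (I : Set α) :
    (M.freeExtension a).Indep I ↔
      (M ＼ {a}).Indep (I \ {a}) ∧ (a ∈ I → ¬ (M ＼ {a}).IsBase (I \ {a})) := Iff.rfl

/-- The bases of the free extension. -/
theorem freeExtension_isBase_iff (M : Matroid α) {a : α} (ha : a ∉ M.E) (B : Set α) :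
    (M.freeExtension a).IsBase B ↔
      M.IsBase B ∨ ∃ B', M.IsBase B' ∧ ∃ b ∈ B', B = insert a (B' \ {b}) := by
  have hN : M ＼ {a} = M := by
    rw [delete_eq_self_iff]
    exact disjoint_singleton_left.2 ha
  have hind : ∀ I, (M.freeExtension a).Indep I ↔
      M.Indep (I \ {a}) ∧ (a ∈ I → ¬ M.IsBase (I \ {a})) := fun I => by
    rw [freeExtension_indep_iff, hN]
  rw [isBase_iff_maximal_indep]
  constructor
  · rintro ⟨hB, hmax⟩
    obtain ⟨hB1, hB2⟩ := (hind B).1 hB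
    obtain ⟨C, hC, hBC⟩ := hB1.exists_isBase_superset
    have haC : a ∉ C := fun h => ha (hC.subset_ground h)
    by_cases haB : a ∈ B
    · right
      obtain ⟨w, hwC, hwB⟩ := exists_of_ssubset
        (hBC.ssubset_of_ne (by rintro h; exact hB2 haB (h ▸ hC)))
      have hwa : w ≠ a := fun h => haC (h ▸ hwC)
      have hss : insert w (B \ {a}) ⊆ C := insert_subset hwC hBC
      have hCw : insert w (B \ {a}) = C := by
        by_contra hne
        have hnb : ¬ M.IsBase (insert w (B \ {a})) := fun h => hne (h.eq_of_subset_isBase hC hss)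
        refine hwB ⟨hmax (y := insert w B) ((hind _).2 ⟨?_, ?_⟩) (subset_insert _ _)
          (mem_insert _ _), hwa⟩
        · rw [← insert_sdiff_singleton_comm hwa]; exact hC.indep.subset hss
        · rw [← insert_sdiff_singleton_comm hwa]; exact fun _ => hnb
      refine ⟨C, hC, w, hwC, ?_⟩
      rw [← hCw, insert_sdiff_of_mem _ (mem_singleton w), sdiff_singleton_eq_self hwB,
        insert_sdiff_singleton, insert_eq_of_mem haB]
    · left
      rw [sdiff_singleton_eq_self haB] at hBC
      have : C ⊆ B := hmax (y := C)
        ((hind C).2 ⟨by rw [sdiff_singleton_eq_self haC]; exact hC.indep, fun h => absurd h haC⟩) hBC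
      rwa [hBC.antisymm this]
  · rintro (hB | ⟨B', hB', b, hb, rfl⟩)
    · have haB : a ∉ B := fun h => ha (hB.subset_ground h)
      refine ⟨(hind B).2 ⟨by rw [sdiff_singleton_eq_self haB]; exact hB.indep,
        fun h => absurd h haB⟩, ?_⟩
      intro K hK hle
      obtain ⟨hK1, hK2⟩ := (hind K).1 hK
      have hEq := hB.eq_of_subset_indep hK1 (subset_sdiff_singleton hle haB)
      have haK : a ∉ K := fun h => hK2 h (hEq ▸ hB)
      rw [sdiff_singleton_eq_self haK] at hEq
      exact hEq.symm.subset
    · have haB' : a ∉ B' := fun h => ha (hB'.subset_ground h)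
      have e1 : insert a (B' \ {b}) \ {a} = B' \ {b} := by
        rw [insert_sdiff_of_mem _ (mem_singleton a), sdiff_singleton_eq_self (fun h => haB' h.1)]
      have hnb : ¬ M.IsBase (B' \ {b}) := fun h =>
        ((h.eq_of_subset_isBase hB' sdiff_subset).symm.subset hb).2 rfl
      refine ⟨(hind _).2 ⟨by rw [e1]; exact hB'.indep.subset sdiff_subset,
        fun _ => by rwa [e1]⟩, ?_⟩
      intro K hK hle y hy
      obtain ⟨hK1, hK2⟩ := (hind K).1 hK
      by_contra hyn
      have hya : y ≠ a := fun h => hyn (Or.inl h)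
      have hyJx : y ∉ B' \ {b} := fun h => hyn (Or.inr h)
      have hss : insert y (B' \ {b}) ⊆ K \ {a} :=
        insert_subset ⟨hy, hya⟩ fun w hw => ⟨hle (Or.inr hw), fun h => haB' (h ▸ hw.1)⟩
      have hbase : M.IsBase (insert y (B' \ {b})) :=
        insert_isBase_of_insert_indep (e := b) (by simp) hyJx
          (by rwa [insert_sdiff_singleton, insert_eq_of_mem hb]) (hK1.subset hss)
      exact hK2 (hle (mem_insert _ _)) (hbase.eq_of_subset_indep hK1 hss ▸ hbase)

/-- A matroid is connected if it is not a nontrivial direct sum. -/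
def IsConnected (M : Matroid α) : Prop :=
  ∀ (M₁ M₂ : Matroid α) (h : Disjoint M₁.E M₂.E), M = M₁.disjointSum M₂ h → M₁.E = ∅ ∨ M₂.E = ∅

/-- The free coextension of a matroid by a new element `a`: the dual of the free extension of the
dual. -/
def freeCoextension (M : Matroid α) (a : α) : Matroid α := (M✶.freeExtension a)✶

end Matroid

/-- The twelve lines of the matroid `Qsing`. -/
def singLines : Finset (Finset ℕ) :=
  {{1, 2, 6, 8}, {1, 3, 5, 7}, {1, 9, 12}, {2, 4, 5, 9}, {2, 7, 11}, {3, 4, 6},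
    {3, 8, 9}, {3, 10, 12}, {4, 7, 8}, {4, 10, 11}, {5, 6, 10}, {8, 11, 12}}

theorem singLines_inter : ∀ l ∈ singLines, ∀ l' ∈ singLines, l ≠ l' → (l ∩ l').card ≤ 1 := by
  decide

/-- The simple rank `3` matroid on `{1, …, 12}` whose lines (flats of rank `2` with at least three
elements) are the members of `singLines`: its bases are the `3`-element subsets of `{1, …, 12}` that
are contained in none of these lines. -/
def Qsing : Matroid ℕ :=
  Matroid.ofIsBaseOfFinite (E := Set.Icc 1 12) (Set.finite_Icc 1 12)
    (fun B => B ⊆ Set.Icc 1 12 ∧ B.ncard = 3 ∧ ∀ l ∈ singLines, ¬ B ⊆ (l : Set ℕ))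
    (by
      refine ⟨(({1, 2, 3} : Finset ℕ) : Set ℕ), ?_, ?_, ?_⟩
      · intro x hx
        simp at hx
        rcases hx with rfl | rfl | rfl <;> simp
      · rw [Set.ncard_coe_finset]; rfl
      · simp only [Finset.coe_subset]
        decide)
    (by
      rintro B C ⟨hBE, hB3, hBl⟩ ⟨hCE, hC3, hCl⟩ x ⟨hxB, hxC⟩
      have hBfin : B.Finite := (Set.finite_Icc 1 12).subset hBE
      have hCfin : C.Finite := (Set.finite_Icc 1 12).subset hCE
      have h2 : (B \ {x}).ncard = 2 := by rw [Set.ncard_sdiff_singleton_of_mem hxB, hB3]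
      have hcard : ∀ y ∈ C \ B, (insert y (B \ {x})).ncard = 3 := fun y hy => by
        rw [Set.ncard_insert_of_notMem (fun h => hy.2 h.1) hBfin.sdiff, h2]
      by_contra! hcon
      have hline : ∀ y ∈ C \ B, ∃ l ∈ singLines, insert y (B \ {x}) ⊆ (l : Set ℕ) := fun y hy =>
        hcon y hy (Set.insert_subset (hCE hy.1) (sdiff_subset.trans hBE)) (hcard y hy)
      obtain ⟨y, hyC, hyB⟩ : ∃ y ∈ C, y ∉ B := by
        by_contra! h
        have := Set.eq_of_subset_of_ncard_le (show C ⊆ B from h) (by omega) hBfin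
        exact hxC (this ▸ hxB)
      obtain ⟨l, hl, hyl⟩ := hline y ⟨hyC, hyB⟩
      refine hCl l hl fun z hz => ?_
      by_cases hzB : z ∈ B
      · exact hyl (Or.inr ⟨hzB, fun h => hxC (h ▸ hz)⟩)
      · obtain ⟨l', hl', hzl⟩ := hline z ⟨hz, hzB⟩
        have : l = l' := by
          by_contra hne
          have h1 := singLines_inter l hl l' hl' hne
          have h3 : (B \ {x}).ncard ≤ (l ∩ l').card := by
            rw [← Set.ncard_coe_finset]
            refine Set.ncard_le_ncard ?_ (Finset.finite_toSet _)
            rw [Finset.coe_inter]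
            exact Set.subset_inter ((Set.subset_insert _ _).trans hyl)
              ((Set.subset_insert _ _).trans hzl)
          omega
        exact this ▸ hzl (Or.inl rfl))
    (fun _ h => h.1)

/-- `k` free coextensions of `Qsing`, by the elements `13, …, 12 + k` in this order. -/
def QsingCoext : ℕ → Matroid ℕ
  | 0 => Qsing
  | k + 1 => (QsingCoext k).freeCoextension (13 + k)

/-- `k` free coextensions of `Qsing`, by the elements `13, …, 12 + k`, followed by `m` free
extensions, by the elements `13 + k, …, 12 + k + m`. -/
def QsingExt (k : ℕ) : ℕ → Matroid ℕ
  | 0 => QsingCoext k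
  | m + 1 => (QsingExt k m).freeExtension (13 + k + m)

/-- The matroid obtained from `Qsing` by `d - 3` free coextensions and then `n - (d + 9)` free
extensions (meant for `3 ≤ d` and `d + 9 ≤ n`). -/
def QsingDN (d n : ℕ) : Matroid ℕ := QsingExt (d - 3) (n - (d + 9))

/-- The pairs `(d, n)` with `3 ≤ d ≤ n / 2` that are left out. -/
def exceptionalPairs : Finset (ℕ × ℕ) :=
  {(3, 6), (3, 7), (3, 8), (3, 9), (3, 10), (3, 11), (4, 8), (4, 9), (4, 10), (4, 11), (4, 12),
    (5, 10), (5, 11), (5, 12), (5, 13), (6, 12), (6, 13), (6, 14), (7, 14), (7, 15), (8, 16)}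

/-- A reference circuit of a matroid `M` of rank `d`: a circuit with `d + 1` elements, listed in some
order `γ 0, …, γ d`. -/
structure ReferenceCircuit {α : Type*} (M : Matroid α) (d : ℕ) where
  toFun : Fin (d + 1) → α
  injective : Function.Injective toFun
  isCircuit : M.IsCircuit (Set.range toFun)
  eRank_eq : M.eRank = d

namespace ReferenceCircuit

/-- The set of those `i` for which exchanging `γ i` for `e` in the reference basis
`{γ 0, …, γ (d - 1)}` gives a basis of `M`. -/
def support {α : Type*} {M : Matroid α} {d : ℕ} (γ : ReferenceCircuit M d) (e : α) : Set (Fin d) :=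
  {i | M.IsBase (insert e ((fun j : Fin d => γ.toFun j.castSucc) '' {j | j ≠ i}))}

/-- The index set of the coordinates `x i e` of the realization space: `e` runs through the elements
outside the reference circuit and `i` through the members of the support of `e` other than the
greatest one, which is `μ(e)`. -/
def Var {α : Type*} {M : Matroid α} {d : ℕ} (γ : ReferenceCircuit M d) : Type _ :=
  {p : Fin d × α // p.2 ∈ M.E ∧ p.2 ∉ Set.range γ.toFun ∧ p.1 ∈ γ.support p.2 ∧
    ¬ IsGreatest (γ.support p.2) p.1}

open Classical in
/-- The entry in row `i` of the column of `e` in the universal normalized `d × E` matrix. The columns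
of `γ 0, …, γ (d - 1)` are the unit vectors, the column of `γ d` is the all-ones vector, and the other
columns have zeros off their support, a `1` in the last place of the support, and independent
variables in the remaining places. -/
noncomputable def entry {α : Type*} {M : Matroid α} {d : ℕ} (F : Type*) [Field F]
    (γ : ReferenceCircuit M d) (i : Fin d) (e : M.E) : MvPolynomial γ.Var F :=
  if h : (e : α) ∈ Set.range γ.toFun then
    if (e : α) = γ.toFun (Fin.last d) ∨ (e : α) = γ.toFun i.castSucc then 1 else 0
  else if hs : i ∈ γ.support e then
    if hg : IsGreatest (γ.support e) i then 1
    else MvPolynomial.X ⟨(i, e), e.2, h, hs, hg⟩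
  else 0

/-- The maximal minor of the universal normalized matrix on the columns of a tuple of elements. -/
noncomputable def minor {α : Type*} {M : Matroid α} {d : ℕ} (F : Type*) [Field F]
    (γ : ReferenceCircuit M d) (t : Fin d → M.E) : MvPolynomial γ.Var F :=
  Matrix.det (Matrix.of fun i j => γ.entry F i (t j))

/-- The ideal generated by the minors on the nonbases of `M`. (A tuple with a repeated element has
minor zero.) -/
noncomputable def nonbasisIdeal {α : Type*} {M : Matroid α} {d : ℕ} (F : Type*) [Field F]
    (γ : ReferenceCircuit M d) : Ideal (MvPolynomial γ.Var F) :=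
  Ideal.span {f | ∃ t : Fin d → M.E,
    ¬ M.IsBase (Set.range fun j => (t j : α)) ∧ f = γ.minor F t}

/-- The multiplicative set generated by the minors on the bases of `M`. -/
noncomputable def basisSubmonoid {α : Type*} {M : Matroid α} {d : ℕ} (F : Type*) [Field F]
    (γ : ReferenceCircuit M d) : Submonoid (MvPolynomial γ.Var F) :=
  Submonoid.closure {f | ∃ t : Fin d → M.E,
    M.IsBase (Set.range fun j => (t j : α)) ∧ f = γ.minor F t}

/-- The coordinate ring `U⁻¹ B / I` of the realization space of `M` over `F`, in the coordinates
given by a reference circuit: `B` is the polynomial ring in the entries of the normalized matrix, `I`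
is generated by the minors on nonbases and `U` by the minors on bases. -/
abbrev RealizationRing {α : Type*} {M : Matroid α} {d : ℕ} (F : Type*) [Field F]
    (γ : ReferenceCircuit M d) : Type _ :=
  Localization ((γ.basisSubmonoid F).map (Ideal.Quotient.mk (γ.nonbasisIdeal F)))

end ReferenceCircuit

/-- The coordinate ring `ℂ[u, v, z₁, …, zₘ] / (u v)` of the product of the node `u v = 0` and affine
`m`-space. -/
abbrev NodeRing (m : ℕ) : Type :=
  MvPolynomial (Fin (m + 2)) ℂ ⧸
    Ideal.span {(MvPolynomial.X 0 * MvPolynomial.X 1 : MvPolynomial (Fin (m + 2)) ℂ)}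

/-- The ideal of the origin in `NodeRing m`. -/
noncomputable def nodeOrigin (m : ℕ) : Ideal (NodeRing m) :=
  Ideal.span (Set.range fun i : Fin (m + 2) => Ideal.Quotient.mk _ (MvPolynomial.X i))

/-- The point `p` of `Spec R` is a nodal singularity: for some `m`, the pointed scheme `(Spec R, p)`
and the product of a node with affine `m`-space, pointed at the origin, have a common étale
neighbourhood. (So for curves, where `m = 0`, the point `p` is a node.) -/
def IsNodalPoint (R : Type) [CommRing R] [Algebra ℂ R] (p : Ideal R) : Prop :=
  ∃ (m : ℕ) (S : Type) (_ : CommRing S) (_ : Algebra ℂ S)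
    (f : R →ₐ[ℂ] S) (g : NodeRing m →ₐ[ℂ] S) (q : Ideal S),
    f.toRingHom.Etale ∧ g.toRingHom.Etale ∧ q.IsPrime ∧
      q.comap f = p ∧ q.comap g = nodeOrigin m

/-- `Spec R` has nodal singularities: there is a closed point at which it is not smooth over `ℂ`, and
every such point is a nodal singularity. -/
def HasNodalSingularities (R : Type) [CommRing R] [Algebra ℂ R] : Prop :=
  (∃ p : MaximalSpectrum R, ¬ Algebra.IsSmoothAt ℂ p.asIdeal) ∧
    ∀ p : MaximalSpectrum R, ¬ Algebra.IsSmoothAt ℂ p.asIdeal → IsNodalPoint R p.asIdeal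

/-! The coordinate ring attached to a reference circuit represents a functor: its homomorphisms to a
ℂ-algebra `T` correspond to the matrices over `T` whose maximal minors are units on bases and zero
on nonbases, up to row operations and rescaling of columns (`IsModuli`). Each class contains a
normal form for the circuit, unique on the ground set, and the entries of the normal form are the
coordinates of the ring. By Yoneda (`IsModuli.nonempty_algEquiv`) the ring does not depend on the
circuit, and any other universal matrix computes it.

For `Qsing`, eleven of the twelve lines can be solved successively. They leave the two-parameter
matrix `singMatrix a v`, and the remaining line {3, 10, 12} imposes (a² - a + 1) v = 0
(`exists_projEquiv_singMatrix`). The realization space is therefore open in the union of the line v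
= 0 with the two lines on which a is a primitive sixth root of unity. Since a² - a + 1 is separable,
the crossings are nodes (`CurveRing.isNodeAt`) and all other points are smooth. A finite check in
the Eisenstein integers shows that the crossings satisfy all the open conditions
(`det₃_singColumn_ne_zero`).

A free extension adjoins a column in general position, and a free coextension adjoins a generic row.
Neither imposes a new equation, so the new realization space is open in the product of the old one
with an affine space. Every ℂ-point lifts, because finitely many nonzero linear forms can be made
nonzero at once over an infinite field. Smoothness passes both ways along such maps and nodes ascend
(`HasNodalSingularities.ascend`), so induction gives all the matroids. Connectedness follows from a
spanning circuit and the absence of loops. The exceptional pairs are exactly those with 2d ≤ n < d +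
9, for which the construction would need a negative number of extensions. -/

/-! ### Closed points as homomorphisms to ℂ: smoothness and nodes -/

instance ker_algHom_isPrime {R : Type} [CommRing R] [Algebra ℂ R] (π : R →ₐ[ℂ] ℂ) :
    (RingHom.ker π).IsPrime := RingHom.ker_isPrime (π : R →+* ℂ)

/-- Lifting criterion for smoothness at the closed point `π`. -/
theorem isSmoothAt_ker_iff {R : Type} [CommRing R] [Algebra ℂ R] (π : R →ₐ[ℂ] ℂ) :
    Algebra.IsSmoothAt ℂ (RingHom.ker π) ↔
      ∀ (B : Type) [CommRing B] [Algebra ℂ B] (I : Ideal B), I ^ 2 = ⊥ →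
        ∀ h : R →ₐ[ℂ] B ⧸ I, (∀ x, π x ≠ 0 → IsUnit (h x)) →
          ∃ h' : R →ₐ[ℂ] B, (Ideal.Quotient.mkₐ ℂ I).comp h' = h := by
  constructor
  · intro hs B _ _ I hI h hu
    have hu' : ∀ y : (RingHom.ker π).primeCompl, IsUnit (h y) := fun y => hu y y.2
    let h₁ : Localization.AtPrime (RingHom.ker π) →ₐ[ℂ] B ⧸ I := IsLocalization.liftAlgHom hu'
    obtain ⟨h₂, hh⟩ := Algebra.FormallySmooth.comp_surjective ℂ _ I hI h₁
    refine ⟨h₂.comp (IsScalarTower.toAlgHom ℂ R _), ?_⟩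
    rw [← AlgHom.comp_assoc, hh]
    ext x
    simp [h₁]
  · intro H
    refine Algebra.FormallySmooth.of_comp_surjective fun B _ _ I hI h => ?_
    obtain ⟨h', hh⟩ := H B I hI (h.comp (IsScalarTower.toAlgHom ℂ R _)) fun x hx => by
      have : IsUnit (algebraMap R (Localization.AtPrime (RingHom.ker π)) x) :=
        IsLocalization.map_units _ (⟨x, hx⟩ : (RingHom.ker π).primeCompl)
      exact this.map h
    have hh' : ∀ x, Ideal.Quotient.mk I (h' x) = h (algebraMap R _ x) := fun x =>
      DFunLike.congr_fun hh x
    -- A unit modulo a square-zero ideal is a unit, so the lift on `R` extends to the local ring.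
    have hu' : ∀ y : (RingHom.ker π).primeCompl, IsUnit (h' y) := fun y => by
      apply (IsNilpotent.isUnit_quotient_mk_iff ⟨2, hI⟩).mp
      rw [hh']
      exact (IsLocalization.map_units _ y).map h
    refine ⟨IsLocalization.liftAlgHom hu', ?_⟩
    apply AlgHom.coe_ringHom_injective
    refine IsLocalization.ringHom_ext (RingHom.ker π).primeCompl ?_
    ext x
    simpa using hh' x

/-- Nullstellensatz: the residue field at `p` is finite over the algebraically closed field ℂ, hence
equal to it. -/
theorem exists_algHom_ker_eq {R : Type} [CommRing R] [Algebra ℂ R] [Algebra.FiniteType ℂ R]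
    (p : Ideal R) [p.IsMaximal] : ∃ π : R →ₐ[ℂ] ℂ, RingHom.ker π = p := by
  let := Ideal.Quotient.field p
  have : Module.Finite ℂ (R ⧸ p) := finite_of_finite_type_of_isJacobsonRing ℂ (R ⧸ p)
  have hb : Function.Bijective (algebraMap ℂ (R ⧸ p)) :=
    IsAlgClosed.algebraMap_bijective_of_isIntegral
  let e : ℂ ≃ₐ[ℂ] (R ⧸ p) := AlgEquiv.ofBijective (Algebra.ofId ℂ (R ⧸ p)) hb
  refine ⟨(e.symm : (R ⧸ p) →ₐ[ℂ] ℂ).comp (Ideal.Quotient.mkₐ ℂ p), ?_⟩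
  ext x
  simp [RingHom.mem_ker, Ideal.Quotient.eq_zero_iff_mem]

/-- The node condition at the closed point `π`, with the prime of the common étale neighbourhood
replaced by a point with values in a field. -/
def IsNodeAt {R : Type} [CommRing R] [Algebra ℂ R] (π : R →ₐ[ℂ] ℂ) : Prop :=
  ∃ (m : ℕ) (S : Type) (_ : CommRing S) (_ : Algebra ℂ S)
    (f : R →ₐ[ℂ] S) (g : NodeRing m →ₐ[ℂ] S) (K : Type) (_ : Field K) (_ : Algebra ℂ K)
    (θ : S →ₐ[ℂ] K),
    f.toRingHom.Etale ∧ g.toRingHom.Etale ∧ θ.comp f = (Algebra.ofId ℂ K).comp π ∧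
      ∀ i, θ (g (Ideal.Quotient.mk _ (MvPolynomial.X i))) = 0

/-- Modulo the variables every class is a constant, and constants inject into `K`. -/
theorem ker_eq_nodeOrigin {m : ℕ} {K : Type} [Field K] [Algebra ℂ K] (θ : NodeRing m →ₐ[ℂ] K)
    (h : ∀ i, θ (Ideal.Quotient.mk _ (MvPolynomial.X i)) = 0) :
    RingHom.ker θ = nodeOrigin m := by
  apply le_antisymm
  · have key : ∀ f : MvPolynomial (Fin (m + 2)) ℂ, ∃ c : ℂ,
        (Ideal.Quotient.mk _ f : NodeRing m) - algebraMap ℂ _ c ∈ nodeOrigin m := by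
      intro f
      induction f using MvPolynomial.induction_on with
      | C a => exact ⟨a, by
          rw [show (Ideal.Quotient.mk _ (MvPolynomial.C a) : NodeRing m) = algebraMap ℂ _ a from rfl,
            sub_self]
          exact zero_mem _⟩
      | add p q hp hq =>
        obtain ⟨a, ha⟩ := hp
        obtain ⟨b, hb⟩ := hq
        refine ⟨a + b, ?_⟩
        rw [map_add, map_add, add_sub_add_comm]
        exact add_mem ha hb
      | mul_X p i hp =>
        refine ⟨0, ?_⟩
        rw [map_zero, sub_zero, map_mul]
        exact Ideal.mul_mem_left _ _ (Ideal.subset_span ⟨i, rfl⟩)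
    have hle : nodeOrigin m ≤ RingHom.ker θ := by
      refine Ideal.span_le.2 ?_
      rintro _ ⟨i, rfl⟩
      exact h i
    intro x hx
    obtain ⟨f, rfl⟩ := Ideal.Quotient.mk_surjective x
    obtain ⟨c, hc⟩ := key f
    have h1 := hle hc
    rw [RingHom.mem_ker] at hx h1
    rw [map_sub, hx, zero_sub, neg_eq_zero, AlgHom.commutes] at h1
    have : c = 0 := (algebraMap ℂ K).injective (by rw [h1, map_zero])
    rwa [this, map_zero, sub_zero] at hc
  · refine Ideal.span_le.2 ?_
    rintro _ ⟨i, rfl⟩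
    exact h i

theorem ker_ofId_comp {R : Type} [CommRing R] [Algebra ℂ R] (K : Type) [Field K] [Algebra ℂ K]
    (π : R →ₐ[ℂ] ℂ) : RingHom.ker ((Algebra.ofId ℂ K).comp π) = RingHom.ker π := by
  ext x
  rw [RingHom.mem_ker, RingHom.mem_ker, AlgHom.comp_apply]
  exact map_eq_zero_iff _ (algebraMap ℂ K).injective

/-- The prime `q` becomes the point with values in its residue field; there `f` agrees with `π`
because `x - π x` lies in the kernel of `π`. Conversely the kernel of `θ` is the required prime. -/
theorem isNodalPoint_ker_iff {R : Type} [CommRing R] [Algebra ℂ R] (π : R →ₐ[ℂ] ℂ) :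
    IsNodalPoint R (RingHom.ker π) ↔ IsNodeAt π := by
  constructor
  · rintro ⟨m, S, _, _, f, g, q, hf, hg, hq, hqf, hqg⟩
    let θ : S →ₐ[ℂ] q.ResidueField := IsScalarTower.toAlgHom ℂ S q.ResidueField
    have hθ : ∀ x, θ x = 0 ↔ x ∈ q := fun x => by
      simp [θ, Ideal.algebraMap_residueField_eq_zero]
    refine ⟨m, S, _, _, f, g, q.ResidueField, inferInstance, inferInstance, θ, hf, hg, ?_, ?_⟩
    · ext x
      have h1 : x - algebraMap ℂ R (π x) ∈ RingHom.ker π := by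
        rw [RingHom.mem_ker, map_sub, AlgHom.commutes]
        simp
      rw [← hqf, Ideal.mem_comap, ← hθ] at h1
      simp only [map_sub, AlgHom.commutes, sub_eq_zero] at h1
      exact h1
    · intro i
      rw [hθ, ← Ideal.mem_comap, hqg]
      exact Ideal.subset_span ⟨i, rfl⟩
  · rintro ⟨m, S, _, _, f, g, K, _, _, θ, hf, hg, h1, h2⟩
    refine ⟨m, S, _, _, f, g, RingHom.ker θ, hf, hg, RingHom.ker_isPrime _, ?_, ?_⟩
    · rw [← ker_ofId_comp K π, ← h1]
      rfl
    · exact ker_eq_nodeOrigin (θ.comp g) h2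

theorem hasNodalSingularities_iff {R : Type} [CommRing R] [Algebra ℂ R] [Algebra.FiniteType ℂ R] :
    HasNodalSingularities R ↔
      (∃ π : R →ₐ[ℂ] ℂ, ¬ Algebra.IsSmoothAt ℂ (RingHom.ker π)) ∧
        ∀ π : R →ₐ[ℂ] ℂ, ¬ Algebra.IsSmoothAt ℂ (RingHom.ker π) → IsNodeAt π := by
  have hmax : ∀ π : R →ₐ[ℂ] ℂ, (RingHom.ker π).IsMaximal := fun π =>
    RingHom.ker_isMaximal_of_surjective _ fun c => ⟨algebraMap ℂ R c, by simp⟩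
  constructor
  · rintro ⟨⟨⟨p, hp⟩, h1⟩, h2⟩
    refine ⟨?_, fun π hπ => (isNodalPoint_ker_iff π).1 (h2 ⟨_, hmax π⟩ hπ)⟩
    obtain ⟨π, rfl⟩ := exists_algHom_ker_eq p
    exact ⟨π, h1⟩
  · rintro ⟨⟨π, h1⟩, h2⟩
    refine ⟨⟨⟨_, hmax π⟩, h1⟩, ?_⟩
    rintro ⟨p, hp⟩ h
    obtain ⟨π, rfl⟩ := exists_algHom_ker_eq p
    exact (isNodalPoint_ker_iff π).2 (h2 π h)

theorem HasNodalSingularities.of_algEquiv {R R' : Type} [CommRing R] [Algebra ℂ R] [CommRing R']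
    [Algebra ℂ R'] [Algebra.FiniteType ℂ R] (e : R ≃ₐ[ℂ] R') (h : HasNodalSingularities R) :
    HasNodalSingularities R' := by
  have : Algebra.FiniteType ℂ R' := Algebra.FiniteType.equiv ‹_› e
  rw [hasNodalSingularities_iff] at h ⊢
  have hs : ∀ π : R →ₐ[ℂ] ℂ,
      Algebra.IsSmoothAt ℂ (RingHom.ker (π.comp (e.symm : R' →ₐ[ℂ] R))) →
        Algebra.IsSmoothAt ℂ (RingHom.ker π) := by
    intro π hπ
    rw [isSmoothAt_ker_iff] at hπ ⊢
    intro B _ _ I hI k hk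
    obtain ⟨k', hk'⟩ := hπ B I hI (k.comp (e.symm : R' →ₐ[ℂ] R)) fun x hx => hk _ hx
    refine ⟨k'.comp (e : R →ₐ[ℂ] R'), ?_⟩
    rw [← AlgHom.comp_assoc, hk']
    ext x
    simp
  have hs' : ∀ π : R' →ₐ[ℂ] ℂ,
      Algebra.IsSmoothAt ℂ (RingHom.ker (π.comp (e : R →ₐ[ℂ] R'))) →
        Algebra.IsSmoothAt ℂ (RingHom.ker π) := by
    intro π hπ
    rw [isSmoothAt_ker_iff] at hπ ⊢
    intro B _ _ I hI k hk
    obtain ⟨k', hk'⟩ := hπ B I hI (k.comp (e : R →ₐ[ℂ] R')) fun x hx => hk _ hx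
    refine ⟨k'.comp (e.symm : R' →ₐ[ℂ] R), ?_⟩
    rw [← AlgHom.comp_assoc, hk']
    ext x
    simp
  obtain ⟨⟨π, hπ⟩, h2⟩ := h
  refine ⟨⟨π.comp (e.symm : R' →ₐ[ℂ] R), fun h => hπ (hs π h)⟩, fun π' hπ' => ?_⟩
  obtain ⟨m, S, _, _, f, g, K, _, _, θ, hf, hg, h3, h4⟩ :=
    h2 (π'.comp (e : R →ₐ[ℂ] R')) fun h => hπ' (hs' π' h)
  refine ⟨m, S, _, _, f.comp (e.symm : R' →ₐ[ℂ] R), g, K, _, _, θ, ?_, hg, ?_, h4⟩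
  · exact RingHom.Etale.stableUnderComposition e.symm.toRingEquiv.toRingHom f.toRingHom
      (.of_bijective e.symm.bijective) hf
  · rw [← AlgHom.comp_assoc, h3]
    ext x
    simp

/-! ### Ascent and descent along localizations of polynomial rings -/

section Ascent

variable {R : Type} [CommRing R] [Algebra ℂ R] {σ : Type}
  {R' : Type} [CommRing R'] [Algebra ℂ R'] [Algebra R R'] [IsScalarTower ℂ R R']
  [Algebra (MvPolynomial σ R) R'] [IsScalarTower R (MvPolynomial σ R) R']
  [IsScalarTower ℂ (MvPolynomial σ R) R']

/-- Smoothness ascends to localizations of polynomial rings. -/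
theorem isSmoothAt_ker_of_isSmoothAt_ker_comp (W : Submonoid (MvPolynomial σ R))
    [IsLocalization W R'] (π' : R' →ₐ[ℂ] ℂ)
    (h : Algebra.IsSmoothAt ℂ (RingHom.ker (π'.comp (IsScalarTower.toAlgHom ℂ R R')))) :
    Algebra.IsSmoothAt ℂ (RingHom.ker π') := by
  rw [isSmoothAt_ker_iff] at h ⊢
  intro B _ _ I hI k hk
  obtain ⟨k₀, hk₀⟩ := h B I hI (k.comp (IsScalarTower.toAlgHom ℂ R R')) fun x hx => hk _ hx
  -- The images of the variables may be lifted arbitrarily; smoothness is needed only for the lift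
  -- on `R`.
  choose b hb using fun i : σ =>
    Ideal.Quotient.mk_surjective (k (algebraMap (MvPolynomial σ R) R' (MvPolynomial.X i)))
  let k₁ : MvPolynomial σ R →+* B := MvPolynomial.eval₂Hom k₀.toRingHom b
  have hk₁ : ∀ f, Ideal.Quotient.mk I (k₁ f) = k (algebraMap (MvPolynomial σ R) R' f) := by
    have : (Ideal.Quotient.mk I).comp k₁ =
        (k : R' →+* B ⧸ I).comp (algebraMap (MvPolynomial σ R) R') := by
      apply MvPolynomial.ringHom_ext
      · intro r
        have := DFunLike.congr_fun hk₀ r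
        simp only [k₁, RingHom.comp_apply, MvPolynomial.coe_eval₂Hom, MvPolynomial.eval₂_C]
        refine this.trans ?_
        simp only [AlgHom.comp_apply, IsScalarTower.coe_toAlgHom', RingHom.coe_coe]
        rw [IsScalarTower.algebraMap_apply R (MvPolynomial σ R) R']
        rfl
      · intro i
        simp [k₁, hb]
    exact fun f => RingHom.congr_fun this f
  have hu : ∀ w : W, IsUnit (k₁ w) := fun w => by
    apply (IsNilpotent.isUnit_quotient_mk_iff ⟨2, hI⟩).mp
    rw [hk₁]
    exact (IsLocalization.map_units R' w).map k
  have hl : ∀ f, IsLocalization.lift hu (algebraMap (MvPolynomial σ R) R' f) = k₁ f :=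
    IsLocalization.lift_eq hu
  let k₂ : R' →ₐ[ℂ] B :=
    { (IsLocalization.lift hu : R' →+* B) with
      commutes' := fun c => by
        refine Eq.trans ?_ (k₀.commutes c)
        change IsLocalization.lift hu (algebraMap ℂ R' c) = _
        rw [IsScalarTower.algebraMap_apply ℂ (MvPolynomial σ R) R', hl,
          IsScalarTower.algebraMap_apply ℂ R (MvPolynomial σ R)]
        simp [k₁, MvPolynomial.algebraMap_eq] }
  refine ⟨k₂, ?_⟩
  apply AlgHom.coe_ringHom_injective
  refine IsLocalization.ringHom_ext W ?_
  refine RingHom.ext fun f => ?_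
  refine Eq.trans ?_ (hk₁ f)
  change Ideal.Quotient.mk I (IsLocalization.lift hu _) = _
  rw [hl]

/-- Smoothness descends from a localization of a polynomial ring. -/
theorem isSmoothAt_ker_comp_of_isSmoothAt_ker (W : Submonoid (MvPolynomial σ R))
    [IsLocalization W R'] (π' : R' →ₐ[ℂ] ℂ) (h : Algebra.IsSmoothAt ℂ (RingHom.ker π')) :
    Algebra.IsSmoothAt ℂ (RingHom.ker (π'.comp (IsScalarTower.toAlgHom ℂ R R'))) := by
  rw [isSmoothAt_ker_iff] at h ⊢
  intro B _ _ I hI k hk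
  -- Freezing the variables at their values under `π'` gives a retraction `ev` of the polynomial
  -- ring onto `R` that is compatible with `π'`. Composition with `ev` turns a lifting problem for
  -- `R` into one for `R'`.
  let c : σ → ℂ := fun i => π' (algebraMap (MvPolynomial σ R) R' (MvPolynomial.X i))
  let ev : MvPolynomial σ R →+* R := MvPolynomial.eval fun i => algebraMap ℂ R (c i)
  have hev : ∀ f, π' (algebraMap R R' (ev f)) = π' (algebraMap (MvPolynomial σ R) R' f) := by
    have : ((π' : R' →+* ℂ).comp (algebraMap R R')).comp ev =
        (π' : R' →+* ℂ).comp (algebraMap (MvPolynomial σ R) R') := by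
      apply MvPolynomial.ringHom_ext
      · intro r
        simp only [ev, RingHom.comp_apply, MvPolynomial.eval_C]
        rw [IsScalarTower.algebraMap_apply R (MvPolynomial σ R) R']
        rfl
      · intro i
        simp only [ev, RingHom.comp_apply, MvPolynomial.eval_X]
        rw [← IsScalarTower.algebraMap_apply ℂ R R']
        simp [c]
    exact fun f => RingHom.congr_fun this f
  have hu : ∀ f, π' (algebraMap (MvPolynomial σ R) R' f) ≠ 0 → IsUnit (k (ev f)) := fun f hf =>
    hk _ (by rw [← hev] at hf; exact hf)
  have hW : ∀ w : W, π' (algebraMap (MvPolynomial σ R) R' w) ≠ 0 := fun w =>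
    ((IsLocalization.map_units R' w).map π').ne_zero
  have huW : ∀ w : W, IsUnit (((k : R →+* B ⧸ I).comp ev) w) := fun w => hu w (hW w)
  have hl : ∀ f, IsLocalization.lift huW (algebraMap (MvPolynomial σ R) R' f) = k (ev f) :=
    IsLocalization.lift_eq huW
  let k₁ : R' →ₐ[ℂ] B ⧸ I :=
    { (IsLocalization.lift huW : R' →+* B ⧸ I) with
      commutes' := fun c => by
        change IsLocalization.lift huW (algebraMap ℂ R' c) = _
        rw [IsScalarTower.algebraMap_apply ℂ (MvPolynomial σ R) R', hl,
          IsScalarTower.algebraMap_apply ℂ R (MvPolynomial σ R)]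
        simp [ev, MvPolynomial.algebraMap_eq] }
  have hk₁ : ∀ f, k₁ (algebraMap (MvPolynomial σ R) R' f) = k (ev f) := hl
  obtain ⟨k₂, hk₂⟩ := h B I hI k₁ fun x hx => by
    obtain ⟨⟨f, w⟩, hfw⟩ := IsLocalization.surj W x
    dsimp only at hfw
    have h1 : IsUnit (k₁ (x * algebraMap (MvPolynomial σ R) R' w)) := by
      rw [hfw, hk₁]
      refine hu f ?_
      rw [← hfw, map_mul]
      exact mul_ne_zero hx (hW w)
    rw [map_mul] at h1
    exact isUnit_of_mul_isUnit_left h1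
  refine ⟨k₂.comp (IsScalarTower.toAlgHom ℂ R R'), ?_⟩
  rw [← AlgHom.comp_assoc, hk₂]
  ext r
  simp only [AlgHom.comp_apply, IsScalarTower.coe_toAlgHom']
  rw [IsScalarTower.algebraMap_apply R (MvPolynomial σ R) R', hk₁]
  simp [ev, MvPolynomial.algebraMap_eq]

/-- The variables of `NodeRing (m + k)` split into those of `NodeRing m` and `k` others. -/
def nodeVars (m k : ℕ) : Fin (m + 2) ⊕ Fin k ≃ Fin (m + k + 2) :=
  finSumFinEquiv.trans (finCongr (by omega))

theorem nodeVars_zero (m k : ℕ) : nodeVars m k (Sum.inl 0) = 0 := by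
  ext
  simp [nodeVars]

theorem nodeVars_one (m k : ℕ) : nodeVars m k (Sum.inl 1) = 1 := by
  ext
  simp [nodeVars]

/-- The product of the node with affine space, in coordinates translated by `c`. -/
theorem exists_nodeRing_bijective (m k : ℕ) (e : σ ≃ Fin k) (c : σ → ℂ) :
    ∃ ν : NodeRing (m + k) →ₐ[ℂ] MvPolynomial σ (NodeRing m), Function.Bijective ν ∧
      (∀ i, ν (Ideal.Quotient.mk _ (MvPolynomial.X (nodeVars m k (Sum.inl i)))) =
        MvPolynomial.C (Ideal.Quotient.mk _ (MvPolynomial.X i))) ∧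
      (∀ i, ν (Ideal.Quotient.mk _ (MvPolynomial.X (nodeVars m k (Sum.inr (e i))))) =
        MvPolynomial.X i - algebraMap ℂ _ (c i)) := by
  let x : Fin (m + k + 2) → MvPolynomial σ (NodeRing m) := fun i =>
    Sum.elim (fun i => MvPolynomial.C (Ideal.Quotient.mk _ (MvPolynomial.X i)))
      (fun j => MvPolynomial.X (e.symm j) - algebraMap ℂ _ (c (e.symm j))) ((nodeVars m k).symm i)
  have hxl : ∀ i, x (nodeVars m k (Sum.inl i)) =
      MvPolynomial.C (Ideal.Quotient.mk _ (MvPolynomial.X i)) := fun i => by simp [x]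
  have hxr : ∀ i, x (nodeVars m k (Sum.inr (e i))) =
      MvPolynomial.X i - algebraMap ℂ _ (c i) := fun i => by simp [x]
  have hx0 := hxl 0
  have hx1 := hxl 1
  rw [nodeVars_zero] at hx0
  rw [nodeVars_one] at hx1
  have hxy : ∀ l : ℕ, (Ideal.Quotient.mk _ (MvPolynomial.X 0) : NodeRing l) *
      Ideal.Quotient.mk _ (MvPolynomial.X 1) = 0 := fun l => by
    rw [← map_mul, Ideal.Quotient.eq_zero_iff_mem]
    exact Ideal.subset_span rfl
  let ν : NodeRing (m + k) →ₐ[ℂ] MvPolynomial σ (NodeRing m) :=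
    Ideal.Quotient.liftₐ _ (MvPolynomial.aeval x) (by
      intro a ha
      refine (Ideal.span_le.2 ?_ : _ ≤ RingHom.ker (MvPolynomial.aeval x)) ha
      rintro _ rfl
      simp only [SetLike.mem_coe, RingHom.mem_ker, map_mul, MvPolynomial.aeval_X]
      rw [hx0, hx1, ← MvPolynomial.C_mul, hxy, MvPolynomial.C_0])
  have hν : ∀ i, ν (Ideal.Quotient.mk _ (MvPolynomial.X i)) = x i := fun i => by
    change MvPolynomial.aeval x (MvPolynomial.X i) = _
    simp
  let κ : NodeRing m →ₐ[ℂ] NodeRing (m + k) :=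
    Ideal.Quotient.liftₐ _ (MvPolynomial.aeval fun i =>
      Ideal.Quotient.mk _ (MvPolynomial.X (nodeVars m k (Sum.inl i)))) (by
      intro a ha
      refine (Ideal.span_le.2 ?_ : _ ≤ RingHom.ker (MvPolynomial.aeval _)) ha
      rintro _ rfl
      simp only [SetLike.mem_coe, RingHom.mem_ker, map_mul, MvPolynomial.aeval_X]
      rw [nodeVars_zero, nodeVars_one, hxy])
  have hκ : ∀ i, κ (Ideal.Quotient.mk _ (MvPolynomial.X i)) =
      Ideal.Quotient.mk _ (MvPolynomial.X (nodeVars m k (Sum.inl i))) := fun i => by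
    change MvPolynomial.aeval _ (MvPolynomial.X i) = _
    simp
  let μ : MvPolynomial σ (NodeRing m) →+* NodeRing (m + k) :=
    MvPolynomial.eval₂Hom (κ : NodeRing m →+* NodeRing (m + k)) fun i =>
      Ideal.Quotient.mk _ (MvPolynomial.X (nodeVars m k (Sum.inr (e i)))) + algebraMap ℂ _ (c i)
  have hμC : ∀ a : ℂ, μ (algebraMap ℂ _ a) = algebraMap ℂ _ a := fun a => by
    rw [IsScalarTower.algebraMap_apply ℂ (NodeRing m) (MvPolynomial σ (NodeRing m)),
      MvPolynomial.algebraMap_eq]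
    simp [μ]
  have h1 : (μ.comp (ν : NodeRing (m + k) →+* _)) = RingHom.id _ := by
    apply Ideal.Quotient.ringHom_ext
    apply MvPolynomial.ringHom_ext
    · intro a
      change μ (ν (algebraMap ℂ _ a)) = algebraMap ℂ _ a
      rw [AlgHom.commutes, hμC]
    · intro i
      change μ (ν (Ideal.Quotient.mk _ (MvPolynomial.X i))) = Ideal.Quotient.mk _ (MvPolynomial.X i)
      rw [hν]
      obtain ⟨j | j, rfl⟩ := (nodeVars m k).surjective i
      · rw [hxl]
        simp only [μ, MvPolynomial.coe_eval₂Hom, MvPolynomial.eval₂_C]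
        exact hκ j
      · obtain ⟨j, rfl⟩ := e.surjective j
        rw [hxr, map_sub, hμC]
        simp [μ]
  have h2 : ((ν : NodeRing (m + k) →+* _).comp μ) = RingHom.id _ := by
    apply MvPolynomial.ringHom_ext
    · intro a
      have : ν.comp κ = IsScalarTower.toAlgHom ℂ (NodeRing m) (MvPolynomial σ (NodeRing m)) := by
        apply Ideal.Quotient.algHom_ext
        apply MvPolynomial.algHom_ext
        intro i
        change ν (κ (Ideal.Quotient.mk _ (MvPolynomial.X i))) = MvPolynomial.C _
        rw [hκ, hν, hxl]
        rfl
      simp only [μ, RingHom.comp_apply, MvPolynomial.coe_eval₂Hom, MvPolynomial.eval₂_C]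
      exact DFunLike.congr_fun this a
    · intro i
      simp only [μ, RingHom.comp_apply, MvPolynomial.coe_eval₂Hom, MvPolynomial.eval₂_X,
        RingHom.coe_coe, map_add, hν, hxr, AlgHom.commutes, RingHom.id_apply]
      ring
  refine ⟨ν, ⟨?_, ?_⟩, fun i => (hν _).trans (hxl i), fun i => (hν _).trans (hxr i)⟩
  · exact Function.LeftInverse.injective (g := μ) fun y => RingHom.congr_fun h1 y
  · exact Function.RightInverse.surjective (g := μ) fun y => RingHom.congr_fun h2 y

end Ascent

section Ascent

variable {R : Type} [CommRing R] [Algebra ℂ R] {σ : Type}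
  {R' : Type} [CommRing R'] [Algebra ℂ R'] [Algebra R R'] [IsScalarTower ℂ R R']
  [Algebra (MvPolynomial σ R) R'] [IsScalarTower R (MvPolynomial σ R) R']
  [IsScalarTower ℂ (MvPolynomial σ R) R']

/-- The extension of `g` to polynomials is its base change along `A → A[σ]`, and étale maps are
stable under base change and under inverting one element afterwards. -/
theorem etale_comp_mvPolynomial_away {A S σ : Type} [CommRing A] [CommRing S] (g : A →+* S)
    (hg : g.Etale) (s : MvPolynomial σ S) :
    ((algebraMap (MvPolynomial σ S) (Localization.Away s)).comp (MvPolynomial.map g)).Etale := by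
  let := g.toAlgebra
  let := MvPolynomial.algebraMvPolynomial (σ := σ) (R := A) (S := S)
  have : Algebra.Etale A S := hg
  have h1 : Algebra.Etale (MvPolynomial σ A) (MvPolynomial σ S) :=
    Algebra.Etale.of_equiv (Algebra.IsPushout.equiv A (MvPolynomial σ A) S (MvPolynomial σ S))
  exact RingHom.Etale.stableUnderComposition _ _
    ((RingHom.etale_algebraMap (R := MvPolynomial σ A) (S := MvPolynomial σ S)).2 h1)
    (RingHom.etale_algebraMap.2 (Algebra.Etale.of_isLocalizationAway s))

/-- Nodes ascend to localizations of polynomial rings. -/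
theorem IsNodeAt.ascend [Finite σ] (w : MvPolynomial σ R) [IsLocalization.Away w R']
    (π' : R' →ₐ[ℂ] ℂ) (h : IsNodeAt (π'.comp (IsScalarTower.toAlgHom ℂ R R'))) :
    IsNodeAt π' := by
  obtain ⟨m, S, _, _, f, g, K, _, _, θ, hf, hg, h1, h2⟩ := h
  obtain ⟨k, ⟨e⟩⟩ := Finite.exists_equiv_fin σ
  let c : σ → ℂ := fun i => π' (algebraMap (MvPolynomial σ R) R' (MvPolynomial.X i))
  let F : MvPolynomial σ R →ₐ[ℂ] MvPolynomial σ S := MvPolynomial.mapAlgHom f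
  -- The new common étale neighbourhood is S[σ] with the image of `w` inverted. The point `θ`
  -- extends to it by sending the variables to the coordinates `c` of `π'`.
  let S' := Localization.Away (F w)
  let f₀ : MvPolynomial σ R →ₐ[ℂ] S' := (IsScalarTower.toAlgHom ℂ _ S').comp F
  let ev : MvPolynomial σ S →ₐ[ℂ] K :=
    { MvPolynomial.eval₂Hom (θ : S →+* K) fun i => algebraMap ℂ K (c i) with
      commutes' := fun a => by
        change MvPolynomial.eval₂Hom _ _ (algebraMap ℂ _ a) = _
        rw [IsScalarTower.algebraMap_apply ℂ S (MvPolynomial σ S)]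
        simp [MvPolynomial.algebraMap_eq] }
  have hevC : ∀ s, ev (MvPolynomial.C s) = θ s := fun s =>
    MvPolynomial.eval₂Hom_C _ _ s
  have hevX : ∀ i, ev (MvPolynomial.X i) = algebraMap ℂ K (c i) := fun i =>
    MvPolynomial.eval₂Hom_X' _ _ i
  have hevF : ∀ q, ev (F q) = algebraMap ℂ K (π' (algebraMap (MvPolynomial σ R) R' q)) := by
    have : (ev : MvPolynomial σ S →+* K).comp (F : MvPolynomial σ R →+* MvPolynomial σ S) =
        ((algebraMap ℂ K).comp (π' : R' →+* ℂ)).comp (algebraMap (MvPolynomial σ R) R') := by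
      apply MvPolynomial.ringHom_ext
      · intro r
        have := DFunLike.congr_fun h1 r
        have hF : F (MvPolynomial.C r) = MvPolynomial.C (f r) := MvPolynomial.map_C _ _
        simp only [RingHom.comp_apply, RingHom.coe_coe, hF, hevC]
        refine this.trans ?_
        simp only [AlgHom.comp_apply, IsScalarTower.coe_toAlgHom', Algebra.ofId_apply]
        rw [IsScalarTower.algebraMap_apply R (MvPolynomial σ R) R']
        rfl
      · intro i
        have hF : F (MvPolynomial.X i) = MvPolynomial.X i := MvPolynomial.map_X _ _
        simp only [RingHom.comp_apply, RingHom.coe_coe, hF, hevX, c]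
    exact fun q => RingHom.congr_fun this q
  have hwu : IsUnit (algebraMap (MvPolynomial σ R) R' w) :=
    IsLocalization.map_units R' (⟨w, 1, pow_one w⟩ : Submonoid.powers w)
  have hevw : IsUnit (ev (F w)) := by
    rw [hevF]
    exact (hwu.map π').map _
  have hevW : ∀ y : Submonoid.powers (F w), IsUnit (ev y) := by
    rintro ⟨_, n, rfl⟩
    simpa using hevw.pow n
  let θ' : S' →ₐ[ℂ] K := IsLocalization.liftAlgHom hevW
  have hθ' : ∀ q, θ' (algebraMap (MvPolynomial σ S) S' q) = ev q := fun q => by simp [θ']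
  have hf₀ : f₀.toRingHom.Etale := etale_comp_mvPolynomial_away f.toRingHom hf (F w)
  have hf₀w : ∀ y : Submonoid.powers w, IsUnit (f₀ y) := by
    rintro ⟨_, n, rfl⟩
    rw [map_pow]
    exact (IsLocalization.map_units S' (⟨F w, 1, pow_one _⟩ : Submonoid.powers (F w))).pow n
  let f' : R' →ₐ[ℂ] S' := IsLocalization.liftAlgHom hf₀w
  have hff : ∀ q, f' (algebraMap (MvPolynomial σ R) R' q) = f₀ q := fun q => by simp [f']
  -- Cancellation: R[σ] → R' and R[σ] → S' are étale, hence so is R' → S'.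
  have hf' : f'.toRingHom.Etale := by
    let := f'.toRingHom.toAlgebra
    let := f₀.toRingHom.toAlgebra
    have : IsScalarTower (MvPolynomial σ R) R' S' :=
      IsScalarTower.of_algebraMap_eq fun q => (hff q).symm
    have : Algebra.Etale (MvPolynomial σ R) R' := Algebra.Etale.of_isLocalizationAway w
    have : Algebra.Etale (MvPolynomial σ R) S' := hf₀
    exact Algebra.Etale.of_restrictScalars (R := MvPolynomial σ R) (A := R') (B := S')
  obtain ⟨ν, hν, hνl, hνr⟩ := exists_nodeRing_bijective m k e c
  let g₀ : MvPolynomial σ (NodeRing m) →ₐ[ℂ] S' :=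
    (IsScalarTower.toAlgHom ℂ _ S').comp (MvPolynomial.mapAlgHom g)
  have hg₀ : RingHom.Etale (R := MvPolynomial σ (NodeRing m)) (S := S') g₀.toRingHom :=
    etale_comp_mvPolynomial_away g.toRingHom hg (F w)
  refine ⟨m + k, S', _, _, f', g₀.comp ν, K, _, _, θ', hf', ?_, ?_, ?_⟩
  · exact RingHom.Etale.stableUnderComposition (S := MvPolynomial σ (NodeRing m)) ν.toRingHom
      g₀.toRingHom (.of_bijective hν) hg₀
  · apply AlgHom.coe_ringHom_injective
    refine IsLocalization.ringHom_ext (Submonoid.powers w) (RingHom.ext fun q => ?_)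
    change θ' (f' (algebraMap _ _ q)) = algebraMap ℂ K (π' (algebraMap _ _ q))
    rw [hff, ← hevF]
    exact hθ' (F q)
  · intro i
    rw [AlgHom.comp_apply]
    have hθg : ∀ q, θ' (g₀ q) = ev (MvPolynomial.map (g : NodeRing m →+* S) q) := fun q => hθ' _
    obtain ⟨j | j, rfl⟩ := (nodeVars m k).surjective i
    · rw [hνl, hθg, MvPolynomial.map_C, hevC]
      exact h2 j
    · obtain ⟨j, rfl⟩ := e.surjective j
      rw [hνr, map_sub, map_sub, AlgHom.commutes, AlgHom.commutes, hθg, MvPolynomial.map_X, hevX,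
        sub_self]

/-- Nodal singularities ascend to localizations of polynomial rings at finitely generated
submonoids, if enough closed points lift. -/
theorem HasNodalSingularities.ascend [Finite σ] [Algebra.FiniteType ℂ R]
    (s : Set (MvPolynomial σ R)) (hs : s.Finite) [IsLocalization (Submonoid.closure s) R']
    (hlift : ∀ π : R →ₐ[ℂ] ℂ, ∃ π' : R' →ₐ[ℂ] ℂ,
      π'.comp (IsScalarTower.toAlgHom ℂ R R') = π)
    (h : HasNodalSingularities R) : HasNodalSingularities R' := by
  -- Inverting finitely many elements amounts to inverting their product, which brings the
  -- localization into the form needed for étale maps.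
  let w : MvPolynomial σ R := ∏ x ∈ hs.toFinset, x
  have hws : ∀ x ∈ s, x ∣ w := fun x hx =>
    Finset.dvd_prod_of_mem (fun x => x) (hs.mem_toFinset.2 hx)
  have hw : w ∈ Submonoid.closure s :=
    Submonoid.prod_mem _ fun x hx => Submonoid.subset_closure (hs.mem_toFinset.1 hx)
  have haway : IsLocalization.Away w R' := by
    have hle : Submonoid.powers w ≤ Submonoid.closure s := by
      rw [Submonoid.powers_le]
      exact hw
    refine (IsLocalization.iff_of_le_of_exists_dvd _ (Submonoid.closure s) hle ?_).2 ‹_›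
    intro x hx
    induction hx using Submonoid.closure_induction with
    | mem x hx => exact ⟨w, ⟨1, pow_one w⟩, hws x hx⟩
    | one => exact ⟨1, one_mem _, dvd_refl _⟩
    | mul x y _ _ hx hy =>
      obtain ⟨a, ha, hxa⟩ := hx
      obtain ⟨b, hb, hyb⟩ := hy
      exact ⟨a * b, mul_mem ha hb, mul_dvd_mul hxa hyb⟩
  have : Algebra.FiniteType (MvPolynomial σ R) R' := IsLocalization.finiteType_of_monoid_fg
    (Submonoid.powers w) R'
  have : Algebra.FiniteType ℂ (MvPolynomial σ R) := .trans (S := R) ‹_› inferInstance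
  have : Algebra.FiniteType ℂ R' := .trans (S := MvPolynomial σ R) ‹_› ‹_›
  rw [hasNodalSingularities_iff] at h ⊢
  obtain ⟨⟨π, hπ⟩, h2⟩ := h
  refine ⟨?_, fun π' hπ' => ?_⟩
  · obtain ⟨π', rfl⟩ := hlift π
    exact ⟨π', fun h => hπ (isSmoothAt_ker_comp_of_isSmoothAt_ker (Submonoid.closure s) π' h)⟩
  · exact IsNodeAt.ascend w π' (h2 _ fun h =>
      hπ' (isSmoothAt_ker_of_isSmoothAt_ker_comp (Submonoid.closure s) π' h))

end Ascent

/-! ### The curve (a² - a + 1) v = 0 and its localizations -/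

/-- The coordinate ring of the plane curve `(a² - a + 1) v = 0`. -/
abbrev CurveRing : Type :=
  MvPolynomial (Fin 2) ℂ ⧸ Ideal.span {((MvPolynomial.X 0 ^ 2 - MvPolynomial.X 0 + 1) *
    MvPolynomial.X 1 : MvPolynomial (Fin 2) ℂ)}

namespace CurveRing

/-- The coordinate `a`. -/
noncomputable def a : CurveRing := Ideal.Quotient.mk _ (MvPolynomial.X 0)

/-- The coordinate `v`. -/
noncomputable def v : CurveRing := Ideal.Quotient.mk _ (MvPolynomial.X 1)

theorem rel : (a ^ 2 - a + 1) * v = 0 :=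
  Ideal.Quotient.eq_zero_iff_mem.2 (Ideal.subset_span rfl)

/-- The homomorphism from the coordinate ring of the curve given by a point. -/
noncomputable def ev {B : Type*} [CommRing B] [Algebra ℂ B] (x y : B)
    (h : (x ^ 2 - x + 1) * y = 0) : CurveRing →ₐ[ℂ] B :=
  Ideal.Quotient.liftₐ _ (MvPolynomial.aeval ![x, y]) (by
    intro f hf
    refine (Ideal.span_le.2 ?_ : _ ≤ RingHom.ker (MvPolynomial.aeval ![x, y])) hf
    rintro _ rfl
    simpa [RingHom.mem_ker] using h)

@[simp] theorem ev_a {B : Type*} [CommRing B] [Algebra ℂ B] (x y : B)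
    (h : (x ^ 2 - x + 1) * y = 0) : ev x y h a = x := by
  change MvPolynomial.aeval ![x, y] (MvPolynomial.X 0) = x
  simp

@[simp] theorem ev_v {B : Type*} [CommRing B] [Algebra ℂ B] (x y : B)
    (h : (x ^ 2 - x + 1) * y = 0) : ev x y h v = y := by
  change MvPolynomial.aeval ![x, y] (MvPolynomial.X 1) = y
  simp

theorem algHom_ext {B : Type*} [CommRing B] [Algebra ℂ B] {φ ψ : CurveRing →ₐ[ℂ] B}
    (ha : φ a = ψ a) (hv : φ v = ψ v) : φ = ψ := by
  apply Ideal.Quotient.algHom_ext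
  apply MvPolynomial.algHom_ext
  intro i
  fin_cases i
  · exact ha
  · exact hv

section Localized

variable {R : Type} [CommRing R] [Algebra ℂ R] [Algebra CurveRing R] [IsScalarTower ℂ CurveRing R]
  (W : Submonoid CurveRing) [IsLocalization W R]

include W in
theorem localization_algHom_ext {B : Type*} [CommRing B] [Algebra ℂ B] {φ ψ : R →ₐ[ℂ] B}
    (ha : φ (algebraMap _ R a) = ψ (algebraMap _ R a))
    (hv : φ (algebraMap _ R v) = ψ (algebraMap _ R v)) : φ = ψ := by
  apply AlgHom.coe_ringHom_injective
  refine IsLocalization.ringHom_ext W (RingHom.ext fun x => ?_)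
  have : φ.comp (IsScalarTower.toAlgHom ℂ CurveRing R) =
    ψ.comp (IsScalarTower.toAlgHom ℂ CurveRing R) := algHom_ext ha hv
  exact DFunLike.congr_fun this x

include W in
/-- A point of the localized curve modulo a square zero ideal lifts if its coordinates lift to a
point of the curve. -/
theorem exists_lift {B : Type} [CommRing B] [Algebra ℂ B] (I : Ideal B) (hI : I ^ 2 = ⊥)
    (h : R →ₐ[ℂ] B ⧸ I) (x y : B) (hx : Ideal.Quotient.mk I x = h (algebraMap _ R a))
    (hy : Ideal.Quotient.mk I y = h (algebraMap _ R v)) (hxy : (x ^ 2 - x + 1) * y = 0) :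
    ∃ h' : R →ₐ[ℂ] B, (Ideal.Quotient.mkₐ ℂ I).comp h' = h ∧
      h' (algebraMap _ R a) = x ∧ h' (algebraMap _ R v) = y := by
  have key : (Ideal.Quotient.mkₐ ℂ I).comp (ev x y hxy) =
      h.comp (IsScalarTower.toAlgHom ℂ CurveRing R) := by
    apply algHom_ext
    · simpa using hx
    · simpa using hy
  have hu : ∀ w : W, IsUnit (ev x y hxy w) := fun w => by
    apply (IsNilpotent.isUnit_quotient_mk_iff ⟨2, hI⟩).mp
    have := DFunLike.congr_fun key (w : CurveRing)
    refine this.symm ▸ ?_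
    exact (IsLocalization.map_units R w).map h
  have hl : ∀ f, (IsLocalization.liftAlgHom hu : R →ₐ[ℂ] B) (algebraMap _ R f) = ev x y hxy f :=
    fun f => by simp
  refine ⟨IsLocalization.liftAlgHom hu, ?_, by rw [hl, ev_a], by rw [hl, ev_v]⟩
  apply localization_algHom_ext W
  · rw [AlgHom.comp_apply, hl, ev_a]
    exact hx
  · rw [AlgHom.comp_apply, hl, ev_v]
    exact hy

/-- Here (2x - 1)² = 4(x² - x + 1) - 3 = -3, so the derivative of the quadratic is a unit at its
roots. This separability makes the branches cross transversally. -/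
theorem isUnit_of_sq {B : Type*} [CommRing B] [Algebra ℂ B] (x : B)
    (h : x ^ 2 - x + 1 = 0) : IsUnit (2 * x - 1) := by
  have h3 : IsUnit (algebraMap ℂ B (-3)) := (IsUnit.mk0 _ (by norm_num)).map _
  have : (2 * x - 1) * (2 * x - 1) = algebraMap ℂ B (-3) := by
    rw [map_neg, map_ofNat]
    linear_combination 4 * h
  rw [← this] at h3
  exact isUnit_of_mul_isUnit_left h3

/-- Newton's method. -/
theorem exists_newton {B : Type*} [CommRing B] (I : Ideal B) (hI : I ^ 2 = ⊥) (x u : B)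
    (hx : x ^ 2 - x + 1 - u ∈ I) (hu : IsUnit (2 * x - 1)) :
    ∃ x', x' - x ∈ I ∧ x' ^ 2 - x' + 1 = u := by
  obtain ⟨t, ht⟩ := hu.exists_right_inv
  have h0 : (x ^ 2 - x + 1 - u) * (x ^ 2 - x + 1 - u) = 0 := by
    have := Ideal.mul_mem_mul hx hx
    rwa [← pow_two, hI, Ideal.mem_bot] at this
  -- A single Newton step is exact, since the square of the error lies in I² = 0.
  refine ⟨x - (x ^ 2 - x + 1 - u) * t, ?_, ?_⟩
  · rw [sub_sub_cancel_left]
    exact neg_mem (Ideal.mul_mem_right _ _ hx)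
  · linear_combination -(x ^ 2 - x + 1 - u) * ht + t ^ 2 * h0

include W in
-- Away from the crossings only one factor can vanish. Where a² - a + 1 is invertible, the curve is
-- v = 0 and `a` lifts freely. Where `v` is invertible, `a` is a simple root, which lifts by
-- Newton's method, while `v` lifts freely.
theorem isSmoothAt_of_ne_zero (π : R →ₐ[ℂ] ℂ)
    (h : π (algebraMap _ R (a ^ 2 - a + 1)) ≠ 0 ∨ π (algebraMap _ R v) ≠ 0) :
    Algebra.IsSmoothAt ℂ (RingHom.ker π) := by
  rw [isSmoothAt_ker_iff]
  intro B _ _ I hI k hk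
  obtain ⟨x, hx⟩ := Ideal.Quotient.mk_surjective (k (algebraMap _ R a))
  obtain ⟨y, hy⟩ := Ideal.Quotient.mk_surjective (k (algebraMap _ R v))
  have hrel : k (algebraMap _ R (a ^ 2 - a + 1)) * k (algebraMap _ R v) = 0 := by
    rw [← map_mul, ← map_mul, rel, map_zero, map_zero]
  have hF : k (algebraMap _ R (a ^ 2 - a + 1)) = Ideal.Quotient.mk I (x ^ 2 - x + 1) := by
    simp [hx]
  rcases h with h | h
  · have hv : k (algebraMap _ R v) = 0 := ((hk _ h).mul_right_eq_zero).1 hrel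
    obtain ⟨h', hh, -⟩ := exists_lift W I hI k x 0 hx (by rw [hv, map_zero]) (mul_zero _)
    exact ⟨h', hh⟩
  · have ha : k (algebraMap _ R (a ^ 2 - a + 1)) = 0 := ((hk _ h).mul_left_eq_zero).1 hrel
    rw [hF] at ha
    have hu : IsUnit (2 * x - 1) := by
      apply (IsNilpotent.isUnit_quotient_mk_iff ⟨2, hI⟩).mp
      have := isUnit_of_sq (Ideal.Quotient.mk I x) (by simpa using ha)
      rwa [← map_ofNat (Ideal.Quotient.mk I), ← map_mul, ← map_one (Ideal.Quotient.mk I),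
        ← map_sub] at this
    obtain ⟨x', hx', hx0⟩ := exists_newton I hI x 0
      (by rw [sub_zero]; exact Ideal.Quotient.eq_zero_iff_mem.1 ha) hu
    obtain ⟨h', hh, -⟩ := exists_lift W I hI k x' y
      (by rw [← hx]; exact Ideal.Quotient.eq.2 hx') hy (by rw [hx0, zero_mul])
    exact ⟨h', hh⟩

/-- Realized by ℂ[ε]/(ε³), the test ring that detects the obstruction to extending a tangent vector
to second order. -/
theorem exists_cube_eq_zero : ∃ (B : Type) (_ : CommRing B) (_ : Algebra ℂ B) (ε : B),
    ε ^ 3 = 0 ∧ ε ^ 2 ≠ 0 := by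
  refine ⟨Polynomial ℂ ⧸ Ideal.span {(Polynomial.X ^ 3 : Polynomial ℂ)}, inferInstance,
    inferInstance, Ideal.Quotient.mk _ Polynomial.X, ?_, ?_⟩
  · rw [← map_pow, Ideal.Quotient.eq_zero_iff_mem]
    exact Ideal.subset_span rfl
  · rw [← map_pow, Ne, Ideal.Quotient.eq_zero_iff_mem, Ideal.mem_span_singleton,
      Polynomial.X_pow_dvd_iff]
    intro h
    have := h 2 (by norm_num)
    simp at this

include W in
-- At a crossing the tangent vector (1, 1) points along neither branch. The map a ↦ z + ε, v ↦ ε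
-- lies on the curve modulo ε², but it cannot be lifted to a ring in which ε³ = 0 and ε² ≠ 0.
theorem not_isSmoothAt (π : R →ₐ[ℂ] ℂ)
    (ha : π (algebraMap _ R (a ^ 2 - a + 1)) = 0) (hv : π (algebraMap _ R v) = 0) :
    ¬ Algebra.IsSmoothAt ℂ (RingHom.ker π) := by
  rw [isSmoothAt_ker_iff]
  intro H
  obtain ⟨B, _, _, ε, hε, hε2⟩ := exists_cube_eq_zero
  let I : Ideal B := Ideal.span {ε ^ 2}
  have hI : I ^ 2 = ⊥ := by
    rw [Ideal.span_singleton_pow, Ideal.span_singleton_eq_bot]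
    linear_combination ε * hε
  let z : ℂ := π (algebraMap _ R a)
  have hz : z ^ 2 - z + 1 = 0 := by simpa [z] using ha
  let δ : (B ⧸ I) := Ideal.Quotient.mk I ε
  have hδ : δ ^ 2 = 0 := by
    rw [← map_pow, Ideal.Quotient.eq_zero_iff_mem]
    exact Ideal.subset_span rfl
  let x : B ⧸ I := algebraMap ℂ (B ⧸ I) z + δ
  have hzB : ∀ (C : Type) [CommRing C] [Algebra ℂ C],
      algebraMap ℂ C z ^ 2 - algebraMap ℂ C z + 1 = 0 := fun C _ _ => by
    rw [← map_pow, ← map_sub, ← map_one (algebraMap ℂ C), ← map_add, hz, map_zero]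
  have hx : (x ^ 2 - x + 1) * δ = 0 := by
    linear_combination δ * hzB (B ⧸ I) + (2 * algebraMap ℂ _ z + δ - 1) * hδ
  have hev : ∀ c : CurveRing, ev x δ hx c - algebraMap ℂ _ (π (algebraMap _ R c)) ∈
      Ideal.span {δ} := by
    have : (Ideal.Quotient.mkₐ ℂ (Ideal.span {δ})).comp (ev x δ hx) =
        ((Algebra.ofId ℂ _).comp π).comp (IsScalarTower.toAlgHom ℂ CurveRing R) := by
      have hδ0 : Ideal.Quotient.mk (Ideal.span {δ}) δ = 0 :=
        Ideal.Quotient.eq_zero_iff_mem.2 (Ideal.subset_span rfl)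
      apply algHom_ext
      · simp only [AlgHom.comp_apply, ev_a, Ideal.Quotient.mkₐ_eq_mk, x, map_add, hδ0, add_zero,
          Algebra.ofId_apply, IsScalarTower.coe_toAlgHom', z]
        rfl
      · simp [hδ0, hv]
    intro c
    rw [← Ideal.Quotient.eq]
    exact DFunLike.congr_fun this c
  -- Up to multiples of the nilpotent `δ` the map is the point `π`, so it inverts everything that
  -- `π` does not kill.
  have hunit : ∀ c : CurveRing, π (algebraMap _ R c) ≠ 0 → IsUnit (ev x δ hx c) := by
    intro c hc
    obtain ⟨r, hr⟩ := Ideal.mem_span_singleton'.1 (hev c)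
    have h1 : IsUnit (algebraMap ℂ (B ⧸ I) (π (algebraMap _ R c))) := (IsUnit.mk0 _ hc).map _
    have h2 : IsNilpotent (r * δ) := ⟨2, by rw [mul_pow, hδ, mul_zero]⟩
    have h3 := h2.isUnit_add_left_of_commute h1 (Commute.all _ _)
    rwa [hr, add_sub_cancel] at h3
  have hπW : ∀ w : W, π (algebraMap CurveRing R w) ≠ 0 := fun w =>
    ((IsLocalization.map_units R w).map π).ne_zero
  have huW : ∀ w : W, IsUnit (ev x δ hx w) := fun w => hunit w (hπW w)
  let k : R →ₐ[ℂ] B ⧸ I := IsLocalization.liftAlgHom huW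
  have hk : ∀ c, k (algebraMap _ R c) = ev x δ hx c := fun c => by simp [k]
  obtain ⟨k', hk'⟩ := H B I hI k fun r hr => by
    obtain ⟨⟨c, w⟩, hcw⟩ := IsLocalization.surj W r
    dsimp only at hcw
    have h1 : IsUnit (k (r * algebraMap CurveRing R w)) := by
      rw [hcw, hk]
      refine hunit c ?_
      rw [← hcw, map_mul]
      exact mul_ne_zero hr (hπW w)
    rw [map_mul] at h1
    exact isUnit_of_mul_isUnit_left h1
  have hlift : ∀ c, Ideal.Quotient.mk I (k' (algebraMap _ R c)) = ev x δ hx c := fun c =>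
    (DFunLike.congr_fun hk' _).trans (hk c)
  have e1 : k' (algebraMap _ R a) - (algebraMap ℂ B z + ε) ∈ I := by
    rw [← Ideal.Quotient.eq, hlift, ev_a]
    rfl
  have e2 : k' (algebraMap _ R v) - ε ∈ I := by
    rw [← Ideal.Quotient.eq, hlift, ev_v]
  obtain ⟨p, hp⟩ := Ideal.mem_span_singleton'.1 e1
  obtain ⟨q, hq⟩ := Ideal.mem_span_singleton'.1 e2
  have hrel : (k' (algebraMap _ R a) ^ 2 - k' (algebraMap _ R a) + 1) *
      k' (algebraMap _ R v) = 0 := by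
    have := congrArg (fun c => k' (algebraMap _ R c)) rel
    simpa using this
  rw [eq_add_of_sub_eq hp.symm, eq_add_of_sub_eq hq.symm] at hrel
  have hu : IsUnit (2 * algebraMap ℂ B z - 1) := isUnit_of_sq _ (hzB B)
  -- Correcting both coordinates by multiples of ε² changes the product only by multiples of ε³, so
  -- the relation of the curve reduces to this.
  have h0 : (2 * algebraMap ℂ B z - 1) * ε ^ 2 = 0 := by
    set Z := algebraMap ℂ B z
    linear_combination hrel - (q * ε ^ 2 + ε) * hzB B -
      (1 + (2 * Z - 1) * p + 2 * p * ε + p ^ 2 * ε ^ 2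
        + q * ((2 * Z - 1) + ε + (2 * Z - 1) * p * ε + 2 * p * ε ^ 2 + p ^ 2 * ε ^ 3)) * hε
  exact hε2 ((hu.mul_right_eq_zero).1 h0)

include W in
-- Take u = a² - a + 1 and v as coordinates. Once 2a - 1 is inverted, the map to the node is étale:
-- over a given u, the function `a` is a simple root of a quadratic, so it lifts uniquely along
-- square-zero ideals.
theorem isNodeAt (π : R →ₐ[ℂ] ℂ) [Algebra.FiniteType ℂ R]
    (ha : π (algebraMap _ R (a ^ 2 - a + 1)) = 0) (hv : π (algebraMap _ R v) = 0) :
    IsNodeAt π := by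
  let α : R := algebraMap _ R a
  let β : R := algebraMap _ R v
  let S := Localization.Away (2 * α - 1)
  let A : S := algebraMap R S α
  let V : S := algebraMap R S β
  have hS : Algebra.FiniteType ℂ S := .trans (S := R) ‹_›
    (IsLocalization.finiteType_of_monoid_fg (Submonoid.powers (2 * α - 1)) S)
  have hrelS : (A ^ 2 - A + 1) * V = 0 := by
    have := congrArg (fun c => algebraMap R S (algebraMap _ R c)) rel
    simpa using this
  have hunit : IsUnit (2 * A - 1) := by
    have := IsLocalization.map_units S (⟨2 * α - 1, 1, pow_one _⟩ : Submonoid.powers (2 * α - 1))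
    simpa [A, map_ofNat] using this
  let g : NodeRing 0 →ₐ[ℂ] S :=
    Ideal.Quotient.liftₐ _ (MvPolynomial.aeval ![A ^ 2 - A + 1, V]) (by
      intro f hf
      refine (Ideal.span_le.2 ?_ :
        _ ≤ RingHom.ker (MvPolynomial.aeval ![A ^ 2 - A + 1, V])) hf
      rintro _ rfl
      simpa [RingHom.mem_ker] using hrelS)
  let u₀ : NodeRing 0 := Ideal.Quotient.mk _ (MvPolynomial.X 0)
  let v₀ : NodeRing 0 := Ideal.Quotient.mk _ (MvPolynomial.X 1)
  have huv : u₀ * v₀ = 0 := by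
    rw [← map_mul, Ideal.Quotient.eq_zero_iff_mem]
    exact Ideal.subset_span rfl
  have hgu : g u₀ = A ^ 2 - A + 1 := by
    change MvPolynomial.aeval ![A ^ 2 - A + 1, V] (MvPolynomial.X 0) = _
    simp
  have hgv : g v₀ = V := by
    change MvPolynomial.aeval ![A ^ 2 - A + 1, V] (MvPolynomial.X 1) = _
    simp
  have hz := isUnit_of_sq (π α) (by simpa [α] using ha)
  have hπS : ∀ y : Submonoid.powers (2 * α - 1), IsUnit (π y) := by
    rintro ⟨_, n, rfl⟩
    rw [map_pow]
    exact IsUnit.pow n (by simpa [map_ofNat] using hz)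
  let θ : S →ₐ[ℂ] ℂ := IsLocalization.liftAlgHom hπS
  have hθ : ∀ r, θ (algebraMap R S r) = π r := fun r => by simp [θ]
  refine ⟨0, S, inferInstance, inferInstance, IsScalarTower.toAlgHom ℂ R S, g, ℂ, inferInstance,
    inferInstance, θ, ?_, ?_, ?_, ?_⟩
  · exact RingHom.etale_algebraMap.2 (Algebra.Etale.of_isLocalizationAway (2 * α - 1))
  · let := g.toRingHom.toAlgebra
    have hgalg : ∀ c, algebraMap (NodeRing 0) S c = g c := fun c => rfl
    have : IsScalarTower ℂ (NodeRing 0) S := IsScalarTower.of_algebraMap_eq fun c =>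
      (g.commutes c).symm
    have hft : Algebra.FiniteType (NodeRing 0) S := .of_restrictScalars_finiteType ℂ _ _
    have hfp : Algebra.FinitePresentation (NodeRing 0) S :=
      Algebra.FinitePresentation.of_finiteType.1 hft
    have hfe : Algebra.FormallyEtale (NodeRing 0) S := by
      rw [Algebra.FormallyEtale.iff_comp_bijective]
      intro B _ _ I hI
      let : Algebra ℂ B := Algebra.compHom B (algebraMap ℂ (NodeRing 0))
      have : IsScalarTower ℂ (NodeRing 0) B := 
        IsScalarTower.of_algebraMap_eq (R := ℂ) (S := NodeRing 0) (A := B) fun c => rfl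
      have hA : ∀ φ : S →ₐ[NodeRing 0] B,
          φ A ^ 2 - φ A + 1 = algebraMap _ B u₀ := fun φ => by
        rw [← φ.commutes, hgalg, hgu]
        simp
      have hV : ∀ φ : S →ₐ[NodeRing 0] B, φ V = algebraMap _ B v₀ := fun φ => by
        rw [← φ.commutes, hgalg, hgv]
      have hext : ∀ φ ψ : S →ₐ[ℂ] B, φ A = ψ A → φ V = ψ V → φ = ψ := by
        intro φ ψ h1 h2
        have : φ.comp (IsScalarTower.toAlgHom ℂ R S) = ψ.comp (IsScalarTower.toAlgHom ℂ R S) :=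
          localization_algHom_ext W h1 h2
        apply AlgHom.coe_ringHom_injective
        exact IsLocalization.ringHom_ext (Submonoid.powers (2 * α - 1))
          (RingHom.ext fun r => DFunLike.congr_fun this r)
      constructor
      · intro φ ψ hφψ
        have hAA : φ A - ψ A ∈ I := Ideal.Quotient.eq.1 (DFunLike.congr_fun hφψ A)
        have hsq : (φ A - ψ A) * (φ A - ψ A) = 0 := by
          have := Ideal.mul_mem_mul hAA hAA
          rwa [← pow_two, hI, Ideal.mem_bot] at this
        have hu : IsUnit (2 * ψ A - 1) := by simpa [map_ofNat] using hunit.map ψ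
        -- Two roots of one quadratic that differ by an element of square zero agree, because the
        -- derivative there is a unit.
        have h0 : (2 * ψ A - 1) * (φ A - ψ A) = 0 := by
          linear_combination hA φ - hA ψ - hsq
        have h1 : φ A = ψ A := sub_eq_zero.1 ((hu.mul_right_eq_zero).1 h0)
        have := hext (φ.restrictScalars ℂ) (ψ.restrictScalars ℂ) h1
          ((hV φ).trans (hV ψ).symm)
        ext s
        exact DFunLike.congr_fun this s
      · intro φ
        obtain ⟨x, hx⟩ := Ideal.Quotient.mk_surjective (φ A)
        have hφu : φ A ^ 2 - φ A + 1 = Ideal.Quotient.mk I (algebraMap _ B u₀) := by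
          have := φ.commutes u₀
          rw [hgalg, hgu] at this
          simpa using this
        have hφv : φ V = Ideal.Quotient.mk I (algebraMap _ B v₀) := by
          have := φ.commutes v₀
          rwa [hgalg, hgv] at this
        have hux : IsUnit (2 * x - 1) := by
          apply (IsNilpotent.isUnit_quotient_mk_iff ⟨2, hI⟩).mp
          have := hunit.map φ
          simpa [hx, map_ofNat] using this
        obtain ⟨x', hx', hx0⟩ := exists_newton I hI x (algebraMap _ B u₀) (by
          rw [← Ideal.Quotient.eq, ← hφu, ← hx]
          simp) hux
        obtain ⟨h', hh, h'a, h'v⟩ := exists_lift W I hI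
          ((φ.restrictScalars ℂ).comp (IsScalarTower.toAlgHom ℂ R S)) x' (algebraMap _ B v₀)
          ((Ideal.Quotient.eq.2 hx').trans hx) hφv.symm (by
            rw [hx0, ← map_mul, huv, map_zero])
        have hux' : IsUnit (2 * x' - 1) := by
          apply (IsNilpotent.isUnit_quotient_mk_iff ⟨2, hI⟩).mp
          have h1 := Ideal.Quotient.eq.2 hx'
          have := hunit.map φ
          simpa [h1, hx, map_ofNat] using this
        have hu' : ∀ y : Submonoid.powers (2 * α - 1), IsUnit (h' y) := by
          rintro ⟨_, n, rfl⟩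
          rw [map_pow]
          refine IsUnit.pow n ?_
          have : h' α = x' := h'a
          simpa [this, map_ofNat] using hux'
        let k : S →ₐ[ℂ] B := IsLocalization.liftAlgHom hu'
        have hk : ∀ r, k (algebraMap R S r) = h' r := fun r => by simp [k]
        have hkA : k A = x' := (hk α).trans h'a
        have hkV : k V = algebraMap _ B v₀ := (hk β).trans h'v
        have hkg : k.comp g = IsScalarTower.toAlgHom ℂ (NodeRing 0) B := by
          apply Ideal.Quotient.algHom_ext
          apply MvPolynomial.algHom_ext
          intro i
          fin_cases i
          · change k (g u₀) = algebraMap _ B u₀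
            rw [hgu, ← hx0, ← hkA]
            simp
          · change k (g v₀) = algebraMap _ B v₀
            rw [hgv, hkV]
        let k' : S →ₐ[NodeRing 0] B :=
          { k with commutes' := fun c => DFunLike.congr_fun hkg c }
        refine ⟨k', ?_⟩
        have h3 : ∀ s, Ideal.Quotient.mk I (k s) = φ s := by
          have : ((Ideal.Quotient.mk I).comp (k : S →+* B)) = (φ : S →+* B ⧸ I) :=
            IsLocalization.ringHom_ext (Submonoid.powers (2 * α - 1))
              (RingHom.ext fun r => by
                simp only [RingHom.comp_apply, RingHom.coe_coe, hk]
                exact DFunLike.congr_fun hh r)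
          exact fun s => RingHom.congr_fun this s
        ext s
        exact h3 s
    exact (⟨hfe, hfp⟩ : Algebra.Etale (NodeRing 0) S)
  · ext r
    exact hθ r
  · intro i
    fin_cases i
    · change θ (g u₀) = 0
      rw [hgu, ← ha]
      simp [A, hθ, α]
    · change θ (g v₀) = 0
      rw [hgv]
      exact (hθ β).trans hv

/-- A localization of the curve `(a² - a + 1) v = 0` that contains a point with
`a² - a + 1 = v = 0` has nodal singularities. -/
theorem hasNodalSingularities (s : Set CurveRing) (hs : s.Finite)
    (hW : W = Submonoid.closure s) (z : ℂ) (hz : (z ^ 2 - z + 1) * 0 = 0)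
    (hz0 : z ^ 2 - z + 1 = 0) (hsz : ∀ c ∈ s, ev z 0 hz c ≠ 0) : HasNodalSingularities R := by
  have hfg : W.FG := hW ▸ ⟨hs.toFinset, by simp⟩
  have hmfg : Monoid.FG W := (Monoid.fg_iff_submonoid_fg _).2 hfg
  have : Algebra.FiniteType ℂ R := .trans (S := CurveRing) inferInstance
    (IsLocalization.finiteType_of_monoid_fg W R)
  rw [hasNodalSingularities_iff]
  constructor
  · have hu : ∀ w : W, IsUnit (ev z 0 hz w) := by
      rintro ⟨w, hw⟩
      rw [isUnit_iff_ne_zero]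
      subst hW
      induction hw using Submonoid.closure_induction with
      | mem x hx => exact hsz x hx
      | one => simp
      | mul x y _ _ hx hy =>
        simp only [map_mul]
        exact mul_ne_zero hx hy
    let π : R →ₐ[ℂ] ℂ := IsLocalization.liftAlgHom hu
    have hπ : ∀ c, π (algebraMap _ R c) = ev z 0 hz c := fun c => by simp [π]
    refine ⟨π, not_isSmoothAt W π ?_ ?_⟩
    · rw [hπ]
      simpa using hz0
    · rw [hπ, ev_v]
  · intro π hπ
    by_cases ha : π (algebraMap _ R (a ^ 2 - a + 1)) = 0
    · by_cases hv : π (algebraMap _ R v) = 0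
      · exact isNodeAt W π ha hv
      · exact absurd (isSmoothAt_of_ne_zero W π (Or.inr hv)) hπ
    · exact absurd (isSmoothAt_of_ne_zero W π (Or.inl ha)) hπ

end Localized

end CurveRing

/-! ### Representations over rings and projective equivalence -/

section Representations

variable {α : Type} {d : ℕ} {T : Type} [CommRing T]

/-- The matrix `A` represents the matroid `M` over the ring `T`: its maximal minors are units on the
bases of `M` and vanish on the nonbases. -/
structure IsRep (M : Matroid α) (A : Matrix (Fin d) α T) : Prop where
  isUnit_det : ∀ t : Fin d → α, (∀ j, t j ∈ M.E) → M.IsBase (range t) →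
    IsUnit (A.submatrix id t).det
  det_eq_zero : ∀ t : Fin d → α, (∀ j, t j ∈ M.E) → ¬ M.IsBase (range t) →
    (A.submatrix id t).det = 0

/-- Equivalence of matrices up to row operations and scaling of the columns in `E`. -/
def ProjEquiv (E : Set α) (A A' : Matrix (Fin d) α T) : Prop :=
  ∃ (g : Matrix (Fin d) (Fin d) T) (u : α → Tˣ), IsUnit g.det ∧
    ∀ e ∈ E, ∀ i, A' i e = (g * A) i e * u e

theorem ProjEquiv.of_eq {E : Set α} {A A' : Matrix (Fin d) α T}
    (h : ∀ e ∈ E, ∀ i, A i e = A' i e) : ProjEquiv E A A' :=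
  ⟨1, fun _ => 1, by simp, fun e he i => by simp [h e he i]⟩

theorem ProjEquiv.trans {E : Set α} {A B C : Matrix (Fin d) α T} (h : ProjEquiv E A B)
    (h' : ProjEquiv E B C) : ProjEquiv E A C := by
  obtain ⟨g, u, hg, h⟩ := h
  obtain ⟨g', u', hg', h'⟩ := h'
  refine ⟨g' * g, fun e => u e * u' e, by rw [Matrix.det_mul]; exact hg'.mul hg,
    fun e he i => ?_⟩
  rw [h' e he i, Matrix.mul_assoc, Matrix.mul_apply, Matrix.mul_apply (N := g * A)]
  simp only [h e he, Units.val_mul, Finset.sum_mul]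
  exact Finset.sum_congr rfl fun j _ => by ring

theorem ProjEquiv.symm {E : Set α} {A B : Matrix (Fin d) α T} (h : ProjEquiv E A B) :
    ProjEquiv E B A := by
  obtain ⟨g, u, hg, h⟩ := h
  refine ⟨g⁻¹, fun e => (u e)⁻¹, Matrix.isUnit_nonsing_inv_det g hg, fun e he i => ?_⟩
  rw [Matrix.mul_apply]
  simp only [h e he]
  rw [Finset.sum_mul]
  have : ∀ j, g⁻¹ i j * ((g * A) j e * (u e : T)) * ((u e)⁻¹ : Tˣ) = g⁻¹ i j * (g * A) j e :=
    fun j => by rw [mul_assoc, mul_assoc, Units.mul_inv, mul_one]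
  simp only [this]
  rw [← Matrix.mul_apply, ← Matrix.mul_assoc, Matrix.nonsing_inv_mul g hg, Matrix.one_mul]

theorem ProjEquiv.map {S : Type} [CommRing S] {E : Set α} {A B : Matrix (Fin d) α T}
    (h : ProjEquiv E A B) (φ : T →+* S) : ProjEquiv E (A.map φ) (B.map φ) := by
  obtain ⟨g, u, hg, h⟩ := h
  refine ⟨g.map φ, fun e => Units.map φ (u e), ?_, fun e he i => ?_⟩
  · have : (g.map φ).det = φ g.det := (φ.map_det g).symm
    rw [this]
    exact hg.map φ
  · rw [Matrix.map_apply, h e he, map_mul, ← Matrix.map_mul, Matrix.map_apply]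
    rfl

/-- A row operation multiplies each maximal minor by its determinant, and rescaling columns
multiplies it by the product of the scalars. Vanishing and invertibility of minors are therefore
invariants of the class. -/
theorem ProjEquiv.det {E : Set α} {A B : Matrix (Fin d) α T} (h : ProjEquiv E A B) :
    ∀ t : Fin d → α, (∀ j, t j ∈ E) → ∃ c : Tˣ,
      (B.submatrix id t).det = c * (A.submatrix id t).det := by
  obtain ⟨g, u, hg, h⟩ := h
  intro t ht
  have h1 : B.submatrix id t = g * A.submatrix id t * Matrix.diagonal fun j => (u (t j) : T) := by
    ext i j
    rw [Matrix.mul_diagonal, Matrix.submatrix_apply, h _ (ht j)]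
    rfl
  rw [h1, Matrix.det_mul, Matrix.det_mul, Matrix.det_diagonal]
  refine ⟨hg.unit * ∏ j, u (t j), ?_⟩
  simp only [Units.val_mul, IsUnit.unit_spec, Units.coe_prod]
  ring

theorem IsRep.of_projEquiv {M : Matroid α} {A B : Matrix (Fin d) α T} (hA : IsRep M A)
    (h : ProjEquiv M.E A B) : IsRep M B := by
  constructor
  · intro t ht hB
    obtain ⟨c, hc⟩ := h.det t ht
    rw [hc]
    exact c.isUnit.mul (hA.isUnit_det t ht hB)
  · intro t ht hB
    obtain ⟨c, hc⟩ := h.det t ht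
    rw [hc, hA.det_eq_zero t ht hB, mul_zero]

theorem det_submatrix_map {S : Type} [CommRing S] (A : Matrix (Fin d) α T) (φ : T →+* S)
    (t : Fin d → α) : ((A.map φ).submatrix id t).det = φ (A.submatrix id t).det := by
  rw [RingHom.map_det]
  rfl

theorem IsRep.map {S : Type} [CommRing S] {M : Matroid α} {A : Matrix (Fin d) α T}
    (hA : IsRep M A) (φ : T →+* S) : IsRep M (A.map φ) := by
  constructor
  · intro t ht hB
    rw [det_submatrix_map]
    exact (hA.isUnit_det t ht hB).map φ
  · intro t ht hB
    rw [det_submatrix_map, hA.det_eq_zero t ht hB, map_zero]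

end Representations

/-! ### Normal forms with respect to a reference circuit -/

namespace ReferenceCircuit

variable {α : Type} {M : Matroid α} {d : ℕ} (γ : ReferenceCircuit M d)

/-- The reference basis. -/
def basis (j : Fin d) : α := γ.toFun j.castSucc

theorem basis_injective : Function.Injective γ.basis := fun _ _ h =>
  Fin.castSucc_injective _ (γ.injective h)

theorem basis_ne_last (j : Fin d) : γ.basis j ≠ γ.toFun (Fin.last d) := fun h =>
  (Fin.castSucc_lt_last j).ne (γ.injective h)

theorem toFun_mem (j : Fin (d + 1)) : γ.toFun j ∈ M.E :=
  γ.isCircuit.subset_ground (mem_range_self j)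

theorem basis_mem (j : Fin d) : γ.basis j ∈ M.E := γ.toFun_mem _

/-- Removing one element from the circuit leaves an independent set of `d` elements, which is a
basis because the rank is `d`. -/
theorem isBase_diff (i : Fin (d + 1)) : M.IsBase (range γ.toFun \ {γ.toFun i}) := by
  have hind := γ.isCircuit.sdiff_singleton_indep (mem_range_self i)
  obtain ⟨B, hB, hsub⟩ := hind.exists_isBase_superset
  have hcard : (range γ.toFun \ {γ.toFun i}).encard = d := by
    have h1 : (range γ.toFun).encard = d + 1 := by
      rw [← image_univ, γ.injective.encard_image]
      simp
    have h2 := encard_sdiff_singleton_add_one (mem_range_self (f := γ.toFun) i)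
    rw [h1] at h2
    exact WithTop.add_right_cancel ENat.one_ne_top h2
  have hBd : B.encard = d := hB.encard_eq_eRank.trans γ.eRank_eq
  have hfin : B.Finite := finite_of_encard_eq_coe hBd
  have := hfin.eq_of_subset_of_encard_le' hsub (by rw [hcard, hBd])
  rwa [this]

theorem range_eq : range γ.toFun = insert (γ.toFun (Fin.last d)) (range γ.basis) := by
  ext x
  constructor
  · rintro ⟨i, rfl⟩
    induction i using Fin.lastCases with
    | last => exact Or.inl rfl
    | cast i => exact Or.inr ⟨i, rfl⟩
  · rintro (rfl | ⟨i, rfl⟩)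
    · exact mem_range_self _
    · exact mem_range_self _

theorem isBase_range_basis : M.IsBase (range γ.basis) := by
  have := γ.isBase_diff (Fin.last d)
  rwa [range_eq, insert_sdiff_of_mem _ (mem_singleton _), sdiff_singleton_eq_self] at this
  rintro ⟨j, hj⟩
  exact γ.basis_ne_last j hj

theorem range_update (i : Fin d) (e : α) :
    range (Function.update γ.basis i e) = insert e (γ.basis '' {j | j ≠ i}) := by
  ext x
  constructor
  · rintro ⟨j, rfl⟩
    by_cases h : j = i
    · subst h
      simp
    · rw [Function.update_of_ne h]
      exact Or.inr ⟨j, h, rfl⟩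
  · rintro (rfl | ⟨j, hj, rfl⟩)
    · exact ⟨i, by simp⟩
    · exact ⟨j, Function.update_of_ne hj _ _⟩

theorem mem_support_iff (e : α) (i : Fin d) :
    i ∈ γ.support e ↔ M.IsBase (range (Function.update γ.basis i e)) := by
  rw [range_update]
  rfl

theorem mem_support_last (i : Fin d) : i ∈ γ.support (γ.toFun (Fin.last d)) := by
  have h := γ.isBase_diff i.castSucc
  rw [mem_support_iff, range_update]
  convert h using 1
  rw [range_eq]
  ext x
  constructor
  · rintro (rfl | ⟨j, hj, rfl⟩)
    · exact ⟨Or.inl rfl, (γ.basis_ne_last i).symm⟩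
    · exact ⟨Or.inr ⟨j, rfl⟩, fun h => hj (γ.basis_injective h)⟩
  · rintro ⟨rfl | ⟨j, rfl⟩, hx⟩
    · exact Or.inl rfl
    · exact Or.inr ⟨j, fun h => hx (h ▸ rfl), rfl⟩

theorem exists_isGreatest {s : Set (Fin d)} (h : s.Nonempty) : ∃ i, IsGreatest s i := by
  obtain ⟨i, hi, hmax⟩ := s.toFinite.exists_maximal h
  exact ⟨i, hi, fun j hj => not_lt.1 fun hlt => hlt.not_ge (hmax hj hlt.le)⟩

/-- The matrix `A` is normalized with respect to the reference circuit. -/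
structure IsNormal {T : Type} [CommRing T] (A : Matrix (Fin d) α T) : Prop where
  apply_last : ∀ i, A i (γ.toFun (Fin.last d)) = 1
  apply_basis : ∀ i j, A i (γ.basis j) = if i = j then 1 else 0
  apply_of_notMem : ∀ e ∈ M.E, e ∉ range γ.toFun → ∀ i ∉ γ.support e, A i e = 0
  apply_of_isGreatest : ∀ e ∈ M.E, e ∉ range γ.toFun → ∀ i, IsGreatest (γ.support e) i → A i e = 1

section Normalize

variable {T : Type} [CommRing T]

theorem IsNormal.map {γ : ReferenceCircuit M d} {S : Type} [CommRing S]
    {A : Matrix (Fin d) α T} (h : γ.IsNormal A) (φ : T →+* S) : γ.IsNormal (A.map φ) where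
  apply_last i := by simp [h.apply_last]
  apply_basis i j := by
    rw [Matrix.map_apply, h.apply_basis]
    split_ifs <;> simp
  apply_of_notMem e he hγ i hi := by simp [h.apply_of_notMem e he hγ i hi]
  apply_of_isGreatest e he hγ i hi := by simp [h.apply_of_isGreatest e he hγ i hi]

/-- Cramer's rule for the identity matrix. It turns single entries into minors, so that the entries
of a representation are units on the support and vanish off it. -/
theorem apply_eq_det (A : Matrix (Fin d) α T) (hA : A.submatrix id γ.basis = 1) (i : Fin d)
    (e : α) : A i e = (A.submatrix id (Function.update γ.basis i e)).det := by
  have : A.submatrix id (Function.update γ.basis i e) =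
      (A.submatrix id γ.basis).updateCol i fun k => A k e := by
    ext k j
    by_cases h : j = i
    · subst h
      simp
    · simp [h]
  rw [this, hA, ← Matrix.cramer_apply, Matrix.cramer_one]
  rfl

theorem isUnit_apply (A : Matrix (Fin d) α T) (hrep : IsRep M A)
    (hA : A.submatrix id γ.basis = 1) {e : α} (he : e ∈ M.E) {i : Fin d} (hi : i ∈ γ.support e) :
    IsUnit (A i e) := by
  rw [γ.apply_eq_det A hA]
  refine hrep.isUnit_det _ (fun j => ?_) ((γ.mem_support_iff e i).1 hi)
  by_cases h : j = i
  · subst h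
    simpa using he
  · simpa [h] using γ.basis_mem j

theorem apply_eq_zero (A : Matrix (Fin d) α T) (hrep : IsRep M A)
    (hA : A.submatrix id γ.basis = 1) {e : α} (he : e ∈ M.E) {i : Fin d} (hi : i ∉ γ.support e) :
    A i e = 0 := by
  rw [γ.apply_eq_det A hA]
  refine hrep.det_eq_zero _ (fun j => ?_) fun h => hi ((γ.mem_support_iff e i).2 h)
  by_cases h : j = i
  · subst h
    simpa using he
  · simpa [h] using γ.basis_mem j

/-- Make the reference basis the identity, divide every row by its entry in the column of the last
circuit element, then rescale the columns: this restores the unit vectors and puts a 1 in the last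
place of each remaining support. All divisors are units by `isUnit_apply`. -/
theorem exists_isNormal (A : Matrix (Fin d) α T) (hrep : IsRep M A) :
    ∃ A' : Matrix (Fin d) α T, ProjEquiv M.E A A' ∧ γ.IsNormal A' := by
  have hB : IsUnit (A.submatrix id γ.basis).det :=
    hrep.isUnit_det _ γ.basis_mem γ.isBase_range_basis
  set B := A.submatrix id γ.basis with hBdef
  let A₁ : Matrix (Fin d) α T := B⁻¹ * A
  have hA₁ : A₁.submatrix id γ.basis = 1 := by
    have : A₁.submatrix id γ.basis = B⁻¹ * B := rfl
    rw [this, Matrix.nonsing_inv_mul B hB]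
  have hequiv : ProjEquiv M.E A A₁ :=
    ⟨B⁻¹, fun _ => 1, Matrix.isUnit_nonsing_inv_det B hB, fun e _ i => by simp [A₁]⟩
  have hrep₁ := hrep.of_projEquiv hequiv
  choose r hr using fun i => γ.isUnit_apply A₁ hrep₁ hA₁ (γ.toFun_mem _) (γ.mem_support_last i)
  have hu : ∀ e, ∃ u : Tˣ, (∀ i, e = γ.basis i → u = r i) ∧ (e = γ.toFun (Fin.last d) → u = 1) ∧
      (e ∈ M.E → e ∉ range γ.toFun → ∀ i, IsGreatest (γ.support e) i →
        ((r i)⁻¹ : Tˣ) * A₁ i e * u = 1) := by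
    intro e
    by_cases he : e ∈ range γ.toFun
    · obtain ⟨i, rfl⟩ := he
      induction i using Fin.lastCases with
      | last => exact ⟨1, fun i hi => absurd hi.symm (γ.basis_ne_last i), fun _ => rfl,
          fun _ h => absurd (mem_range_self _) h⟩
      | cast i =>
        refine ⟨r i, fun j hj => ?_, fun h => absurd h (γ.basis_ne_last i),
          fun _ h => absurd (mem_range_self _) h⟩
        rw [γ.basis_injective (show γ.basis i = γ.basis j from hj)]
    · have h1 : ∀ i, e ≠ γ.basis i := fun i h => he (h ▸ mem_range_self _)
      have h2 : e ≠ γ.toFun (Fin.last d) := fun h => he (h ▸ mem_range_self _)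
      by_cases hg : e ∈ M.E ∧ ∃ i, IsGreatest (γ.support e) i
      · obtain ⟨heE, i, hi⟩ := hg
        obtain ⟨w, hw⟩ := γ.isUnit_apply A₁ hrep₁ hA₁ heE hi.1
        refine ⟨w⁻¹ * r i, fun i h => absurd h (h1 i), fun h => absurd h h2, fun _ _ j hj => ?_⟩
        rw [hj.unique hi, ← hw, ← Units.val_mul, ← Units.val_mul]
        simp
      · refine ⟨1, fun i h => absurd h (h1 i), fun h => absurd h h2, fun h3 _ i hi => ?_⟩
        exact absurd ⟨h3, i, hi⟩ hg
  choose u hu1 hu2 hu3 using hu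
  let A₂ : Matrix (Fin d) α T := Matrix.of fun i e => ((r i)⁻¹ : Tˣ) * A₁ i e * u e
  have hentry : ∀ i j, A₁ i (γ.basis j) = if i = j then 1 else 0 := fun i j => by
    have := congrFun (congrFun hA₁ i) j
    rwa [Matrix.one_apply] at this
  refine ⟨A₂, hequiv.trans ⟨Matrix.diagonal fun i => (((r i)⁻¹ : Tˣ) : T), u, ?_, ?_⟩, ?_⟩
  · rw [Matrix.det_diagonal, ← Units.coe_prod]
    exact Units.isUnit _
  · intro e _ i
    rw [Matrix.diagonal_mul]
    rfl
  · refine ⟨fun i => ?_, fun i j => ?_, fun e he hγ i hi => ?_, fun e he hγ i hi => hu3 e he hγ i hi⟩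
    · simp only [A₂, Matrix.of_apply]
      rw [hu2 _ rfl, ← hr, Units.val_one, mul_one, Units.inv_mul]
    · simp only [A₂, Matrix.of_apply]
      rw [hentry, hu1 _ j rfl]
      split_ifs with h
      · rw [h, mul_one, Units.inv_mul]
      · simp
    · simp only [A₂, Matrix.of_apply]
      rw [γ.apply_eq_zero A₁ hrep₁ hA₁ he hi]
      simp

variable {γ} in
-- The unit vectors force the row operation to be diagonal, the all-ones column forces it to be
-- scalar, and the 1 in the last place of the support forces the scaling of each other column to
-- cancel that scalar.
theorem IsNormal.eq_of_projEquiv {A A' : Matrix (Fin d) α T} (hA : γ.IsNormal A)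
    (hA' : γ.IsNormal A') (h : ProjEquiv M.E A A') : ∀ e ∈ M.E, ∀ i, A i e = A' i e := by
  obtain ⟨g, u, -, h⟩ := h
  have hcol : ∀ i j, (g * A) i (γ.basis j) = g i j := fun i j => by
    simp [Matrix.mul_apply, hA.apply_basis]
  have h1 : ∀ i j, (if i = j then 1 else 0) = g i j * u (γ.basis j) := fun i j => by
    rw [← hcol, ← h _ (γ.basis_mem j), hA'.apply_basis]
  have hg0 : ∀ i j, i ≠ j → g i j = 0 := fun i j hij => by
    have := h1 i j
    rw [if_neg hij] at this
    exact (Units.mul_left_eq_zero _).1 this.symm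
  have hdiag : ∀ i e, (g * A) i e = g i i * A i e := fun i e => by
    rw [Matrix.mul_apply]
    exact Finset.sum_eq_single i (fun j _ hj => by rw [hg0 i j hj.symm, zero_mul])
      fun h => absurd (Finset.mem_univ _) h
  have hgi : ∀ i, g i i = ((u (γ.toFun (Fin.last d)))⁻¹ : Tˣ) := fun i => by
    have := h _ (γ.toFun_mem (Fin.last d)) i
    rw [hdiag, hA.apply_last, hA'.apply_last, mul_one] at this
    exact Units.eq_inv_of_mul_eq_one_right this.symm
  intro e he i
  by_cases hγ : e ∈ range γ.toFun
  · rw [range_eq] at hγ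
    rcases hγ with rfl | ⟨j, rfl⟩
    · rw [hA.apply_last, hA'.apply_last]
    · rw [hA.apply_basis, hA'.apply_basis]
  · by_cases hi : i ∈ γ.support e
    · obtain ⟨k, hk⟩ := exists_isGreatest ⟨i, hi⟩
      have h2 := h e he k
      rw [hdiag, hA.apply_of_isGreatest e he hγ k hk, hA'.apply_of_isGreatest e he hγ k hk,
        hgi, mul_one] at h2
      rw [h e he i, hdiag, hgi, mul_right_comm, ← h2, one_mul]
    · rw [hA.apply_of_notMem e he hγ i hi, hA'.apply_of_notMem e he hγ i hi]

end Normalize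

end ReferenceCircuit

/-! ### Universal representations -/

/-- The matrix `U` over `R` is a universal representation of `M` up to equivalence. -/
structure IsModuli {α : Type} {d : ℕ} (M : Matroid α) {R : Type} [CommRing R] [Algebra ℂ R]
    (U : Matrix (Fin d) α R) : Prop where
  isRep : IsRep M U
  exists_hom : ∀ (T : Type) [CommRing T] [Algebra ℂ T] (A : Matrix (Fin d) α T), IsRep M A →
    ∃ φ : R →ₐ[ℂ] T, ProjEquiv M.E (U.map φ) A
  hom_ext : ∀ (T : Type) [CommRing T] [Algebra ℂ T] (φ ψ : R →ₐ[ℂ] T),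
    ProjEquiv M.E (U.map φ) (U.map ψ) → φ = ψ

namespace IsModuli

variable {α : Type} {d : ℕ} {M : Matroid α}

/-- Yoneda: each universal matrix is induced from the other, and `hom_ext` makes the two composites
identities. -/
theorem nonempty_algEquiv {R R' : Type} [CommRing R] [Algebra ℂ R] [CommRing R'] [Algebra ℂ R']
    {U : Matrix (Fin d) α R} {U' : Matrix (Fin d) α R'} (h : IsModuli M U) (h' : IsModuli M U') :
    Nonempty (R ≃ₐ[ℂ] R') := by
  obtain ⟨φ, hφ⟩ := h.exists_hom R' U' h'.isRep
  obtain ⟨ψ, hψ⟩ := h'.exists_hom R U h.isRep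
  refine ⟨AlgEquiv.ofAlgHom φ ψ (h'.hom_ext _ _ _ ?_) (h.hom_ext _ _ _ ?_)⟩
  · have h1 := (hψ.map (φ : R →+* R')).trans hφ
    simpa [Matrix.map_map] using h1
  · have h1 := (hφ.map (ψ : R' →+* R)).trans hψ
    simpa [Matrix.map_map] using h1

/-- The maximal minors of a matrix on the bases of a matroid. -/
def baseMinors {P : Type} [CommRing P] (M : Matroid α) (V : Matrix (Fin d) α P) : Set P :=
  {f | ∃ t : Fin d → α, (∀ j, t j ∈ M.E) ∧ M.IsBase (range t) ∧ f = (V.submatrix id t).det}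

/-- The nonbasis minors vanish already over `P`, so a homomorphism from `P` carries `V` to a
representation exactly when it inverts the base minors, that is, when it factors through the
localization. -/
theorem localization {P R : Type} [CommRing P] [Algebra ℂ P] [CommRing R] [Algebra ℂ R]
    [Algebra P R] [IsScalarTower ℂ P R] (V : Matrix (Fin d) α P)
    [IsLocalization (Submonoid.closure (baseMinors M V)) R]
    (hzero : ∀ t : Fin d → α, (∀ j, t j ∈ M.E) → ¬ M.IsBase (range t) →
      (V.submatrix id t).det = 0)
    (hex : ∀ (T : Type) [CommRing T] [Algebra ℂ T] (A : Matrix (Fin d) α T), IsRep M A →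
      ∃ φ : P →ₐ[ℂ] T, ProjEquiv M.E (V.map φ) A)
    (hext : ∀ (T : Type) [CommRing T] [Algebra ℂ T] (φ ψ : P →ₐ[ℂ] T), IsRep M (V.map φ) →
      IsRep M (V.map ψ) → ProjEquiv M.E (V.map φ) (V.map ψ) → φ = ψ) :
    IsModuli M (V.map (algebraMap P R)) := by
  have hrep : IsRep M (V.map (algebraMap P R)) := by
    constructor
    · intro t ht hB
      rw [det_submatrix_map]
      exact IsLocalization.map_units R (⟨_, Submonoid.subset_closure ⟨t, ht, hB, rfl⟩⟩ :
        Submonoid.closure (baseMinors M V))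
    · intro t ht hB
      rw [det_submatrix_map, hzero t ht hB, map_zero]
  refine ⟨hrep, ?_, ?_⟩
  · intro T _ _ A hA
    obtain ⟨φ, hφ⟩ := hex T A hA
    have hφrep : IsRep M (V.map φ) := hA.of_projEquiv hφ.symm
    have hu : ∀ y : Submonoid.closure (baseMinors M V), IsUnit (φ y) := by
      rintro ⟨y, hy⟩
      have hle : Submonoid.closure (baseMinors M V) ≤ (IsUnit.submonoid T).comap (φ : P →* T) := by
        rw [Submonoid.closure_le]
        rintro _ ⟨t, ht, hB, rfl⟩
        have := hφrep.isUnit_det t ht hB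
        change IsUnit ((φ : P →+* T) (V.submatrix id t).det)
        rw [← det_submatrix_map]
        exact this
      exact hle hy
    refine ⟨IsLocalization.liftAlgHom hu, ?_⟩
    convert hφ using 1
    ext i e
    simp
  · intro T _ _ φ ψ h
    have h1 := hext T (φ.comp (IsScalarTower.toAlgHom ℂ P R)) (ψ.comp (IsScalarTower.toAlgHom ℂ P R))
      (hrep.map (φ : R →+* T)) (hrep.map (ψ : R →+* T)) h
    apply AlgHom.coe_ringHom_injective
    exact IsLocalization.ringHom_ext (Submonoid.closure (baseMinors M V))
      (RingHom.ext fun x => DFunLike.congr_fun h1 x)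

/-- Existence and uniqueness of normal forms reduce the universal property to normalized matrices,
for which equivalence is equality on the ground set. -/
theorem of_isNormal (γ : ReferenceCircuit M d) {P R : Type} [CommRing P] [Algebra ℂ P] [CommRing R]
    [Algebra ℂ R] [Algebra P R] [IsScalarTower ℂ P R] (V : Matrix (Fin d) α P)
    [IsLocalization (Submonoid.closure (baseMinors M V)) R]
    (hzero : ∀ t : Fin d → α, (∀ j, t j ∈ M.E) → ¬ M.IsBase (range t) →
      (V.submatrix id t).det = 0)
    (hnormal : γ.IsNormal V)
    (hex : ∀ (T : Type) [CommRing T] [Algebra ℂ T] (A : Matrix (Fin d) α T), IsRep M A →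
      γ.IsNormal A → ∃ φ : P →ₐ[ℂ] T, ∀ e ∈ M.E, ∀ i, φ (V i e) = A i e)
    (hext : ∀ (T : Type) [CommRing T] [Algebra ℂ T] (φ ψ : P →ₐ[ℂ] T),
      (∀ e ∈ M.E, ∀ i, φ (V i e) = ψ (V i e)) → φ = ψ) :
    IsModuli M (V.map (algebraMap P R)) := by
  refine localization V hzero ?_ ?_
  · intro T _ _ A hA
    obtain ⟨A', hAA', hA'⟩ := γ.exists_isNormal A hA
    obtain ⟨φ, hφ⟩ := hex T A' (hA.of_projEquiv hAA') hA'
    exact ⟨φ, (ProjEquiv.of_eq hφ).trans hAA'.symm⟩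
  · intro T _ _ φ ψ _ _ h
    exact hext T φ ψ (ReferenceCircuit.IsNormal.eq_of_projEquiv (hnormal.map (φ : P →+* T))
      (hnormal.map (ψ : P →+* T)) h)

end IsModuli

/-! ### The realization ring is a moduli ring -/

namespace ReferenceCircuit

variable {α : Type} {M : Matroid α} {d : ℕ} (γ : ReferenceCircuit M d)

open Classical in
/-- The universal normalized matrix modulo the nonbasis ideal. -/
noncomputable def quotientMatrix :
    Matrix (Fin d) α (MvPolynomial γ.Var ℂ ⧸ γ.nonbasisIdeal ℂ) :=
  Matrix.of fun i e => if h : e ∈ M.E then Ideal.Quotient.mk _ (γ.entry ℂ i ⟨e, h⟩) else 0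

theorem quotientMatrix_apply (i : Fin d) {e : α} (h : e ∈ M.E) :
    γ.quotientMatrix i e = Ideal.Quotient.mk _ (γ.entry ℂ i ⟨e, h⟩) := by
  simp [quotientMatrix, h]

theorem det_quotientMatrix (t : Fin d → α) (ht : ∀ j, t j ∈ M.E) :
    (γ.quotientMatrix.submatrix id t).det =
      Ideal.Quotient.mk _ (γ.minor ℂ fun j => ⟨t j, ht j⟩) := by
  rw [minor, RingHom.map_det]
  congr 1
  ext i j
  simp [quotientMatrix_apply, ht]

theorem entry_last (i : Fin d) :
    γ.entry ℂ i ⟨γ.toFun (Fin.last d), γ.toFun_mem _⟩ = 1 := by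
  simp [entry]

theorem entry_basis (i j : Fin d) :
    γ.entry ℂ i ⟨γ.basis j, γ.basis_mem _⟩ = if i = j then 1 else 0 := by
  have h1 : γ.basis j ∈ range γ.toFun := mem_range_self _
  have h3 : γ.basis j = γ.toFun i.castSucc ↔ i = j :=
    ⟨fun h => (γ.basis_injective h).symm, fun h => h ▸ rfl⟩
  simp [entry, h1, γ.basis_ne_last, h3]

theorem isNormal_quotientMatrix : γ.IsNormal γ.quotientMatrix where
  apply_last i := by rw [γ.quotientMatrix_apply i (γ.toFun_mem _), entry_last, map_one]
  apply_basis i j := by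
    rw [γ.quotientMatrix_apply i (γ.basis_mem _), entry_basis]
    split_ifs <;> simp
  apply_of_notMem e he hγ i hi := by
    rw [γ.quotientMatrix_apply i he, entry, dif_neg hγ, dif_neg hi, map_zero]
  apply_of_isGreatest e he hγ i hi := by
    rw [γ.quotientMatrix_apply i he, entry, dif_neg hγ, dif_pos hi.1, dif_pos hi, map_one]

theorem map_basisSubmonoid :
    (γ.basisSubmonoid ℂ).map (Ideal.Quotient.mk (γ.nonbasisIdeal ℂ)) =
      Submonoid.closure (IsModuli.baseMinors M γ.quotientMatrix) := by
  rw [basisSubmonoid, MonoidHom.map_mclosure]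
  congr 1
  ext f
  constructor
  · rintro ⟨_, ⟨t, ht, rfl⟩, rfl⟩
    exact ⟨fun j => t j, fun j => (t j).2, ht, (γ.det_quotientMatrix _ fun j => (t j).2).symm⟩
  · rintro ⟨t, ht, hB, rfl⟩
    exact ⟨_, ⟨fun j => ⟨t j, ht j⟩, hB, rfl⟩, (γ.det_quotientMatrix t ht).symm⟩

/-- The universal normalized matrix over the realization ring. -/
noncomputable def universalMatrix : Matrix (Fin d) α (γ.RealizationRing ℂ) :=
  γ.quotientMatrix.map (algebraMap _ _)

theorem isNormal_universalMatrix : γ.IsNormal γ.universalMatrix :=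
  γ.isNormal_quotientMatrix.map _

/-- The variables go to the corresponding entries of `A`. Normality accounts for the constant
entries, and the vanishing minors of `A` kill the nonbasis ideal. -/
theorem exists_quotient_algHom {T : Type} [CommRing T] [Algebra ℂ T] (A : Matrix (Fin d) α T)
    (hA : IsRep M A) (hn : γ.IsNormal A) :
    ∃ φ : (MvPolynomial γ.Var ℂ ⧸ γ.nonbasisIdeal ℂ) →ₐ[ℂ] T,
      ∀ e ∈ M.E, ∀ i, φ (γ.quotientMatrix i e) = A i e := by
  let φ₀ : MvPolynomial γ.Var ℂ →ₐ[ℂ] T := MvPolynomial.aeval fun p => A p.1.1 p.1.2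
  have h0 : ∀ e (he : e ∈ M.E) i, φ₀ (γ.entry ℂ i ⟨e, he⟩) = A i e := by
    intro e he i
    by_cases hγ : e ∈ range γ.toFun
    · have h1 := hγ
      rw [range_eq] at h1
      rcases h1 with rfl | ⟨j, rfl⟩
      · rw [entry_last, hn.apply_last, map_one]
      · rw [entry_basis, hn.apply_basis]
        split_ifs <;> simp
    · rw [entry, dif_neg hγ]
      split_ifs with h1 h2
      · rw [map_one, hn.apply_of_isGreatest e he hγ i h2]
      · exact MvPolynomial.aeval_X _ _
      · rw [map_zero, hn.apply_of_notMem e he hγ i h1]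
  refine ⟨Ideal.Quotient.liftₐ _ φ₀ ?_, fun e he i => ?_⟩
  · intro f hf
    refine (Ideal.span_le.2 ?_ : γ.nonbasisIdeal ℂ ≤ RingHom.ker φ₀) hf
    rintro _ ⟨t, ht, rfl⟩
    rw [SetLike.mem_coe, RingHom.mem_ker, minor, AlgHom.map_det,
      ← hA.det_eq_zero (fun j => t j) (fun j => (t j).2) ht]
    congr 1
    ext i j
    simp [h0]
  · rw [γ.quotientMatrix_apply i he]
    exact h0 e he i

theorem quotient_algHom_ext {T : Type} [CommRing T] [Algebra ℂ T]
    (φ ψ : (MvPolynomial γ.Var ℂ ⧸ γ.nonbasisIdeal ℂ) →ₐ[ℂ] T)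
    (h : ∀ e ∈ M.E, ∀ i, φ (γ.quotientMatrix i e) = ψ (γ.quotientMatrix i e)) : φ = ψ := by
  apply Ideal.Quotient.algHom_ext
  apply MvPolynomial.algHom_ext
  rintro ⟨⟨i, e⟩, he, hγ, hi, hg⟩
  have := h e he i
  rw [γ.quotientMatrix_apply i he, entry, dif_neg hγ, dif_pos hi, dif_neg hg] at this
  exact this

instance : IsLocalization (Submonoid.closure (IsModuli.baseMinors M γ.quotientMatrix))
    (γ.RealizationRing ℂ) := by
  rw [← map_basisSubmonoid]
  infer_instance

theorem isModuli : IsModuli M γ.universalMatrix :=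
  IsModuli.of_isNormal γ γ.quotientMatrix
    (fun t ht hB => by
      rw [γ.det_quotientMatrix t ht, Ideal.Quotient.eq_zero_iff_mem]
      exact Ideal.subset_span ⟨_, hB, rfl⟩)
    γ.isNormal_quotientMatrix
    (fun _ _ _ A hA hn => γ.exists_quotient_algHom A hA hn)
    (fun _ _ _ φ ψ h => γ.quotient_algHom_ext φ ψ h)

theorem exists_algHom {T : Type} [CommRing T] [Algebra ℂ T] (A : Matrix (Fin d) α T)
    (hA : IsRep M A) (hn : γ.IsNormal A) :
    ∃ φ : γ.RealizationRing ℂ →ₐ[ℂ] T, ∀ e ∈ M.E, ∀ i, φ (γ.universalMatrix i e) = A i e := by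
  obtain ⟨φ, hφ⟩ := γ.isModuli.exists_hom T A hA
  exact ⟨φ, IsNormal.eq_of_projEquiv (γ.isNormal_universalMatrix.map (φ : _ →+* T)) hn hφ⟩

theorem algHom_ext {T : Type} [CommRing T] [Algebra ℂ T] (φ ψ : γ.RealizationRing ℂ →ₐ[ℂ] T)
    (h : ∀ e ∈ M.E, ∀ i, φ (γ.universalMatrix i e) = ψ (γ.universalMatrix i e)) : φ = ψ :=
  γ.isModuli.hom_ext T φ ψ (ProjEquiv.of_eq h)

theorem finiteType (hE : M.E.Finite) : Algebra.FiniteType ℂ (γ.RealizationRing ℂ) := by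
  have := hE.to_subtype
  have h1 : Finite γ.Var := by
    refine Finite.of_injective (β := Fin d × M.E) (fun p => (p.1.1, ⟨p.1.2, p.2.1⟩)) ?_
    rintro ⟨⟨i, e⟩, h⟩ ⟨⟨i', e'⟩, h'⟩ heq
    simp only [Prod.mk.injEq, Subtype.mk.injEq] at heq
    obtain ⟨rfl, rfl⟩ := heq
    rfl
  have hfin : (IsModuli.baseMinors M γ.quotientMatrix).Finite := by
    refine (Set.finite_range fun t : Fin d → M.E =>
      (γ.quotientMatrix.submatrix id fun j => (t j : α)).det).subset ?_
    rintro _ ⟨t, ht, -, rfl⟩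
    exact ⟨fun j => ⟨t j, ht j⟩, rfl⟩
  have hmfg : Monoid.FG (Submonoid.closure (IsModuli.baseMinors M γ.quotientMatrix)) :=
    (Monoid.fg_iff_submonoid_fg _).2 ⟨hfin.toFinset, by simp⟩
  exact .trans (S := MvPolynomial γ.Var ℂ ⧸ γ.nonbasisIdeal ℂ) inferInstance
    (IsLocalization.finiteType_of_monoid_fg
      (Submonoid.closure (IsModuli.baseMinors M γ.quotientMatrix)) _)

end ReferenceCircuit

/-! ### Bases of free extensions and coextensions -/

namespace Matroid

variable {α : Type*} {M : Matroid α} {a : α}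

theorem freeExtension_isBase_iff_of_notMem (ha : a ∉ M.E) {B : Set α} (hB : a ∉ B) :
    (M.freeExtension a).IsBase B ↔ M.IsBase B := by
  rw [freeExtension_isBase_iff M ha]
  refine ⟨?_, Or.inl⟩
  rintro (h | ⟨B', -, b, -, rfl⟩)
  · exact h
  · exact absurd (mem_insert _ _) hB

theorem freeExtension_isBase_insert_iff (ha : a ∉ M.E) {I : Set α} (hI : a ∉ I) :
    (M.freeExtension a).IsBase (insert a I) ↔ ∃ b, b ∉ I ∧ M.IsBase (insert b I) := by
  rw [freeExtension_isBase_iff M ha]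
  constructor
  · rintro (h | ⟨B, hB, b, hb, h⟩)
    · exact absurd (h.subset_ground (mem_insert _ _)) ha
    · refine ⟨b, ?_⟩
      have : I = B \ {b} := by
        have h1 := congrArg (fun s => s \ {a}) h
        simp only [insert_sdiff_of_mem, mem_singleton] at h1
        rwa [sdiff_singleton_eq_self hI, sdiff_singleton_eq_self] at h1
        exact fun h => ha (hB.subset_ground h.1)
      subst this
      exact ⟨fun h => h.2 rfl, by rwa [insert_sdiff_singleton, insert_eq_of_mem hb]⟩
  · rintro ⟨b, hb, hB⟩
    exact Or.inr ⟨_, hB, b, mem_insert _ _, by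
      rw [insert_sdiff_of_mem _ (mem_singleton b), sdiff_singleton_eq_self hb]⟩

/-- The complement of a set through `a` avoids `a`, and the bases of a free extension that avoid `a`
are the old ones. In linear terms, contracting `a` gives back `M`. -/
theorem freeCoextension_isBase_insert_iff (ha : a ∉ M.E) {I : Set α} (hI : a ∉ I) :
    (M.freeCoextension a).IsBase (insert a I) ↔ M.IsBase I := by
  rw [freeCoextension, dual_isBase_iff', freeExtension_ground, dual_ground]
  have h1 : insert a M.E \ insert a I = M.E \ I := by
    ext x
    simp only [mem_sdiff, mem_insert_iff]
    constructor
    · rintro ⟨rfl | hx, h⟩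
      · exact absurd (Or.inl rfl) h
      · exact ⟨hx, fun hI => h (Or.inr hI)⟩
    · rintro ⟨hx, h⟩
      refine ⟨Or.inr hx, ?_⟩
      rintro (rfl | hI)
      · exact ha hx
      · exact h hI
  rw [h1, freeExtension_isBase_iff_of_notMem (by simpa using ha) (fun h => ha h.1)]
  constructor
  · rintro ⟨h, hsub⟩
    have hIE : I ⊆ M.E := fun x hx =>
      (hsub (Or.inr hx)).resolve_left fun h => hI (h ▸ hx)
    rwa [dual_isBase_iff sdiff_subset, sdiff_sdiff_cancel_left hIE] at h
  · intro h
    refine ⟨?_, insert_subset_insert h.subset_ground⟩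
    rwa [dual_isBase_iff sdiff_subset, sdiff_sdiff_cancel_left h.subset_ground]

/-- The complement of `B` contains `a`, so it comes from a basis of the dual by exchanging an
element for `a`; that element is the superfluous member `b` of `B`. -/
theorem freeCoextension_isBase_iff_of_notMem (ha : a ∉ M.E) {B : Set α} (hB : a ∉ B) :
    (M.freeCoextension a).IsBase B ↔ B ⊆ M.E ∧ ∃ b ∈ B, M.IsBase (B \ {b}) := by
  rw [freeCoextension, dual_isBase_iff', freeExtension_ground, dual_ground]
  have h1 : insert a M.E \ B = insert a (M.E \ B) := insert_sdiff_of_notMem _ hB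
  rw [h1, freeExtension_isBase_insert_iff (by simpa using ha) (fun h => ha h.1)]
  constructor
  · rintro ⟨⟨b, hb, h⟩, hsub⟩
    have hBE : B ⊆ M.E := fun x hx => (hsub hx).resolve_left fun h => hB (h ▸ hx)
    have hbE : b ∈ M.E := h.subset_ground (mem_insert _ _)
    have hbB : b ∈ B := by_contra fun h => hb ⟨hbE, h⟩
    refine ⟨hBE, b, hbB, ?_⟩
    have hsub' : insert b (M.E \ B) ⊆ M.E := insert_subset hbE sdiff_subset
    rw [dual_isBase_iff hsub'] at h
    convert h using 1
    ext x
    simp only [mem_sdiff, mem_insert_iff, mem_singleton_iff]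
    constructor
    · rintro ⟨hx, hxb⟩
      refine ⟨hBE hx, ?_⟩
      rintro (h | h)
      · exact hxb h
      · exact h.2 hx
    · rintro ⟨hx, h⟩
      exact ⟨by_contra fun h' => h (Or.inr ⟨hx, h'⟩), fun h' => h (Or.inl h')⟩
  · rintro ⟨hBE, b, hb, h⟩
    refine ⟨⟨b, fun h => h.2 hb, ?_⟩, hBE.trans (subset_insert _ _)⟩
    have hsub : insert b (M.E \ B) ⊆ M.E := insert_subset (hBE hb) sdiff_subset
    rw [dual_isBase_iff hsub]
    convert h using 1
    ext x
    simp only [mem_sdiff, mem_insert_iff, mem_singleton_iff]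
    constructor
    · rintro ⟨hx, h⟩
      exact ⟨by_contra fun h' => h (Or.inr ⟨hx, h'⟩), fun h' => h (Or.inl h')⟩
    · rintro ⟨hx, hxb⟩
      refine ⟨hBE hx, ?_⟩
      rintro (h | h)
      · exact hxb h
      · exact h.2 hx

/-- Every element of the matroid lies in a basis. -/
def NoLoops (M : Matroid α) : Prop := ∀ e ∈ M.E, ∃ B, M.IsBase B ∧ e ∈ B

end Matroid

/-! ### Spanning circuits and connectedness -/

namespace ReferenceCircuit

variable {α : Type*} {M : Matroid α} {d : ℕ}

/-- A sequence of `d + 1` elements is a reference circuit if deleting any of them leaves a basis. -/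
def ofIsBase (f : Fin (d + 1) → α) (hf : Function.Injective f) (hE : ∀ i, f i ∈ M.E)
    (h : ∀ i, M.IsBase (range f \ {f i})) : ReferenceCircuit M d where
  toFun := f
  injective := hf
  isCircuit := by
    rw [Matroid.isCircuit_iff_dep_forall_sdiff_singleton_indep]
    refine ⟨⟨fun hind => ?_, ?_⟩, ?_⟩
    · have := (h 0).eq_of_subset_indep hind sdiff_subset
      have h0 : f 0 ∈ range f \ {f 0} := this.symm.subset (mem_range_self 0)
      exact h0.2 rfl
    · rintro _ ⟨i, rfl⟩
      exact hE i
    · rintro _ ⟨i, rfl⟩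
      exact (h i).indep
  eRank_eq := by
    rw [← (h 0).encard_eq_eRank]
    have h1 : (range f).encard = d + 1 := by
      rw [← image_univ, hf.encard_image]
      simp
    have h2 := encard_sdiff_singleton_add_one (mem_range_self (f := f) 0)
    rw [h1] at h2
    exact WithTop.add_right_cancel ENat.one_ne_top h2

end ReferenceCircuit

namespace ReferenceCircuit

variable {α : Type} {M : Matroid α} {d : ℕ} (γ : ReferenceCircuit M d)

include γ in
theorem encard_isBase {B : Set α} (hB : M.IsBase B) : B.encard = d :=
  hB.encard_eq_eRank.trans γ.eRank_eq

include γ in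
theorem injective_of_isBase {t : Fin d → α} (ht : M.IsBase (range t)) : Function.Injective t := by
  have h1 := γ.encard_isBase ht
  have h2 : (range t).ncard = d := by
    rw [ncard_def, h1]
    rfl
  rw [← image_univ] at h2
  have := injOn_of_ncard_image_eq (f := t) (s := univ) (by simpa using h2) finite_univ
  exact injOn_univ.1 this

/-- Extend `{e}` to a basis by members of the reference basis; the member left out gives a place in
the support. -/
theorem support_nonempty (hM : M.NoLoops) {e : α} (he : e ∈ M.E) (hγ : e ∉ range γ.toFun) :
    (γ.support e).Nonempty := by
  obtain ⟨B, hB, heB⟩ := hM e he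
  have hind : M.Indep {e} := hB.indep.subset (by simpa using heB)
  obtain ⟨B', hB', heB', hsub⟩ := hind.exists_isBase_subset_union_isBase γ.isBase_range_basis
  have heb : e ∉ range γ.basis := fun ⟨j, hj⟩ => hγ ⟨j.castSucc, hj⟩
  have heB'' : e ∈ B' := heB' rfl
  obtain ⟨i, hi⟩ : ∃ i, γ.basis i ∉ B' := by
    by_contra! hcon
    have h1 : range γ.basis ⊆ B' := by
      rintro _ ⟨i, rfl⟩
      exact hcon i
    have := γ.isBase_range_basis.eq_of_subset_isBase hB' h1
    exact heb (this ▸ heB'')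
  refine ⟨i, ?_⟩
  rw [mem_support_iff]
  have h1 : B' ⊆ range (Function.update γ.basis i e) := by
    rw [range_update]
    intro x hx
    rcases hsub hx with rfl | ⟨j, rfl⟩
    · exact Or.inl rfl
    · exact Or.inr ⟨j, fun h => hi (h ▸ hx), rfl⟩
  have h2 := (finite_range (Function.update γ.basis i e)).eq_of_subset_of_encard_le' h1 (by
    rw [γ.encard_isBase hB', ← image_univ]
    refine (encard_image_le _ _).trans ?_
    simp)
  rwa [← h2]

include γ in
/-- A matroid without loops that has a spanning circuit is connected. -/
theorem isConnected (hM : M.NoLoops) : M.IsConnected := by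
  have key : ∀ (M₁ M₂ : Matroid α) (h : Disjoint M₁.E M₂.E), M = M₁.disjointSum M₂ h →
      γ.toFun (Fin.last d) ∈ M₁.E → M₂.E = ∅ := by
    intro M₁ M₂ h hsum hlast
    have hE : M.E = M₁.E ∪ M₂.E := by rw [hsum, Matroid.disjointSum_ground_eq]
    have hb : ∀ B, M.IsBase B → M₁.IsBase (B ∩ M₁.E) ∧ M₂.IsBase (B ∩ M₂.E) := fun B hB => by
      rw [hsum, Matroid.disjointSum_isBase_iff] at hB
      exact ⟨hB.1, hB.2.1⟩
    -- Every basis of a direct sum meets each summand in a basis. Exchanging an element of a summand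
    -- for one outside it would leave a proper subset of a basis there.
    have hexch : ∀ (N : Matroid α) (i : Fin d) (e : α), γ.basis i ∈ N.E → e ∉ N.E →
        N.IsBase (range γ.basis ∩ N.E) →
        ¬ N.IsBase (insert e (γ.basis '' {j | j ≠ i}) ∩ N.E) := by
      intro N i e hi he hB hB'
      have hsub : insert e (γ.basis '' {j | j ≠ i}) ∩ N.E ⊆ range γ.basis ∩ N.E := by
        rintro x ⟨rfl | ⟨j, -, rfl⟩, hx⟩
        · exact absurd hx he
        · exact ⟨⟨j, rfl⟩, hx⟩
      have heq := hB'.eq_of_subset_isBase hB hsub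
      have hmem : γ.basis i ∈ insert e (γ.basis '' {j | j ≠ i}) ∩ N.E := heq ▸ ⟨⟨i, rfl⟩, hi⟩
      rcases hmem.1 with h1 | ⟨j, hj, hji⟩
      · exact he (h1 ▸ hi)
      · exact hj (γ.basis_injective hji)
    have hbase := hb _ γ.isBase_range_basis
    -- The last circuit element can replace every member of the reference basis, so they all lie in
    -- its summand.
    have hbasis : ∀ i, γ.basis i ∈ M₁.E := by
      intro i
      by_contra hi
      have hi2 : γ.basis i ∈ M₂.E := by
        have := γ.basis_mem i
        rw [hE] at this
        exact this.resolve_left hi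
      exact hexch M₂ i _ hi2 (fun h' => h.notMem_of_mem_left hlast h') hbase.2
        (hb _ (γ.mem_support_last i)).2
    rw [eq_empty_iff_forall_notMem]
    intro e he
    have he1 : e ∉ M₁.E := fun h' => h.notMem_of_mem_left h' he
    have hγ : e ∉ range γ.toFun := by
      rw [range_eq]
      rintro (rfl | ⟨j, rfl⟩)
      · exact he1 hlast
      · exact he1 (hbasis j)
    -- An element of the other summand is not a loop, so it could replace a reference element of the
    -- first summand, which `hexch` forbids.
    obtain ⟨i, hi⟩ := γ.support_nonempty hM (hE ▸ Or.inr he) hγ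
    exact hexch M₁ i e (hbasis i) he1 hbase.1 (hb _ hi).1
  intro M₁ M₂ h hsum
  have hlast : γ.toFun (Fin.last d) ∈ M₁.E ∪ M₂.E := by
    have hE : M.E = M₁.E ∪ M₂.E := by rw [hsum, Matroid.disjointSum_ground_eq]
    exact hE ▸ γ.toFun_mem (Fin.last d)
  rcases hlast with h1 | h2
  · exact Or.inr (key M₁ M₂ h hsum h1)
  · exact Or.inl (key M₂ M₁ h.symm (hsum.trans Matroid.disjointSum_comm) h2)

end ReferenceCircuit

/-! ### Free extensions: a column in general position -/

section Extension

variable {α : Type} {d : ℕ}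

theorem finite_baseMinors {P : Type} [CommRing P] {M : Matroid α} (hE : M.E.Finite)
    (V : Matrix (Fin d) α P) : (IsModuli.baseMinors M V).Finite := by
  have := hE.to_subtype
  refine (Set.finite_range fun t : Fin d → M.E =>
    (V.submatrix id fun j => (t j : α)).det).subset ?_
  rintro _ ⟨t, ht, -, rfl⟩
  exact ⟨fun j => ⟨t j, ht j⟩, rfl⟩

theorem Matrix.det_updateCol_eq_sum {T : Type*} [CommRing T] (A : Matrix (Fin d) (Fin d) T)
    (j : Fin d) (c : Fin d → T) :
    (A.updateCol j c).det = ∑ i, c i * (A.updateCol j (Pi.single i 1)).det := by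
  simp only [← Matrix.cramer_apply, Matrix.cramer_eq_adjugate_mulVec]
  simp [Matrix.mulVec, dotProduct, Pi.single_apply, mul_comm]

theorem det_submatrix_eq_zero {T : Type*} [CommRing T] (A : Matrix (Fin d) α T) {t : Fin d → α}
    {j k : Fin d} (hjk : j ≠ k) (h : t j = t k) : (A.submatrix id t).det = 0 :=
  Matrix.det_zero_of_column_eq hjk fun i => by simp [h]

open Classical in
/-- The matrix `A` with the column of `a` replaced by `c`. -/
noncomputable def replaceCol {T : Type} (A : Matrix (Fin d) α T) (a : α) (c : Fin d → T) :
    Matrix (Fin d) α T :=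
  Matrix.of fun i e => if e = a then c i else A i e

theorem replaceCol_self {T : Type} (A : Matrix (Fin d) α T) (a : α) (c : Fin d → T) (i : Fin d) :
    replaceCol A a c i a = c i := by simp [replaceCol]

theorem replaceCol_of_ne {T : Type} (A : Matrix (Fin d) α T) {a e : α} (he : e ≠ a)
    (c : Fin d → T) (i : Fin d) : replaceCol A a c i e = A i e := by simp [replaceCol, he]

theorem replaceCol_map {T S : Type} (A : Matrix (Fin d) α T) (a : α)
    (c : Fin d → T) (φ : T → S) : (replaceCol A a c).map φ = replaceCol (A.map φ) a (φ ∘ c) := by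
  ext i e
  by_cases h : e = a
  · subst h
    simp [replaceCol_self]
  · simp [replaceCol_of_ne, h]

theorem replaceCol_submatrix_of_notMem {T : Type} (A : Matrix (Fin d) α T) {a : α}
    (c : Fin d → T) {t : Fin d → α} (ht : a ∉ range t) :
    (replaceCol A a c).submatrix id t = A.submatrix id t := by
  ext i j
  exact replaceCol_of_ne A (fun h => ht ⟨j, h⟩) c i

end Extension

namespace ReferenceCircuit

variable {α : Type} {d : ℕ} {M : Matroid α} (γ : ReferenceCircuit M d) {a : α}

/-- The determinant is linear in the new column, and the i-th unit vector is the column of the i-th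
reference element. -/
theorem det_replaceCol {T : Type} [CommRing T] (A : Matrix (Fin d) α T)
    (hA : A.submatrix id γ.basis = 1) (c : Fin d → T) {t : Fin d → α}
    {j : Fin d} (hj : t j = a) (hne : ∀ k, k ≠ j → t k ≠ a) :
    ((replaceCol A a c).submatrix id t).det =
      ∑ i, c i * (A.submatrix id (Function.update t j (γ.basis i))).det := by
  have h1 : (replaceCol A a c).submatrix id t = (A.submatrix id t).updateCol j c := by
    ext i k
    by_cases hk : k = j
    · subst hk
      simp [hj, replaceCol_self]
    · simp [hk, replaceCol_of_ne A (hne k hk)]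
  rw [h1, Matrix.det_updateCol_eq_sum]
  refine Finset.sum_congr rfl fun i _ => ?_
  congr 2
  ext l k
  by_cases hk : k = j
  · subst hk
    have := congrFun (congrFun hA l) i
    simp only [Matrix.submatrix_apply, id_eq] at this
    simp [this, Matrix.one_apply, Pi.single_apply]
  · simp [hk]

theorem IsNormal.submatrix_basis {γ : ReferenceCircuit M d} {T : Type} [CommRing T]
    {A : Matrix (Fin d) α T} (h : γ.IsNormal A) : A.submatrix id γ.basis = 1 := by
  ext i j
  rw [Matrix.submatrix_apply, id, h.apply_basis, Matrix.one_apply]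

theorem range_update_eq_insert {t : Fin d → α} {j : Fin d} (hj : t j = a)
    (hne : ∀ k, k ≠ j → t k ≠ a) (b : α) :
    range (Function.update t j b) = insert b (range t \ {a}) := by
  ext x
  constructor
  · rintro ⟨k, rfl⟩
    by_cases hk : k = j
    · subst hk
      simp
    · rw [Function.update_of_ne hk]
      exact Or.inr ⟨⟨k, rfl⟩, hne k hk⟩
  · rintro (rfl | ⟨⟨k, rfl⟩, hk⟩)
    · exact ⟨j, by simp⟩
    · have : k ≠ j := fun h => hk (h ▸ hj)
      exact ⟨k, Function.update_of_ne this _ _⟩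

/-- The reference circuit of the free extension. -/
def freeExtension (ha : a ∉ M.E) : ReferenceCircuit (M.freeExtension a) d :=
  ofIsBase γ.toFun γ.injective (fun i => Or.inr (γ.toFun_mem i)) fun i => by
    rw [Matroid.freeExtension_isBase_iff_of_notMem ha]
    · exact γ.isBase_diff i
    · rintro ⟨⟨j, hj⟩, -⟩
      exact ha (hj ▸ γ.toFun_mem j)

theorem freeExtension_support (ha : a ∉ M.E) {e : α} (he : e ∈ M.E) :
    (γ.freeExtension ha).support e = γ.support e := by
  ext i
  refine Matroid.freeExtension_isBase_iff_of_notMem ha ?_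
  rintro (rfl | ⟨j, -, hj⟩)
  · exact ha he
  · have hj' : γ.basis j = a := hj
    exact ha (hj' ▸ γ.basis_mem j)

/-- The new element can replace every member of the reference basis. Consequently its normalized
entry 1 always sits in the last row. -/
theorem freeExtension_support_self (ha : a ∉ M.E) : (γ.freeExtension ha).support a = univ := by
  rw [eq_univ_iff_forall]
  intro i
  have h1 : a ∉ γ.basis '' {j | j ≠ i} := by
    rintro ⟨j, -, rfl⟩
    exact ha (γ.basis_mem j)
  refine (Matroid.freeExtension_isBase_insert_iff ha h1).2 ⟨γ.basis i, ?_, ?_⟩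
  · rintro ⟨j, hj, h⟩
    exact hj (γ.basis_injective h)
  · rw [← range_update, Function.update_eq_self]
    exact γ.isBase_range_basis

/-- When `a` occurs once, every cofactor in `det_replaceCol` is a minor of `A` on a nonbasis, since
otherwise `a` could be exchanged into that basis. A free extension thus imposes no equation on the
new column. -/
theorem det_replaceCol_eq_zero {T : Type} [CommRing T] (A : Matrix (Fin d) α T) (hA : IsRep M A)
    (hn : γ.IsNormal A) (ha : a ∉ M.E) (c : Fin d → T) (t : Fin d → α)
    (ht : ∀ j, t j ∈ (M.freeExtension a).E) (hB : ¬ (M.freeExtension a).IsBase (range t)) :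
    ((replaceCol A a c).submatrix id t).det = 0 := by
  by_cases hat : a ∈ range t
  · obtain ⟨j, hj⟩ := hat
    by_cases hne : ∀ k, k ≠ j → t k ≠ a
    · rw [γ.det_replaceCol A hn.submatrix_basis c hj hne]
      refine Finset.sum_eq_zero fun i _ => ?_
      rw [hA.det_eq_zero, mul_zero]
      · intro k
        by_cases hk : k = j
        · subst hk
          simpa using γ.basis_mem i
        · rw [Function.update_of_ne hk]
          exact (ht k).resolve_left (hne k hk)
      · intro hb
        have hinj := γ.injective_of_isBase hb
        rw [range_update_eq_insert hj hne] at hb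
        refine hB ?_
        have h1 : range t = insert a (range t \ {a}) := by
          rw [insert_sdiff_singleton, insert_eq_of_mem (show a ∈ range t from ⟨j, hj⟩)]
        rw [h1, Matroid.freeExtension_isBase_insert_iff ha (fun h => h.2 rfl)]
        refine ⟨_, ?_, hb⟩
        rintro ⟨⟨k, hk⟩, hka⟩
        have hkj : k ≠ j := fun h => hka (by rw [← hk, h, hj]; rfl)
        exact hkj (hinj (by rw [Function.update_of_ne hkj, Function.update_self, hk]))
    · push Not at hne
      obtain ⟨k, hkj, hk⟩ := hne
      exact det_submatrix_eq_zero _ hkj (hk.trans hj.symm)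
  · rw [replaceCol_submatrix_of_notMem A c hat]
    refine hA.det_eq_zero t (fun j => (ht j).resolve_left fun h => hat ⟨j, h⟩) fun h => hB ?_
    rwa [Matroid.freeExtension_isBase_iff_of_notMem ha hat]

/-- Over an infinite field, a normalized representation extends to the free extension. -/
theorem exists_replaceCol_det_ne_zero {k : ℕ} (γ : ReferenceCircuit M (k + 1)) (hE : M.E.Finite)
    (A : Matrix (Fin (k + 1)) α ℂ) (hA : IsRep M A) (hn : γ.IsNormal A) (ha : a ∉ M.E) :
    ∃ c : Fin (k + 1) → ℂ, c (Fin.last k) = 1 ∧ ∀ t : Fin (k + 1) → α,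
      (∀ j, t j ∈ (M.freeExtension a).E) → (M.freeExtension a).IsBase (range t) →
        ((replaceCol A a c).submatrix id t).det ≠ 0 := by
  have hE' : (M.freeExtension a).E.Finite := hE.insert a
  have := hE'.to_subtype
  -- Each basis through `a`, with the position of `a` recorded, asks a linear functional of the new
  -- column not to vanish. Finitely many nonzero functionals have a common point of nonvanishing.
  let I : Type := {p : (Fin (k + 1) → (M.freeExtension a).E) × Fin (k + 1) //
    (p.1 p.2 : α) = a ∧ (M.freeExtension a).IsBase (range fun j => (p.1 j : α))}
  let f : I → Module.Dual ℂ (Fin (k + 1) → ℂ) := fun p =>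
    ∑ i, (A.submatrix id (Function.update (fun j => (p.1.1 j : α)) p.1.2 (γ.basis i))).det •
      LinearMap.proj i
  have hf : ∀ (p : I) c, f p c =
      ∑ i, c i * (A.submatrix id (Function.update (fun j => (p.1.1 j : α)) p.1.2 (γ.basis i))).det :=
    fun p c => by simp [f, mul_comm]
  have hinj : ∀ p : I, ∀ l, l ≠ p.1.2 → (p.1.1 l : α) ≠ a := fun p l hl h =>
    hl ((γ.freeExtension ha).injective_of_isBase p.2.2 (h.trans p.2.1.symm))
  -- The index `none` asks for a nonzero last entry, which is afterwards scaled to 1.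
  let g : Option I → Module.Dual ℂ (Fin (k + 1) → ℂ) := fun o =>
    o.elim (LinearMap.proj (Fin.last k)) f
  obtain ⟨c, -, hc⟩ := Module.Dual.exists_forall_mem_ne_zero_of_forall_exists ⊤ g (by
    rintro (_ | p)
    · exact ⟨Pi.single (Fin.last k) 1, trivial, by simp [g]⟩
    · obtain ⟨⟨t, j⟩, hj, hB⟩ := p
      set t' : Fin (k + 1) → α := fun j => (t j : α) with ht'
      have hne : ∀ l, l ≠ j → t' l ≠ a := hinj ⟨⟨t, j⟩, hj, hB⟩
      have h1 : range t' = insert a (range t' \ {a}) := by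
        rw [insert_sdiff_singleton, insert_eq_of_mem (show a ∈ range t' from ⟨j, hj⟩)]
      rw [h1, Matroid.freeExtension_isBase_insert_iff ha (fun h => h.2 rfl)] at hB
      obtain ⟨b, hb, hB⟩ := hB
      have hind : M.Indep (range t' \ {a}) := hB.indep.subset (subset_insert _ _)
      have hnb : ¬ M.IsBase (range t' \ {a}) := fun h =>
        hb (h.eq_of_subset_isBase hB (subset_insert _ _) ▸ mem_insert _ _)
      -- Some reference element completes the other members of the tuple to a basis, so the
      -- functional is nonzero on the corresponding unit vector.
      obtain ⟨_, ⟨⟨i, rfl⟩, hi⟩, hins⟩ := hind.exists_insert_of_not_isBase hnb γ.isBase_range_basis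
      have hbase := Matroid.insert_isBase_of_insert_indep hb hi hB hins
      rw [← range_update_eq_insert hj hne] at hbase
      refine ⟨Pi.single i 1, trivial, ?_⟩
      change f _ _ ≠ 0
      rw [hf, Finset.sum_eq_single i]
      · simp only [Pi.single_eq_same, one_mul]
        refine (hA.isUnit_det _ (fun l => ?_) hbase).ne_zero
        exact hbase.subset_ground (mem_range_self l)
      · intro l _ hl
        simp [hl]
      · simp)
  have hlast : c (Fin.last k) ≠ 0 := hc none
  have hc' : ∀ p, f p c ≠ 0 := fun p => hc (some p)
  refine ⟨(c (Fin.last k))⁻¹ • c, by simp [hlast], fun t ht hB => ?_⟩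
  by_cases hat : a ∈ range t
  · obtain ⟨j, hj⟩ := hat
    let p : I := ⟨⟨fun l => ⟨t l, ht l⟩, j⟩, hj, hB⟩
    rw [γ.det_replaceCol A hn.submatrix_basis _ hj (hinj p)]
    have h2 := hf p ((c (Fin.last k))⁻¹ • c)
    rw [map_smul] at h2
    refine ne_of_eq_of_ne h2.symm ?_
    exact smul_ne_zero (inv_ne_zero hlast) (hc' p)
  · rw [replaceCol_submatrix_of_notMem A _ hat]
    refine (hA.isUnit_det t (fun j => (ht j).resolve_left fun h => hat ⟨j, h⟩) ?_).ne_zero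
    rwa [Matroid.freeExtension_isBase_iff_of_notMem ha hat] at hB

/-- The polynomial ring that carries the entries of the new column. -/
abbrev ExtRing {k : ℕ} (γ : ReferenceCircuit M (k + 1)) : Type :=
  MvPolynomial (Fin k) (γ.RealizationRing ℂ)

/-- The universal matrix with a new generic column. -/
noncomputable def extMatrix {k : ℕ} (γ : ReferenceCircuit M (k + 1)) (a : α) :
    Matrix (Fin (k + 1)) α γ.ExtRing :=
  replaceCol (γ.universalMatrix.map MvPolynomial.C) a (Fin.snoc (fun i => MvPolynomial.X i) 1)

theorem isNormal_extMatrix {k : ℕ} (γ : ReferenceCircuit M (k + 1)) (ha : a ∉ M.E) :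
    (γ.freeExtension ha).IsNormal (γ.extMatrix a) := by
  have hn := γ.isNormal_universalMatrix.map
    (MvPolynomial.C : γ.RealizationRing ℂ →+* MvPolynomial (Fin k) (γ.RealizationRing ℂ))
  have hne : ∀ e ∈ M.E, e ≠ a := fun e he h => ha (h ▸ he)
  constructor
  · intro i
    refine (replaceCol_of_ne _ (hne _ (γ.toFun_mem _)) _ i).trans ?_
    exact hn.apply_last i
  · intro i j
    refine (replaceCol_of_ne _ (hne _ (γ.basis_mem j)) _ i).trans ?_
    exact hn.apply_basis i j
  · rintro e (rfl | he) hγ i hi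
    · rw [freeExtension_support_self] at hi
      exact absurd (mem_univ _) hi
    · rw [γ.freeExtension_support ha he] at hi
      exact (replaceCol_of_ne _ (hne _ he) _ i).trans (hn.apply_of_notMem e he hγ i hi)
  · rintro e (rfl | he) hγ i hi
    · rw [freeExtension_support_self] at hi
      have : i = Fin.last k := le_antisymm (Fin.le_last i) (hi.2 (mem_univ _))
      subst this
      rw [extMatrix, replaceCol_self, Fin.snoc_last]
    · rw [γ.freeExtension_support ha he] at hi
      exact (replaceCol_of_ne _ (hne _ he) _ i).trans (hn.apply_of_isGreatest e he hγ i hi)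

theorem IsNormal.of_freeExtension {γ : ReferenceCircuit M d} (ha : a ∉ M.E) {T : Type} [CommRing T]
    {A : Matrix (Fin d) α T} (h : (γ.freeExtension ha).IsNormal A) : γ.IsNormal A where
  apply_last := h.apply_last
  apply_basis := h.apply_basis
  apply_of_notMem e he hγ i hi :=
    h.apply_of_notMem e (Or.inr he) hγ i (by rwa [γ.freeExtension_support ha he])
  apply_of_isGreatest e he hγ i hi :=
    h.apply_of_isGreatest e (Or.inr he) hγ i (by rwa [γ.freeExtension_support ha he])

theorem _root_.IsRep.of_freeExtension (ha : a ∉ M.E) {T : Type} [CommRing T]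
    {A : Matrix (Fin d) α T} (h : IsRep (M.freeExtension a) A) : IsRep M A := by
  have hat : ∀ t : Fin d → α, (∀ j, t j ∈ M.E) → a ∉ range t := by
    rintro t ht ⟨j, hj⟩
    exact ha (hj ▸ ht j)
  constructor
  · intro t ht hB
    refine h.isUnit_det t (fun j => Or.inr (ht j)) ?_
    rwa [Matroid.freeExtension_isBase_iff_of_notMem ha (hat t ht)]
  · intro t ht hB
    refine h.det_eq_zero t (fun j => Or.inr (ht j)) ?_
    rwa [Matroid.freeExtension_isBase_iff_of_notMem ha (hat t ht)]

/-- The localization of the polynomial ring of the new column at the base minors. -/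
abbrev ExtLocalization {k : ℕ} (γ : ReferenceCircuit M (k + 1)) (a : α) : Type :=
  Localization (Submonoid.closure (IsModuli.baseMinors (M.freeExtension a) (γ.extMatrix a)))

/-- A normalized representation of the free extension is one of `M` together with a column ending in
1; the new conditions are all open. -/
theorem isModuli_freeExtension {k : ℕ} (γ : ReferenceCircuit M (k + 1)) (ha : a ∉ M.E) :
    IsModuli (M.freeExtension a)
      ((γ.extMatrix a).map (algebraMap γ.ExtRing (γ.ExtLocalization a))) := by
  refine IsModuli.of_isNormal (γ.freeExtension ha) (γ.extMatrix a) ?_ (γ.isNormal_extMatrix ha)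
    ?_ ?_
  · exact fun t ht hB => γ.det_replaceCol_eq_zero _ (γ.isModuli.isRep.map _)
      (γ.isNormal_universalMatrix.map _) ha _ t ht hB
  · intro T _ _ A hA hn
    obtain ⟨φ, hφ⟩ := γ.exists_algHom A (hA.of_freeExtension ha) (hn.of_freeExtension ha)
    let ψ : γ.ExtRing →ₐ[ℂ] T :=
      { MvPolynomial.eval₂Hom (φ : γ.RealizationRing ℂ →+* T) fun i => A i.castSucc a with
        commutes' := fun c => by
          change MvPolynomial.eval₂Hom _ _ (algebraMap ℂ _ c) = _
          rw [IsScalarTower.algebraMap_apply ℂ (γ.RealizationRing ℂ) γ.ExtRing]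
          simp [MvPolynomial.algebraMap_eq] }
    have hψC : ∀ s, ψ (MvPolynomial.C s) = φ s := fun s => MvPolynomial.eval₂Hom_C _ _ s
    have hψX : ∀ i, ψ (MvPolynomial.X i) = A i.castSucc a := fun i =>
      MvPolynomial.eval₂Hom_X' _ _ i
    refine ⟨ψ, fun e he i => ?_⟩
    rcases he with rfl | he
    · rw [extMatrix, replaceCol_self]
      induction i using Fin.lastCases with
      | last =>
        rw [Fin.snoc_last, map_one, hn.apply_of_isGreatest e (Or.inl rfl)]
        · rintro ⟨j, hj⟩
          exact ha (hj ▸ γ.toFun_mem j)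
        · rw [freeExtension_support_self]
          exact ⟨mem_univ _, fun i _ => Fin.le_last i⟩
      | cast i => rw [Fin.snoc_castSucc, hψX]
    · have hea : e ≠ a := fun h => ha (by rwa [← h])
      rw [extMatrix, replaceCol_of_ne _ hea, Matrix.map_apply, hψC, hφ e he]
  · intro T _ _ φ ψ h
    have h1 : φ.comp (IsScalarTower.toAlgHom ℂ (γ.RealizationRing ℂ) γ.ExtRing) =
        ψ.comp (IsScalarTower.toAlgHom ℂ (γ.RealizationRing ℂ) γ.ExtRing) := by
      refine γ.algHom_ext _ _ fun e he i => ?_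
      have := h e (Or.inr he) i
      have hea : e ≠ a := fun h => ha (by rwa [← h])
      rw [extMatrix, replaceCol_of_ne _ hea] at this
      exact this
    apply AlgHom.coe_ringHom_injective
    apply MvPolynomial.ringHom_ext
    · intro r
      exact DFunLike.congr_fun h1 r
    · intro i
      have := h a (Or.inl rfl) i.castSucc
      rw [extMatrix, replaceCol_self, Fin.snoc_castSucc] at this
      exact this

/-- The new realization space is open in affine space over the old one, and every ℂ-point lifts
because a column in general position exists. -/
theorem hasNodalSingularities_freeExtension {k : ℕ} (γ : ReferenceCircuit M (k + 1))
    (ha : a ∉ M.E) (hE : M.E.Finite) (h : HasNodalSingularities (γ.RealizationRing ℂ)) :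
    HasNodalSingularities ((γ.freeExtension ha).RealizationRing ℂ) := by
  have hE' : (M.freeExtension a).E.Finite := hE.insert a
  have := γ.finiteType hE
  have := (γ.freeExtension ha).finiteType hE'
  obtain ⟨e⟩ := (γ.isModuli_freeExtension ha).nonempty_algEquiv (γ.freeExtension ha).isModuli
  have : Algebra.FiniteType ℂ (γ.ExtLocalization a) := Algebra.FiniteType.equiv ‹_› e.symm
  refine HasNodalSingularities.of_algEquiv e ?_
  refine HasNodalSingularities.ascend
    (IsModuli.baseMinors (M.freeExtension a) (γ.extMatrix a)) (finite_baseMinors hE' _) ?_ h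
  intro π
  obtain ⟨c, hc, hdet⟩ := γ.exists_replaceCol_det_ne_zero hE (γ.universalMatrix.map π)
    (γ.isModuli.isRep.map (π : γ.RealizationRing ℂ →+* ℂ))
    (γ.isNormal_universalMatrix.map (π : γ.RealizationRing ℂ →+* ℂ)) ha
  let ψ : γ.ExtRing →ₐ[ℂ] ℂ :=
    { MvPolynomial.eval₂Hom (π : γ.RealizationRing ℂ →+* ℂ) fun i => c i.castSucc with
      commutes' := fun c => by
        change MvPolynomial.eval₂Hom _ _ (algebraMap ℂ _ c) = _
        rw [IsScalarTower.algebraMap_apply ℂ (γ.RealizationRing ℂ) γ.ExtRing]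
        simp [MvPolynomial.algebraMap_eq] }
  have hψC : ∀ s, ψ (MvPolynomial.C s) = π s := fun s => MvPolynomial.eval₂Hom_C _ _ s
  have hψX : ∀ i, ψ (MvPolynomial.X i) = c i.castSucc := fun i =>
    MvPolynomial.eval₂Hom_X' _ _ i
  have hψ : (γ.extMatrix a).map ψ = replaceCol (γ.universalMatrix.map π) a c := by
    rw [extMatrix, replaceCol_map]
    congr 1
    · ext i e
      exact hψC _
    · ext i
      induction i using Fin.lastCases with
      | last => simp [hc]
      | cast i => simp [hψX]
  have hu : ∀ y : Submonoid.closure (IsModuli.baseMinors (M.freeExtension a) (γ.extMatrix a)),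
      IsUnit (ψ y) := by
    rintro ⟨y, hy⟩
    have hle : Submonoid.closure (IsModuli.baseMinors (M.freeExtension a) (γ.extMatrix a)) ≤
        (IsUnit.submonoid ℂ).comap (ψ : γ.ExtRing →* ℂ) := by
      rw [Submonoid.closure_le]
      rintro _ ⟨t, ht, hB, rfl⟩
      change IsUnit ((ψ : γ.ExtRing →+* ℂ) ((γ.extMatrix a).submatrix id t).det)
      rw [← det_submatrix_map, isUnit_iff_ne_zero]
      have := hdet t ht hB
      rw [← hψ] at this
      exact this
    exact hle hy
  refine ⟨IsLocalization.liftAlgHom hu, ?_⟩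
  refine AlgHom.ext fun r => ?_
  rw [AlgHom.comp_apply, IsScalarTower.coe_toAlgHom',
    IsScalarTower.algebraMap_apply (γ.RealizationRing ℂ) γ.ExtRing (γ.ExtLocalization a)]
  refine (IsLocalization.lift_eq hu _).trans ?_
  exact hψC r

end ReferenceCircuit

/-! ### Free coextensions: a generic row -/

section Coextension

variable {α : Type} {d : ℕ}

open Classical in
/-- The matrix `A` with the column of `a` replaced by zero, and a new row on top with entry `1` in
the column of `a` and the entries of `r` elsewhere. -/
noncomputable def addRow {T : Type} [CommRing T] (A : Matrix (Fin d) α T) (r : α → T) (a : α) :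
    Matrix (Fin (d + 1)) α T :=
  Matrix.of fun i e => Fin.cases (if e = a then 1 else r e) (fun i => if e = a then 0 else A i e) i

variable {T : Type} [CommRing T] (A : Matrix (Fin d) α T) (r : α → T) (a : α)

@[simp] theorem addRow_zero_self : addRow A r a 0 a = 1 := by simp [addRow]

@[simp] theorem addRow_succ_self (i : Fin d) : addRow A r a i.succ a = 0 := by simp [addRow]

variable {a}

theorem addRow_zero {e : α} (he : e ≠ a) : addRow A r a 0 e = r e := by simp [addRow, he]

theorem addRow_succ {e : α} (he : e ≠ a) (i : Fin d) : addRow A r a i.succ e = A i e := by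
  simp [addRow, he]

theorem addRow_map {S : Type} [CommRing S] (φ : T →+* S) :
    (addRow A r a).map φ = addRow (A.map φ) (φ ∘ r) a := by
  ext i e
  by_cases h : e = a
  · subst h
    induction i using Fin.cases <;> simp
  · induction i using Fin.cases <;> simp [addRow_zero, addRow_succ, h]

/-- Expansion along the column of `a`, which is the first unit vector: minors through `a` see only
`A`. -/
theorem det_addRow_of_mem {t : Fin (d + 1) → α} {j : Fin (d + 1)} (hj : t j = a)
    (hne : ∀ k, k ≠ j → t k ≠ a) :
    ((addRow A r a).submatrix id t).det =
      (-1) ^ (j : ℕ) * (A.submatrix id (t ∘ j.succAbove)).det := by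
  rw [Matrix.det_succ_column _ j, Fin.sum_univ_succ, Finset.sum_eq_zero, add_zero]
  · have : ((addRow A r a).submatrix id t).submatrix (Fin.succAbove 0) j.succAbove =
        A.submatrix id (t ∘ j.succAbove) := by
      ext i k
      have hk := hne _ (Fin.succAbove_ne j k)
      simp [addRow_succ A r hk]
    rw [this]
    simp [hj]
  · intro i _
    simp [hj]

theorem det_addRow_of_notMem {t : Fin (d + 1) → α} (ht : a ∉ range t) :
    ((addRow A r a).submatrix id t).det =
      ∑ j : Fin (d + 1), (-1) ^ (j : ℕ) * r (t j) * (A.submatrix id (t ∘ j.succAbove)).det := by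
  have hne : ∀ j, t j ≠ a := fun j h => ht ⟨j, h⟩
  rw [Matrix.det_succ_row_zero]
  refine Finset.sum_congr rfl fun j _ => ?_
  have : ((addRow A r a).submatrix id t).submatrix Fin.succ j.succAbove =
      A.submatrix id (t ∘ j.succAbove) := by
    ext i k
    simp [addRow_succ A r (hne _)]
  rw [this, Matrix.submatrix_apply, id, addRow_zero A r (hne j)]

theorem range_comp_succAbove {t : Fin (d + 1) → α} {j : Fin (d + 1)}
    (hne : ∀ k, k ≠ j → t k ≠ t j) : range (t ∘ j.succAbove) = range t \ {t j} := by
  rw [range_comp, Fin.range_succAbove]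
  ext x
  constructor
  · rintro ⟨k, hk, rfl⟩
    exact ⟨⟨k, rfl⟩, hne k hk⟩
  · rintro ⟨⟨k, rfl⟩, hk⟩
    exact ⟨k, fun h => hk (h ▸ rfl), rfl⟩

variable {M : Matroid α}

/-- Expand along the column of `a` if it occurs, and along the new row otherwise. Every cofactor
that enters is a minor of `A` on a nonbasis, so the new row `r` is subject to no equation. -/
theorem IsRep.det_addRow_eq_zero {A : Matrix (Fin d) α T} (hA : IsRep M A) (ha : a ∉ M.E)
    (t : Fin (d + 1) → α) (ht : ∀ j, t j ∈ (M.freeCoextension a).E)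
    (hB : ¬ (M.freeCoextension a).IsBase (range t)) :
    ((addRow A r a).submatrix id t).det = 0 := by
  by_cases hinj : Function.Injective t
  · by_cases hat : a ∈ range t
    · obtain ⟨j, hj⟩ := hat
      have hne : ∀ k, k ≠ j → t k ≠ a := fun k hk h => hk (hinj (h.trans hj.symm))
      rw [det_addRow_of_mem A r hj hne, hA.det_eq_zero, mul_zero]
      · exact fun k => (ht _).resolve_left (hne _ (Fin.succAbove_ne j k))
      · intro h
        rw [range_comp_succAbove (fun k hk => hj ▸ hne k hk), hj] at h
        refine hB ?_
        rw [← Matroid.freeCoextension_isBase_insert_iff ha (fun h => h.2 rfl),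
          insert_sdiff_singleton, insert_eq_of_mem (show a ∈ range t from ⟨j, hj⟩)] at h
        exact h
    · rw [det_addRow_of_notMem A r hat]
      have htE : ∀ j, t j ∈ M.E := fun j => (ht j).resolve_left fun h => hat ⟨j, h⟩
      refine Finset.sum_eq_zero fun j _ => ?_
      rw [hA.det_eq_zero, mul_zero]
      · exact fun k => htE _
      · intro h
        rw [range_comp_succAbove (fun k hk h => hk (hinj h))] at h
        refine hB ((Matroid.freeCoextension_isBase_iff_of_notMem ha hat).2 ⟨?_, t j, ⟨j, rfl⟩, h⟩)
        rintro _ ⟨k, rfl⟩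
        exact htE k
  · simp only [Function.Injective, not_forall] at hinj
    obtain ⟨j, k, hjk, hne⟩ := hinj
    exact det_submatrix_eq_zero _ hne hjk

end Coextension

namespace ReferenceCircuit

variable {α : Type} {d : ℕ} {M : Matroid α} (γ : ReferenceCircuit M d) {a : α}

/-- The reference circuit of the free coextension. -/
def freeCoextension (ha : a ∉ M.E) : ReferenceCircuit (M.freeCoextension a) (d + 1) :=
  ofIsBase (Fin.cons a γ.toFun : Fin (d + 1 + 1) → α)
    (Fin.cons_injective_iff.2 ⟨fun ⟨j, hj⟩ => ha (hj ▸ γ.toFun_mem j), γ.injective⟩)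
    (fun i => by
      induction i using Fin.cases with
      | zero => exact Or.inl rfl
      | succ i => exact Or.inr (γ.toFun_mem i))
    fun i => by
      have haγ : a ∉ range γ.toFun := fun ⟨j, hj⟩ => ha (hj ▸ γ.toFun_mem j)
      rw [Fin.range_cons]
      induction i using Fin.cases with
      | zero =>
        rw [Fin.cons_zero, insert_sdiff_of_mem _ (mem_singleton a), sdiff_singleton_eq_self haγ,
          Matroid.freeCoextension_isBase_iff_of_notMem ha haγ]
        exact ⟨by rintro _ ⟨j, rfl⟩; exact γ.toFun_mem j, _, mem_range_self 0, γ.isBase_diff 0⟩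
      | succ i =>
        rw [Fin.cons_succ, insert_sdiff_of_notMem,
          Matroid.freeCoextension_isBase_insert_iff ha fun h => haγ h.1]
        · exact γ.isBase_diff i
        · rintro h
          exact haγ ⟨i, h.symm⟩

theorem freeCoextension_basis_zero (ha : a ∉ M.E) : (γ.freeCoextension ha).basis 0 = a := rfl

theorem freeCoextension_basis_succ (ha : a ∉ M.E) (j : Fin d) :
    (γ.freeCoextension ha).basis j.succ = γ.basis j := rfl

/-- Putting `a` in front leaves the last circuit element, and with it the all-ones column, in place.
-/
theorem freeCoextension_last (ha : a ∉ M.E) :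
    (γ.freeCoextension ha).toFun (Fin.last (d + 1)) = γ.toFun (Fin.last d) := rfl

theorem mem_range_freeCoextension (ha : a ∉ M.E) {e : α} :
    e ∈ range (γ.freeCoextension ha).toFun ↔ e = a ∨ e ∈ range γ.toFun := by
  have : range (γ.freeCoextension ha).toFun = insert a (range γ.toFun) := Fin.range_cons _ _
  rw [this]
  rfl

/-- The reference basis of `M` with `e` adjoined has one superfluous element, so it is a basis of
the coextension. -/
theorem zero_mem_freeCoextension_support (ha : a ∉ M.E) {e : α} (he : e ∈ M.E)
    (hγ : e ∉ range γ.toFun) : 0 ∈ (γ.freeCoextension ha).support e := by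
  have h1 : (γ.freeCoextension ha).basis '' {j | j ≠ 0} = range γ.basis := by
    ext x
    constructor
    · rintro ⟨j, hj, rfl⟩
      obtain ⟨j, rfl⟩ := Fin.exists_succ_eq.2 hj
      exact ⟨j, rfl⟩
    · rintro ⟨j, rfl⟩
      exact ⟨j.succ, Fin.succ_ne_zero j, rfl⟩
  change (M.freeCoextension a).IsBase (insert e ((γ.freeCoextension ha).basis '' {j | j ≠ 0}))
  rw [h1]
  have heb : e ∉ range γ.basis := fun ⟨j, hj⟩ => hγ ⟨j.castSucc, hj⟩
  have hsub : insert e (range γ.basis) ⊆ M.E := by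
    rintro x (rfl | ⟨j, rfl⟩)
    · exact he
    · exact γ.basis_mem j
  rw [Matroid.freeCoextension_isBase_iff_of_notMem ha fun h => ha (hsub h)]
  refine ⟨hsub, e, mem_insert _ _, ?_⟩
  rw [insert_sdiff_of_mem _ (mem_singleton e), sdiff_singleton_eq_self heb]
  exact γ.isBase_range_basis

theorem succ_mem_freeCoextension_support (ha : a ∉ M.E) {e : α} (he : e ∈ M.E) (i : Fin d) :
    i.succ ∈ (γ.freeCoextension ha).support e ↔ i ∈ γ.support e := by
  have h1 : (γ.freeCoextension ha).basis '' {j | j ≠ i.succ} =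
      insert a (γ.basis '' {j | j ≠ i}) := by
    ext x
    constructor
    · rintro ⟨j, hj, rfl⟩
      induction j using Fin.cases with
      | zero => exact Or.inl rfl
      | succ j => exact Or.inr ⟨j, fun h => hj (h ▸ rfl), rfl⟩
    · rintro (rfl | ⟨j, hj, rfl⟩)
      · exact ⟨0, (Fin.succ_ne_zero i).symm, rfl⟩
      · exact ⟨j.succ, fun h => hj (Fin.succ_injective _ h), rfl⟩
  change (M.freeCoextension a).IsBase
    (insert e ((γ.freeCoextension ha).basis '' {j | j ≠ i.succ})) ↔ _
  rw [h1, insert_comm, Matroid.freeCoextension_isBase_insert_iff ha]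
  · rfl
  · rintro (rfl | ⟨j, -, hj⟩)
    · exact ha he
    · exact ha (hj ▸ γ.basis_mem j)

theorem isGreatest_freeCoextension_support (ha : a ∉ M.E) {e : α} (he : e ∈ M.E) {i : Fin d}
    (hi : IsGreatest (γ.support e) i) :
    IsGreatest ((γ.freeCoextension ha).support e) i.succ := by
  refine ⟨(γ.succ_mem_freeCoextension_support ha he i).2 hi.1, fun j hj => ?_⟩
  induction j using Fin.cases with
  | zero => exact Fin.zero_le _
  | succ j =>
    exact Fin.succ_le_succ_iff.2 (hi.2 ((γ.succ_mem_freeCoextension_support ha he j).1 hj))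

/-- Without loops the old support is nonempty, so the new row 0 is never the greatest place and the
normalizing 1 stays where it was. -/
theorem exists_isGreatest_of_freeCoextension (hM : M.NoLoops) (ha : a ∉ M.E) {e : α}
    (he : e ∈ M.E) (hγ : e ∉ range γ.toFun) {i : Fin (d + 1)}
    (hi : IsGreatest ((γ.freeCoextension ha).support e) i) :
    ∃ k, i = k.succ ∧ IsGreatest (γ.support e) k := by
  obtain ⟨k, hk⟩ := exists_isGreatest (γ.support_nonempty hM he hγ)
  exact ⟨k, hi.unique (γ.isGreatest_freeCoextension_support ha he hk), hk⟩

/-- Over the complex numbers, a normalized representation lifts to the free coextension. -/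
theorem exists_addRow_det_ne_zero (hE : M.E.Finite) (A : Matrix (Fin d) α ℂ) (hA : IsRep M A)
    (hn : γ.IsNormal A) (ha : a ∉ M.E) :
    ∃ r : α → ℂ, r (γ.toFun (Fin.last d)) = 1 ∧ (∀ j, r (γ.basis j) = 0) ∧
      ∀ t : Fin (d + 1) → α, (∀ j, t j ∈ (M.freeCoextension a).E) →
        (M.freeCoextension a).IsBase (range t) → ((addRow A r a).submatrix id t).det ≠ 0 := by
  have := hE.to_subtype
  let γ' := γ.freeCoextension ha
  let I : Type := {t : Fin (d + 1) → M.E // (M.freeCoextension a).IsBase (range fun j => (t j : α))}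
  -- For a basis avoiding `a` the minor is a linear functional of the new row, by expansion along
  -- that row.
  let f : I → Module.Dual ℂ (α → ℂ) := fun t => ∑ j : Fin (d + 1),
    ((-1) ^ (j : ℕ) * (A.submatrix id ((fun j => (t.1 j : α)) ∘ j.succAbove)).det) •
      LinearMap.proj (t.1 j : α)
  have hf' : ∀ (t : I) r, f t r = ∑ j : Fin (d + 1), (-1) ^ (j : ℕ) * r (t.1 j) *
      (A.submatrix id ((fun j => (t.1 j : α)) ∘ j.succAbove)).det := fun t r => by
    simp [f, mul_right_comm]
  have hat : ∀ t : I, a ∉ range fun j => (t.1 j : α) := by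
    rintro t ⟨j, hj⟩
    exact ha (hj ▸ (t.1 j).2)
  have hf : ∀ (t : I) r, f t r = ((addRow A r a).submatrix id fun j => (t.1 j : α)).det :=
    fun t r => by rw [hf', det_addRow_of_notMem A r (hat t)]
  -- A row of `A` taken as new row produces a repeated row. Hence subtracting multiples of the rows
  -- of `A` changes no minor, and the new row can be made zero on the reference basis.
  have hrow : ∀ (t : I) i, f t (A i) = 0 := by
    intro t i
    rw [hf]
    refine Matrix.det_zero_of_row_eq (Fin.succ_ne_zero i).symm ?_
    ext j
    have hne : (t.1 j : α) ≠ a := fun h => hat t ⟨j, h⟩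
    simp [addRow_zero _ _ hne, addRow_succ _ _ hne]
  obtain ⟨r, -, hr⟩ := Module.Dual.exists_forall_mem_ne_zero_of_forall_exists ⊤ f (by
    classical
    intro t
    have htinj : Function.Injective fun j => (t.1 j : α) := γ'.injective_of_isBase t.2
    obtain ⟨-, _, ⟨j, rfl⟩, hB⟩ :=
      (Matroid.freeCoextension_isBase_iff_of_notMem ha (hat t)).1 t.2
    refine ⟨Pi.single (t.1 j : α) 1, trivial, ?_⟩
    rw [hf', Finset.sum_eq_single j]
    · rw [Pi.single_eq_same, mul_one]
      refine mul_ne_zero (by simp) (hA.isUnit_det _ (fun k => (t.1 _).2) ?_).ne_zero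
      have h2 := range_comp_succAbove (t := fun j => (t.1 j : α)) (j := j)
        (fun k hk h => hk (htinj h))
      change M.IsBase (range ((fun j => (t.1 j : α)) ∘ j.succAbove))
      rwa [h2]
    · intro k _ hk
      rw [Pi.single_eq_of_ne (fun h => hk (htinj h)), mul_zero, zero_mul]
    · simp)
  let r₁ : α → ℂ := r - ∑ i, r (γ.basis i) • A i
  have hr₁ : ∀ t, f t r₁ = f t r := fun t => by simp [r₁, hrow]
  have hbasis : ∀ j, r₁ (γ.basis j) = 0 := fun j => by
    simp [r₁, hn.apply_basis]
  have haγ : a ∉ range γ.toFun := fun ⟨j, hj⟩ => ha (hj ▸ γ.toFun_mem j)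
  -- The circuit of `M` is a basis of the coextension. Its minor would vanish if the new row were
  -- zero on all of it, so the entry at the last circuit element is nonzero and can be scaled to 1.
  let t₀ : I := ⟨fun j => ⟨γ.toFun j, γ.toFun_mem j⟩,
    (Matroid.freeCoextension_isBase_iff_of_notMem ha haγ).2
      ⟨by rintro _ ⟨j, rfl⟩; exact γ.toFun_mem j, _, mem_range_self 0, γ.isBase_diff 0⟩⟩
  have hc : r₁ (γ.toFun (Fin.last d)) ≠ 0 := by
    intro h
    refine hr t₀ ?_
    rw [← hr₁, hf']
    refine Finset.sum_eq_zero fun j _ => ?_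
    have : r₁ (t₀.1 j) = 0 := by
      induction j using Fin.lastCases with
      | last => exact h
      | cast j => exact hbasis j
    rw [this, mul_zero, zero_mul]
  set c := r₁ (γ.toFun (Fin.last d))
  refine ⟨c⁻¹ • r₁, by simp [c, hc], fun j => by simp [hbasis], fun t ht hB => ?_⟩
  by_cases hta : a ∈ range t
  · obtain ⟨j, hj⟩ := hta
    have htinj := γ'.injective_of_isBase hB
    have hne : ∀ k, k ≠ j → t k ≠ a := fun k hk h => hk (htinj (h.trans hj.symm))
    rw [det_addRow_of_mem A _ hj hne]
    refine mul_ne_zero (by simp) (hA.isUnit_det _ (fun k => ?_) ?_).ne_zero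
    · exact (ht _).resolve_left (hne _ (Fin.succAbove_ne j k))
    · rw [range_comp_succAbove (fun k hk => hj ▸ hne k hk), hj,
        ← Matroid.freeCoextension_isBase_insert_iff ha (fun h => h.2 rfl), insert_sdiff_singleton,
        insert_eq_of_mem (show a ∈ range t from ⟨j, hj⟩)]
      exact hB
  · let t' : I := ⟨fun j => ⟨t j, (ht j).resolve_left fun h => hta ⟨j, h⟩⟩, hB⟩
    have h1 := hf t' (c⁻¹ • r₁)
    rw [map_smul, hr₁] at h1
    exact ne_of_eq_of_ne h1.symm (smul_ne_zero (inv_ne_zero hc) (hr t'))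

/-- The polynomial ring that carries the entries of the new row. -/
abbrev CoextRing (γ : ReferenceCircuit M d) : Type :=
  MvPolynomial {e : α // e ∈ M.E ∧ e ∉ range γ.toFun} (γ.RealizationRing ℂ)

open Classical in
/-- The generic normalized new row. -/
noncomputable def coextRow (e : α) : γ.CoextRing :=
  if e = γ.toFun (Fin.last d) then 1
  else if h : e ∈ M.E ∧ e ∉ range γ.toFun then MvPolynomial.X ⟨e, h⟩ else 0

theorem coextRow_last : γ.coextRow (γ.toFun (Fin.last d)) = 1 := by simp [coextRow]

theorem coextRow_basis (j : Fin d) : γ.coextRow (γ.basis j) = 0 := by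
  have : γ.basis j ∈ range γ.toFun := mem_range_self _
  simp [coextRow, γ.basis_ne_last, this]

theorem coextRow_of_notMem {e : α} (he : e ∈ M.E) (hγ : e ∉ range γ.toFun) :
    γ.coextRow e = MvPolynomial.X ⟨e, he, hγ⟩ := by
  have : e ≠ γ.toFun (Fin.last d) := fun h => hγ (h ▸ mem_range_self _)
  rw [coextRow, if_neg this, dif_pos ⟨he, hγ⟩]

/-- The universal matrix with a new generic row. -/
noncomputable def coextMatrix (a : α) : Matrix (Fin (d + 1)) α γ.CoextRing :=
  addRow (γ.universalMatrix.map MvPolynomial.C) γ.coextRow a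

theorem isNormal_coextMatrix (hM : M.NoLoops) (ha : a ∉ M.E) :
    (γ.freeCoextension ha).IsNormal (γ.coextMatrix a) := by
  have hn := γ.isNormal_universalMatrix.map (MvPolynomial.C : γ.RealizationRing ℂ →+* γ.CoextRing)
  have hne : ∀ e ∈ M.E, e ≠ a := fun e he h => ha (h ▸ he)
  constructor
  · intro i
    rw [freeCoextension_last]
    induction i using Fin.cases with
    | zero => exact (addRow_zero _ _ (hne _ (γ.toFun_mem _))).trans γ.coextRow_last
    | succ i => exact (addRow_succ _ _ (hne _ (γ.toFun_mem _)) i).trans (hn.apply_last i)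
  · intro i j
    induction j using Fin.cases with
    | zero =>
      rw [freeCoextension_basis_zero]
      induction i using Fin.cases <;> simp [coextMatrix]
    | succ j =>
      rw [freeCoextension_basis_succ]
      induction i using Fin.cases with
      | zero =>
        rw [if_neg (Fin.succ_ne_zero j).symm]
        exact (addRow_zero _ _ (hne _ (γ.basis_mem _))).trans (γ.coextRow_basis j)
      | succ i =>
        simp only [Fin.succ_inj]
        exact (addRow_succ _ _ (hne _ (γ.basis_mem _)) i).trans (hn.apply_basis i j)
  · rintro e he hγ i hi
    rw [mem_range_freeCoextension, not_or] at hγ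
    have he' : e ∈ M.E := he.resolve_left hγ.1
    induction i using Fin.cases with
    | zero => exact absurd (γ.zero_mem_freeCoextension_support ha he' hγ.2) hi
    | succ i =>
      rw [γ.succ_mem_freeCoextension_support ha he'] at hi
      exact (addRow_succ _ _ hγ.1 i).trans (hn.apply_of_notMem e he' hγ.2 i hi)
  · rintro e he hγ i hi
    rw [mem_range_freeCoextension, not_or] at hγ
    have he' : e ∈ M.E := he.resolve_left hγ.1
    obtain ⟨k, rfl, hk⟩ := γ.exists_isGreatest_of_freeCoextension hM ha he' hγ.2 hi
    exact (addRow_succ _ _ hγ.1 k).trans (hn.apply_of_isGreatest e he' hγ.2 k hk)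

variable {γ} in
theorem IsNormal.of_freeCoextension (ha : a ∉ M.E) {T : Type}
    [CommRing T] {A : Matrix (Fin (d + 1)) α T} (h : (γ.freeCoextension ha).IsNormal A) :
    γ.IsNormal (A.submatrix Fin.succ id) where
  apply_last i := h.apply_last i.succ
  apply_basis i j := by
    have := h.apply_basis i.succ j.succ
    simp only [Fin.succ_inj] at this
    exact this
  apply_of_notMem e he hγ i hi := by
    refine h.apply_of_notMem e (Or.inr he) ?_ i.succ ?_
    · rw [mem_range_freeCoextension, not_or]
      exact ⟨fun h => ha (h ▸ he), hγ⟩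
    · rwa [γ.succ_mem_freeCoextension_support ha he]
  apply_of_isGreatest e he hγ i hi := by
    refine h.apply_of_isGreatest e (Or.inr he) ?_ i.succ ?_
    · rw [mem_range_freeCoextension, not_or]
      exact ⟨fun h => ha (h ▸ he), hγ⟩
    · exact γ.isGreatest_freeCoextension_support ha he hi

variable {γ} in
-- By normality the column of `a` is the first unit vector, so the minors of the lower rows are the
-- minors through `a`, and the bases through `a` correspond to the bases of `M`.
theorem IsNormal.isRep_of_freeCoextension (ha : a ∉ M.E) {T : Type} [CommRing T]
    {A : Matrix (Fin (d + 1)) α T} (hn : (γ.freeCoextension ha).IsNormal A)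
    (h : IsRep (M.freeCoextension a) A) : IsRep M (A.submatrix Fin.succ id) := by
  have hA : A = addRow (A.submatrix Fin.succ id) (A 0) a := by
    ext i e
    by_cases he : e = a
    · subst he
      have h1 := hn.apply_basis i 0
      rw [freeCoextension_basis_zero] at h1
      rw [h1]
      induction i using Fin.cases <;> simp
    · induction i using Fin.cases with
      | zero => rw [addRow_zero _ _ he]
      | succ i =>
        rw [addRow_succ _ _ he]
        rfl
  have hat : ∀ t : Fin d → α, (∀ j, t j ∈ M.E) → a ∉ range t := by
    rintro t ht ⟨j, hj⟩
    exact ha (hj ▸ ht j)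
  have hdet : ∀ t : Fin d → α, (∀ j, t j ∈ M.E) →
      (A.submatrix id (Fin.cons a t : Fin (d + 1) → α)).det =
        ((A.submatrix Fin.succ id).submatrix id t).det := by
    intro t ht
    have h1 := det_addRow_of_mem (A.submatrix Fin.succ id) (A 0)
      (t := (Fin.cons a t : Fin (d + 1) → α)) (j := 0) (a := a) rfl (by
        intro k hk
        obtain ⟨k, rfl⟩ := Fin.exists_succ_eq.2 hk
        exact fun h => hat t ht ⟨k, h⟩)
    rw [← hA] at h1
    rw [h1, Fin.val_zero, pow_zero, one_mul]
    rfl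
  have hmem : ∀ t : Fin d → α, (∀ j, t j ∈ M.E) →
      ∀ j, (Fin.cons a t : Fin (d + 1) → α) j ∈ (M.freeCoextension a).E := by
    intro t ht j
    induction j using Fin.cases with
    | zero => exact Or.inl rfl
    | succ j => exact Or.inr (ht j)
  have hiff : ∀ t : Fin d → α, (∀ j, t j ∈ M.E) →
      ((M.freeCoextension a).IsBase (range (Fin.cons a t : Fin (d + 1) → α)) ↔
        M.IsBase (range t)) := by
    intro t ht
    rw [Fin.range_cons, Matroid.freeCoextension_isBase_insert_iff ha (hat t ht)]
  constructor
  · intro t ht hB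
    rw [← hdet t ht]
    exact h.isUnit_det _ (hmem t ht) ((hiff t ht).2 hB)
  · intro t ht hB
    rw [← hdet t ht]
    exact h.det_eq_zero _ (hmem t ht) fun h => hB ((hiff t ht).1 h)

/-- The localization of the polynomial ring of the new row at the base minors. -/
abbrev CoextLocalization (a : α) : Type :=
  Localization (Submonoid.closure (IsModuli.baseMinors (M.freeCoextension a) (γ.coextMatrix a)))

/-- The homomorphism from the polynomial ring of the new row given by a new row. -/
noncomputable def coextHom {T : Type} [CommRing T] [Algebra ℂ T] (φ : γ.RealizationRing ℂ →ₐ[ℂ] T)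
    (r : α → T) : γ.CoextRing →ₐ[ℂ] T :=
  { MvPolynomial.eval₂Hom (φ : γ.RealizationRing ℂ →+* T)
      (fun e : {e : α // e ∈ M.E ∧ e ∉ range γ.toFun} => r e.1) with
    commutes' := fun c => by
      change MvPolynomial.eval₂Hom _ _ (algebraMap ℂ _ c) = _
      rw [IsScalarTower.algebraMap_apply ℂ (γ.RealizationRing ℂ) γ.CoextRing]
      simp [MvPolynomial.algebraMap_eq] }

theorem coextHom_C {T : Type} [CommRing T] [Algebra ℂ T] (φ : γ.RealizationRing ℂ →ₐ[ℂ] T)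
    (r : α → T) (s : γ.RealizationRing ℂ) : γ.coextHom φ r (MvPolynomial.C s) = φ s :=
  MvPolynomial.eval₂Hom_C _ _ s

theorem coextHom_coextRow {T : Type} [CommRing T] [Algebra ℂ T]
    (φ : γ.RealizationRing ℂ →ₐ[ℂ] T) (r : α → T) (hl : r (γ.toFun (Fin.last d)) = 1)
    (hb : ∀ j, r (γ.basis j) = 0) {e : α} (he : e ∈ M.E) :
    γ.coextHom φ r (γ.coextRow e) = r e := by
  by_cases hγ : e ∈ range γ.toFun
  · rw [range_eq] at hγ
    rcases hγ with rfl | ⟨j, rfl⟩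
    · rw [coextRow_last, map_one, hl]
    · rw [coextRow_basis, map_zero, hb]
  · rw [coextRow_of_notMem γ he hγ]
    exact MvPolynomial.eval₂Hom_X' _ _ _

/-- Normalization fixes the new row on the reference circuit; the other entries are free, one for
each element off the circuit, subject only to open conditions. -/
theorem isModuli_freeCoextension (hM : M.NoLoops) (ha : a ∉ M.E) :
    IsModuli (M.freeCoextension a)
      ((γ.coextMatrix a).map (algebraMap γ.CoextRing (γ.CoextLocalization a))) := by
  have hne : ∀ e ∈ M.E, e ≠ a := fun e he h => ha (h ▸ he)
  refine IsModuli.of_isNormal (γ.freeCoextension ha) (γ.coextMatrix a) ?_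
    (γ.isNormal_coextMatrix hM ha) ?_ ?_
  · exact fun t ht hB => (γ.isModuli.isRep.map _).det_addRow_eq_zero _ ha t ht hB
  · intro T _ _ A hA hn
    obtain ⟨φ, hφ⟩ := γ.exists_algHom _ (hn.isRep_of_freeCoextension ha hA)
      (hn.of_freeCoextension ha)
    refine ⟨γ.coextHom φ (A 0), fun e he i => ?_⟩
    rcases he with rfl | he
    · have h1 := hn.apply_basis i 0
      rw [freeCoextension_basis_zero] at h1
      rw [h1]
      induction i using Fin.cases <;> simp [coextMatrix]
    · induction i using Fin.cases with
      | zero =>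
        rw [coextMatrix, addRow_zero _ _ (hne e he),
          γ.coextHom_coextRow φ (A 0) (hn.apply_last 0) (fun j => ?_) he]
        exact (hn.apply_basis 0 j.succ).trans (if_neg (Fin.succ_ne_zero j).symm)
      | succ i =>
        rw [coextMatrix, addRow_succ _ _ (hne e he), Matrix.map_apply, coextHom_C, hφ e he]
        rfl
  · intro T _ _ φ ψ h
    have h1 : φ.comp (IsScalarTower.toAlgHom ℂ (γ.RealizationRing ℂ) γ.CoextRing) =
        ψ.comp (IsScalarTower.toAlgHom ℂ (γ.RealizationRing ℂ) γ.CoextRing) := by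
      refine γ.algHom_ext _ _ fun e he i => ?_
      have := h e (Or.inr he) i.succ
      rw [coextMatrix, addRow_succ _ _ (hne e he)] at this
      exact this
    apply AlgHom.coe_ringHom_injective
    apply MvPolynomial.ringHom_ext
    · intro r
      exact DFunLike.congr_fun h1 r
    · rintro ⟨e, he, hγ⟩
      have := h e (Or.inr he) 0
      rw [coextMatrix, addRow_zero _ _ (hne e he), coextRow_of_notMem γ he hγ] at this
      exact this

theorem hasNodalSingularities_freeCoextension (hM : M.NoLoops) (ha : a ∉ M.E) (hE : M.E.Finite)
    (h : HasNodalSingularities (γ.RealizationRing ℂ)) :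
    HasNodalSingularities ((γ.freeCoextension ha).RealizationRing ℂ) := by
  have hE' : (M.freeCoextension a).E.Finite := hE.insert a
  have := γ.finiteType hE
  have := (γ.freeCoextension ha).finiteType hE'
  have hσ : Finite {e : α // e ∈ M.E ∧ e ∉ range γ.toFun} :=
    (hE.subset fun e he => he.1 : {e : α | e ∈ M.E ∧ e ∉ range γ.toFun}.Finite).to_subtype
  obtain ⟨e⟩ := (γ.isModuli_freeCoextension hM ha).nonempty_algEquiv
    (γ.freeCoextension ha).isModuli
  have : Algebra.FiniteType ℂ (γ.CoextLocalization a) := Algebra.FiniteType.equiv ‹_› e.symm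
  refine HasNodalSingularities.of_algEquiv e ?_
  refine HasNodalSingularities.ascend
    (IsModuli.baseMinors (M.freeCoextension a) (γ.coextMatrix a)) (finite_baseMinors hE' _) ?_ h
  intro π
  obtain ⟨r, hl, hb, hdet⟩ := γ.exists_addRow_det_ne_zero hE (γ.universalMatrix.map π)
    (γ.isModuli.isRep.map (π : γ.RealizationRing ℂ →+* ℂ))
    (γ.isNormal_universalMatrix.map (π : γ.RealizationRing ℂ →+* ℂ)) ha
  let ψ := γ.coextHom π r
  have hψ : ∀ t : Fin (d + 1) → α, (∀ j, t j ∈ (M.freeCoextension a).E) →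
      ψ ((γ.coextMatrix a).submatrix id t).det =
        ((addRow (γ.universalMatrix.map π) r a).submatrix id t).det := by
    intro t ht
    have h1 := det_submatrix_map (γ.coextMatrix a) (ψ : γ.CoextRing →+* ℂ) t
    refine h1.symm.trans ?_
    congr 1
    ext i j
    rw [Matrix.submatrix_apply, Matrix.submatrix_apply, coextMatrix, addRow_map]
    by_cases hj : t j = a
    · rw [hj]
      induction i using Fin.cases <;> simp
    · induction i using Fin.cases with
      | zero =>
        rw [id, addRow_zero _ _ hj, addRow_zero _ _ hj]
        exact γ.coextHom_coextRow π r hl hb ((ht j).resolve_left hj)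
      | succ i =>
        rw [id, addRow_succ _ _ hj, addRow_succ _ _ hj]
        exact γ.coextHom_C π r _
  have hu : ∀ y : Submonoid.closure (IsModuli.baseMinors (M.freeCoextension a) (γ.coextMatrix a)),
      IsUnit (ψ y) := by
    rintro ⟨y, hy⟩
    have hle : Submonoid.closure (IsModuli.baseMinors (M.freeCoextension a) (γ.coextMatrix a)) ≤
        (IsUnit.submonoid ℂ).comap (ψ : γ.CoextRing →* ℂ) := by
      rw [Submonoid.closure_le]
      rintro _ ⟨t, ht, hB, rfl⟩
      change IsUnit (ψ ((γ.coextMatrix a).submatrix id t).det)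
      rw [hψ t ht, isUnit_iff_ne_zero]
      exact hdet t ht hB
    exact hle hy
  refine ⟨IsLocalization.liftAlgHom hu, ?_⟩
  refine AlgHom.ext fun s => ?_
  rw [AlgHom.comp_apply, IsScalarTower.coe_toAlgHom',
    IsScalarTower.algebraMap_apply (γ.RealizationRing ℂ) γ.CoextRing (γ.CoextLocalization a)]
  refine (IsLocalization.lift_eq hu _).trans ?_
  exact γ.coextHom_C π r s

end ReferenceCircuit

/-! ### The matroid `Qsing` and its two-parameter family of matrices -/

/-- The decidable form of being a basis of `Qsing`, for a triple of elements. -/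
def IsSingTriple (i j k : ℕ) : Prop :=
  ({i, j, k} : Finset ℕ) ⊆ Finset.Icc 1 12 ∧ ({i, j, k} : Finset ℕ).card = 3 ∧
    ∀ l ∈ singLines, ¬ ({i, j, k} : Finset ℕ) ⊆ l

instance (i j k : ℕ) : Decidable (IsSingTriple i j k) := by
  unfold IsSingTriple
  infer_instance

theorem IsSingTriple.swap_left {i j k : ℕ} (h : IsSingTriple i j k) : IsSingTriple j i k := by
  unfold IsSingTriple at *
  rwa [Finset.insert_comm j i]

theorem IsSingTriple.swap_right {i j k : ℕ} (h : IsSingTriple i j k) : IsSingTriple i k j := by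
  unfold IsSingTriple at *
  rwa [Finset.pair_comm k j]

theorem not_isSingTriple_self (i k : ℕ) : ¬ IsSingTriple i i k := by
  rintro ⟨-, h, -⟩
  rw [Finset.insert_idem] at h
  have := Finset.card_le_two (a := i) (b := k)
  omega

theorem Qsing_ground : Qsing.E = Set.Icc 1 12 := rfl

theorem Qsing_isBase_coe_iff (s : Finset ℕ) : Qsing.IsBase (s : Set ℕ) ↔
    s ⊆ Finset.Icc 1 12 ∧ s.card = 3 ∧ ∀ l ∈ singLines, ¬ s ⊆ l := by
  rw [← Set.ncard_coe_finset]
  simp only [← Finset.coe_subset, Finset.coe_Icc]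
  exact Iff.rfl

theorem Qsing_isBase_range_iff (t : Fin 3 → ℕ) :
    Qsing.IsBase (range t) ↔ IsSingTriple (t 0) (t 1) (t 2) := by
  have : range t = (({t 0, t 1, t 2} : Finset ℕ) : Set ℕ) := by
    ext x
    simp [Fin.exists_fin_succ, eq_comm]
  rw [this, Qsing_isBase_coe_iff]
  rfl

/-- A symmetric statement that holds on repetitions needs to be checked only on increasing triples,
which keeps the finite verifications small. -/
theorem triple_induction {P : ℕ → ℕ → ℕ → Prop} (swap_left : ∀ i j k, P i j k → P j i k)
    (swap_right : ∀ i j k, P i j k → P i k j) (self : ∀ i k, P i i k)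
    (lt : ∀ i j k, i < j → j < k → P i j k) (i j k : ℕ) : P i j k := by
  have key : ∀ i j k, i ≤ j → P i j k := by
    intro i j k hij
    rcases hij.eq_or_lt with rfl | hij
    · exact self _ _
    rcases lt_trichotomy j k with h | rfl | h
    · exact lt _ _ _ hij h
    · exact swap_left _ _ _ (swap_right _ _ _ (self _ _))
    rcases lt_trichotomy i k with h' | rfl | h'
    · exact swap_right _ _ _ (lt _ _ _ h' h)
    · exact swap_right _ _ _ (self _ _)
    · exact swap_right _ _ _ (swap_left _ _ _ (lt _ _ _ h' hij))
  rcases le_total i j with h | h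
  · exact key _ _ _ h
  · exact swap_left _ _ _ (key _ _ _ h)

/-- The columns of a matrix representing `Qsing` which depend on two parameters. -/
def singColumn {T : Type*} [CommRing T] (a v : T) : ℕ → Fin 3 → T
  | 1 => ![1, 0, 0]
  | 2 => ![0, 1, 0]
  | 3 => ![1, 0, -a]
  | 4 => ![0, 1, 1]
  | 5 => ![0, 0, 1]
  | 6 => ![1, a, 0]
  | 7 => ![1, 0, -1]
  | 8 => ![1, 1, 0]
  | 9 => ![0, 1, a]
  | 10 => ![1 + a, a * (1 + a), a ^ 2 - a - v]
  | 11 => ![1 + a, v + a - 1, -(1 + a)]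
  | 12 => ![a * v - a + 1, 1 + a, a * (1 + a)]
  | _ => 0

/-- The matrix with columns `singColumn a v`. -/
def singMatrix {T : Type*} [CommRing T] (a v : T) : Matrix (Fin 3) ℕ T :=
  Matrix.of fun i e => singColumn a v e i

theorem map_singColumn {T S : Type*} [CommRing T] [CommRing S] (φ : T →+* S) (a v : T) (e : ℕ)
    (i : Fin 3) : φ (singColumn a v e i) = singColumn (φ a) (φ v) e i := by
  unfold singColumn
  split <;> fin_cases i <;> simp

theorem map_singMatrix {T S : Type*} [CommRing T] [CommRing S] (φ : T →+* S) (a v : T) :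
    (singMatrix a v).map φ = singMatrix (φ a) (φ v) := by
  ext i e
  exact map_singColumn φ a v e i

/-- The determinant of a matrix with three given columns. -/
def det₃ {T : Type*} [CommRing T] (x y z : Fin 3 → T) : T :=
  x 0 * y 1 * z 2 - x 0 * z 1 * y 2 - y 0 * x 1 * z 2 + y 0 * z 1 * x 2 + z 0 * x 1 * y 2 -
    z 0 * y 1 * x 2

theorem det₃_swap_left {T : Type*} [CommRing T] (x y z : Fin 3 → T) :
    det₃ y x z = -det₃ x y z := by
  unfold det₃
  ring

theorem det₃_swap_right {T : Type*} [CommRing T] (x y z : Fin 3 → T) :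
    det₃ x z y = -det₃ x y z := by
  unfold det₃
  ring

theorem det₃_self {T : Type*} [CommRing T] (x y : Fin 3 → T) : det₃ x x y = 0 := by
  unfold det₃
  ring

theorem det_submatrix_eq_det₃ {T : Type*} [CommRing T] (A : Matrix (Fin 3) ℕ T) (t : Fin 3 → ℕ) :
    (A.submatrix id t).det =
      det₃ (fun i => A i (t 0)) (fun i => A i (t 1)) (fun i => A i (t 2)) := by
  rw [Matrix.det_fin_three, det₃]
  simp only [Matrix.submatrix_apply, id]

/-- The triples in increasing order that are contained in a line. -/
theorem mem_of_not_isSingTriple : ∀ k ∈ Finset.Icc 1 12, ∀ j ∈ Finset.Ico 1 k,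
    ∀ i ∈ Finset.Ico 1 j, ¬ IsSingTriple i j k → (i, j, k) ∈ ([(1, 2, 6), (1, 2, 8), (1, 6, 8),
      (2, 6, 8), (1, 3, 5), (1, 3, 7), (1, 5, 7), (3, 5, 7), (1, 9, 12), (2, 4, 5), (2, 4, 9),
      (2, 5, 9), (4, 5, 9), (2, 7, 11), (3, 4, 6), (3, 8, 9), (3, 10, 12), (4, 7, 8), (4, 10, 11),
      (5, 6, 10), (8, 11, 12)] : List (ℕ × ℕ × ℕ)) := by
  decide +kernel

theorem det₃_singColumn_eq_zero {T : Type*} [CommRing T] (a v : T) (h : (a ^ 2 - a + 1) * v = 0)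
    (i j k : ℕ) : i ∈ Icc 1 12 → j ∈ Icc 1 12 → k ∈ Icc 1 12 → ¬ IsSingTriple i j k →
    det₃ (singColumn a v i) (singColumn a v j) (singColumn a v k) = 0 := by
  induction i, j, k using triple_induction with
  | swap_left i j k ih =>
    intro hi hj hk hB
    rw [det₃_swap_left, ih hj hi hk fun h => hB h.swap_left, neg_zero]
  | swap_right i j k ih =>
    intro hi hj hk hB
    rw [det₃_swap_right, ih hi hk hj fun h => hB h.swap_right, neg_zero]
  | self i k => exact fun _ _ _ _ => det₃_self _ _
  | lt i j k hij hjk =>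
    intro hi hj hk hB
    have := mem_of_not_isSingTriple k (by simpa using hk) j (by simp at *; omega) i
      (by simp at *; omega) hB
    simp only [List.mem_cons, Prod.mk.injEq, List.not_mem_nil, or_false] at this
    rcases this with ⟨rfl, rfl, rfl⟩ | ⟨rfl, rfl, rfl⟩ | ⟨rfl, rfl, rfl⟩ | ⟨rfl, rfl, rfl⟩ |
      ⟨rfl, rfl, rfl⟩ | ⟨rfl, rfl, rfl⟩ | ⟨rfl, rfl, rfl⟩ | ⟨rfl, rfl, rfl⟩ | ⟨rfl, rfl, rfl⟩ |
      ⟨rfl, rfl, rfl⟩ | ⟨rfl, rfl, rfl⟩ | ⟨rfl, rfl, rfl⟩ | ⟨rfl, rfl, rfl⟩ | ⟨rfl, rfl, rfl⟩ |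
      ⟨rfl, rfl, rfl⟩ | ⟨rfl, rfl, rfl⟩ | ⟨rfl, rfl, rfl⟩ | ⟨rfl, rfl, rfl⟩ | ⟨rfl, rfl, rfl⟩ |
      ⟨rfl, rfl, rfl⟩ | ⟨rfl, rfl, rfl⟩ <;>
    simp [det₃, singColumn] <;> try ring_nf
    -- Only the triple 3, 10, 12 needs the equation of the curve; the other twenty minors vanish
    -- identically.
    linear_combination (1 + a) ^ 2 * h

/-- `QuadraticAlgebra ℤ (-1) 1` is the ring of Eisenstein integers, in which `⟨0, 1⟩` is a root of
x² - x + 1. Exact integer arithmetic makes the minors at the crossing decidable. -/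
theorem det₃_singColumn_ne_zero_aux : ∀ k ∈ Finset.Icc 1 12, ∀ j ∈ Finset.Ico 1 k,
    ∀ i ∈ Finset.Ico 1 j, IsSingTriple i j k →
      det₃ (singColumn (⟨0, 1⟩ : QuadraticAlgebra ℤ (-1) 1) 0 i) (singColumn ⟨0, 1⟩ 0 j)
        (singColumn ⟨0, 1⟩ 0 k) ≠ 0 := by
  decide +kernel

theorem det₃_map {T S : Type*} [CommRing T] [CommRing S] (φ : T →+* S) (x y z : Fin 3 → T) :
    det₃ (fun i => φ (x i)) (fun i => φ (y i)) (fun i => φ (z i)) = φ (det₃ x y z) := by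
  simp [det₃]

theorem det₃_singColumn_map {T S : Type*} [CommRing T] [CommRing S] (φ : T →+* S) (a v : T)
    (i j k : ℕ) : det₃ (singColumn (φ a) (φ v) i) (singColumn (φ a) (φ v) j)
      (singColumn (φ a) (φ v) k) =
        φ (det₃ (singColumn a v i) (singColumn a v j) (singColumn a v k)) := by
  have h : ∀ e, singColumn (φ a) (φ v) e = fun i => φ (singColumn a v e i) := fun e =>
    funext fun i => (map_singColumn φ a v e i).symm
  rw [h, h, h, det₃_map]

/-- Sending the generator to `z` embeds the Eisenstein integers in ℂ because the norm form is
positive definite, so the integer check holds at every root `z`. -/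
theorem det₃_singColumn_ne_zero {z : ℂ} (hz : z ^ 2 - z + 1 = 0) (i j k : ℕ) :
    IsSingTriple i j k →
      det₃ (singColumn z 0 i) (singColumn z 0 j) (singColumn z 0 k) ≠ 0 := by
  induction i, j, k using triple_induction with
  | swap_left i j k ih =>
    intro hB
    rw [det₃_swap_left, neg_ne_zero]
    exact ih hB.swap_left
  | swap_right i j k ih =>
    intro hB
    rw [det₃_swap_right, neg_ne_zero]
    exact ih hB.swap_right
  | self i k => exact fun h => absurd h (not_isSingTriple_self _ _)
  | lt i j k hij hjk =>
    intro hB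
    let ρ : QuadraticAlgebra ℤ (-1) 1 →ₐ[ℤ] ℂ :=
      QuadraticAlgebra.lift ⟨z, by simp; linear_combination hz⟩
    have hρz : ρ ⟨0, 1⟩ = z := by simp [ρ, QuadraticAlgebra.lift]
    have hρ : ∀ x, ρ x = 0 → x = 0 := by
      intro x hx
      have h1 : QuadraticAlgebra.norm x = 0 := by
        have h2 : ρ (algebraMap ℤ _ x.norm) = 0 := by
          rw [QuadraticAlgebra.algebraMap_norm_eq_mul_star, map_mul, hx, zero_mul]
        rw [AlgHom.commutes] at h2
        simpa using h2
      rw [QuadraticAlgebra.norm_def] at h1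
      have h3 : (2 * x.re + x.im) ^ 2 + 3 * x.im ^ 2 = 0 := by linear_combination 4 * h1
      have h4 : x.im = 0 := by nlinarith [sq_nonneg (2 * x.re + x.im), sq_nonneg x.im]
      have h5 : x.re = 0 := by
        rw [h4] at h3
        nlinarith
      ext
      · exact h5
      · exact h4
    have hmem : ∀ e ∈ ({i, j, k} : Finset ℕ), e ∈ Finset.Icc 1 12 := fun e he => hB.1 he
    have hi := Finset.mem_Icc.1 (hmem i (by simp))
    have hk := hmem k (by simp)
    have hj := Finset.mem_Icc.1 (hmem j (by simp))
    have := det₃_singColumn_ne_zero_aux k hk j (Finset.mem_Ico.2 ⟨hj.1, hjk⟩) i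
      (Finset.mem_Ico.2 ⟨hi.1, hij⟩) hB
    intro h0
    refine this (hρ _ ?_)
    have h6 := det₃_singColumn_map (ρ : QuadraticAlgebra ℤ (-1) 1 →+* ℂ) ⟨0, 1⟩ 0 i j k
    rw [map_zero] at h6
    change det₃ (singColumn (ρ ⟨0, 1⟩) 0 i) (singColumn (ρ ⟨0, 1⟩) 0 j)
      (singColumn (ρ ⟨0, 1⟩) 0 k) = ρ _ at h6
    rw [hρz] at h6
    rw [← h6, h0]

/-- The reference circuit `1, 2, 5, 11` of `Qsing`. -/
def singCircuit : ReferenceCircuit Qsing 3 :=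
  ReferenceCircuit.ofIsBase ![1, 2, 5, 11] (by decide)
    (by
      intro i
      fin_cases i <;> simp [Qsing_ground])
    (by
      have h : range ![1, 2, 5, 11] = (({1, 2, 5, 11} : Finset ℕ) : Set ℕ) := by
        ext x
        simp
        tauto
      intro i
      rw [h, ← Finset.coe_erase, Qsing_isBase_coe_iff]
      revert i
      decide +kernel)

theorem Qsing_noLoops : Qsing.NoLoops := by
  have h : ∀ e ∈ Finset.Icc 1 12, ∃ i ∈ Finset.Icc 1 12, ∃ j ∈ Finset.Icc 1 12,
      IsSingTriple e i j := by decide +kernel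
  intro e he
  obtain ⟨i, -, j, -, hB⟩ := h e (by simpa [Qsing_ground] using he)
  exact ⟨range ![e, i, j], (Qsing_isBase_range_iff _).2 hB, 0, rfl⟩

theorem IsRep.det₃_eq_zero {T : Type} [CommRing T] {A : Matrix (Fin 3) ℕ T} (hA : IsRep Qsing A)
    (i j k : ℕ) (h : ({i, j, k} : Finset ℕ) ⊆ Finset.Icc 1 12 ∧ ¬ IsSingTriple i j k) :
    det₃ (fun m => A m i) (fun m => A m j) (fun m => A m k) = 0 := by
  have := hA.det_eq_zero ![i, j, k] (fun m => ?_) fun hB => h.2 ((Qsing_isBase_range_iff _).1 hB)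
  · rwa [det_submatrix_eq_det₃] at this
  · rw [Qsing_ground, ← Finset.coe_Icc]
    exact h.1 (by fin_cases m <;> simp)

theorem IsRep.isUnit_det₃ {T : Type} [CommRing T] {A : Matrix (Fin 3) ℕ T} (hA : IsRep Qsing A)
    (i j k : ℕ) (h : IsSingTriple i j k) :
    IsUnit (det₃ (fun m => A m i) (fun m => A m j) (fun m => A m k)) := by
  have := hA.isUnit_det ![i, j, k] (fun m => ?_) ((Qsing_isBase_range_iff _).2 h)
  · rwa [det_submatrix_eq_det₃] at this
  · rw [Qsing_ground, ← Finset.coe_Icc]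
    exact h.1 (by fin_cases m <;> simp)

theorem ProjEquiv.of_diagonal {α T : Type} {d : ℕ} [CommRing T] {E : Set α}
    {A A' : Matrix (Fin d) α T} (g : Fin d → T) (hg : ∀ i, IsUnit (g i))
    (h : ∀ e ∈ E, ∃ c, IsUnit c ∧ ∀ i, A' i e = g i * A i e * c) : ProjEquiv E A A' := by
  classical
  choose c hc h using h
  refine ⟨Matrix.diagonal g, fun e => if he : e ∈ E then (hc e he).unit else 1, ?_,
    fun e he i => ?_⟩
  · rw [Matrix.det_diagonal]
    exact Finset.prod_induction _ IsUnit (fun _ _ => IsUnit.mul) isUnit_one fun i _ => hg i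
  · simp [he, h e he i, Matrix.diagonal_mul]

/-- Normalize along the circuit 1, 2, 5, 11 and solve the lines successively: all columns become
expressions in the entries p of column 6 and q of column 8. A change of parameters and a diagonal
row scaling then lead to `singMatrix`. -/
theorem exists_projEquiv_singMatrix {T : Type} [CommRing T] {A : Matrix (Fin 3) ℕ T}
    (hA : IsRep Qsing A) : ∃ a v : T, (a ^ 2 - a + 1) * v = 0 ∧
      ProjEquiv Qsing.E (singMatrix a v) A := by
  obtain ⟨A', hAA', hn⟩ := singCircuit.exists_isNormal A hA
  have hA' := hA.of_projEquiv hAA'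
  have c1 : ∀ i, A' i 1 = if i = 0 then 1 else 0 := fun i => hn.apply_basis i 0
  have c2 : ∀ i, A' i 2 = if i = 1 then 1 else 0 := fun i => hn.apply_basis i 1
  have c5 : ∀ i, A' i 5 = if i = 2 then 1 else 0 := fun i => hn.apply_basis i 2
  have c11 : ∀ i, A' i 11 = 1 := hn.apply_last
  have z := hA'.det₃_eq_zero
  have u := hA'.isUnit_det₃
  have hb : singCircuit.basis = ![1, 2, 5] := by
    funext i
    fin_cases i <;> rfl
  have hs : ∀ e i, i ∈ singCircuit.support e ↔ IsSingTriple (Function.update ![1, 2, 5] i e 0)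
      (Function.update ![1, 2, 5] i e 1) (Function.update ![1, 2, 5] i e 2) := fun e i => by
    rw [ReferenceCircuit.mem_support_iff, hb, Qsing_isBase_range_iff]
  have one : ∀ (e : ℕ) (i : Fin 3), e ∈ Finset.Icc 1 12 \ {1, 2, 5, 11} →
      (IsSingTriple (Function.update ![1, 2, 5] i e 0) (Function.update ![1, 2, 5] i e 1)
        (Function.update ![1, 2, 5] i e 2) ∧ ∀ j, i < j →
          ¬ IsSingTriple (Function.update ![1, 2, 5] j e 0) (Function.update ![1, 2, 5] j e 1)
            (Function.update ![1, 2, 5] j e 2)) → A' i e = 1 := by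
    intro e i he hi
    rw [Finset.mem_sdiff] at he
    refine hn.apply_of_isGreatest e (by simpa [Qsing_ground] using he.1) ?_ i
      ⟨(hs e i).2 hi.1, fun j hj => not_lt.1 fun hij => hi.2 j hij ((hs e j).1 hj)⟩
    rintro ⟨j, rfl⟩
    refine he.2 ?_
    fin_cases j <;> simp [singCircuit, ReferenceCircuit.ofIsBase]
  have h31 : A' 1 3 = 0 := by simpa [det₃, c1, c5] using z 1 3 5 (by decide +kernel)
  have h40 : A' 0 4 = 0 := by simpa [det₃, c2, c5] using z 4 2 5 (by decide +kernel)
  have h62 : A' 2 6 = 0 := by simpa [det₃, c1, c2] using z 1 2 6 (by decide +kernel)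
  have h71 : A' 1 7 = 0 := by simpa [det₃, c1, c5] using z 1 7 5 (by decide +kernel)
  have h82 : A' 2 8 = 0 := by simpa [det₃, c1, c2] using z 1 2 8 (by decide +kernel)
  have h90 : A' 0 9 = 0 := by simpa [det₃, c2, c5] using z 9 2 5 (by decide +kernel)
  have h32 : A' 2 3 = 1 := one 3 2 (by decide) (by decide +kernel)
  have h42 : A' 2 4 = 1 := one 4 2 (by decide) (by decide +kernel)
  have h61 : A' 1 6 = 1 := one 6 1 (by decide) (by decide +kernel)
  have h72 : A' 2 7 = 1 := one 7 2 (by decide) (by decide +kernel)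
  have h81 : A' 1 8 = 1 := one 8 1 (by decide) (by decide +kernel)
  have h92 : A' 2 9 = 1 := one 9 2 (by decide) (by decide +kernel)
  have h102 : A' 2 10 = 1 := one 10 2 (by decide) (by decide +kernel)
  have h122 : A' 2 12 = 1 := one 12 2 (by decide) (by decide +kernel)
  have up := u 6 2 5 (by decide +kernel)
  have uq := u 8 2 5 (by decide +kernel)
  have uz := u 1 9 5 (by decide +kernel)
  have u679 := u 6 7 9 (by decide +kernel)
  have m2711 := z 2 7 11 (by decide +kernel)
  have m478 := z 4 7 8 (by decide +kernel)
  have m346 := z 3 4 6 (by decide +kernel)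
  have m389 := z 3 8 9 (by decide +kernel)
  have m5610 := z 5 6 10 (by decide +kernel)
  have m41011 := z 4 10 11 (by decide +kernel)
  have m1912 := z 1 9 12 (by decide +kernel)
  have m81112 := z 8 11 12 (by decide +kernel)
  have m31012 := z 3 10 12 (by decide +kernel)
  simp [det₃, c1, c2, c5, c11, h31, h40, h62, h71, h82, h90, h32, h42, h61, h72, h81, h92, h102,
    h122] at up uq uz u679 m2711 m478 m346 m389 m5610 m41011 m1912 m81112 m31012
  obtain ⟨p', hp⟩ := up.exists_right_inv
  obtain ⟨q', hq⟩ := uq.exists_right_inv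
  have h07 : A' 0 7 = 1 := by linear_combination -m2711
  have h14 : A' 1 4 = -q' := by linear_combination q' * m478 - q' * h07 - A' 1 4 * hq
  have h03 : A' 0 3 = A' 0 6 * q' := by linear_combination -m346 - A' 0 6 * h14
  have h19 : A' 1 9 = -(A' 0 6 * q' * q') := by
    linear_combination q' * m389 - q' * h03 - A' 1 9 * hq
  have h010 : A' 0 10 = A' 0 6 * A' 1 10 := by linear_combination -m5610
  have h112 : A' 1 12 = -(A' 0 6 * q' * q') := by linear_combination h19 - m1912
  have h012 : A' 0 12 = 1 - A' 0 8 - A' 0 6 * q' := by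
    linear_combination m81112 + A' 0 8 * h112 - A' 0 6 * q' * hq
  rw [h010, h14] at m41011
  rw [h19, h07] at u679
  -- The columns of 6 and 8 are (p, 1, 0) and (q, 1, 0), with `p'` and `q'` the inverses of p and q.
  obtain ⟨p, hp6⟩ : ∃ p, A' 0 6 = p := ⟨_, rfl⟩
  obtain ⟨q, hq8⟩ : ∃ q, A' 0 8 = q := ⟨_, rfl⟩
  rw [hp6] at up hp h03 h19 h010 h112 h012 m41011 u679
  rw [hq8] at uq hq h012
  -- The parameters will be a = q/p and v = (1 + a) q + 1 - a.
  obtain ⟨a, ha⟩ : ∃ a, a = q * p' := ⟨_, rfl⟩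
  have ha' : a * (p * q') = 1 := by rw [ha]; linear_combination q * q' * hp + hq
  -- Since {6, 7, 9} is a basis, its minor is a unit; up to sign it is (1 - a²)/a².
  have hb : IsUnit (1 + a) := by
    have : -(p * (-(p * q' * q'))) - 1 = (1 + a) * ((1 - a) * (p * q') ^ 2) := by
      linear_combination (a * (p * q') + 1) * ha'
    rw [this] at u679
    exact isUnit_of_mul_isUnit_left u679
  -- The line {4, 10, 11} determines the remaining entry of column 10.
  have hx : A' 1 10 * p * (1 + q - a) = 1 := by
    rw [ha]
    linear_combination q * m41011 - (A' 1 10 * q) * hp + (1 - A' 1 10 * p) * hq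
  have huq : IsUnit q := uq
  have hupq : IsUnit (p * q') := IsUnit.of_mul_eq_one a (by rw [mul_comm]; exact ha')
  have hua : IsUnit a := IsUnit.of_mul_eq_one _ ha'
  obtain ⟨b', hb'⟩ := hb.exists_right_inv
  have hub' : IsUnit b' := IsUnit.of_mul_eq_one (1 + a) (by rw [mul_comm]; exact hb')
  have huq' : IsUnit q' := IsUnit.of_mul_eq_one q (by rw [mul_comm]; exact hq)
  have hup' : IsUnit p' := IsUnit.of_mul_eq_one p (by rw [mul_comm]; exact hp)
  have hux : IsUnit (1 + q - a) :=
    IsUnit.of_mul_eq_one (A' 1 10 * p) (by rw [mul_comm]; exact hx)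
  have hV : ProjEquiv Qsing.E A' (singMatrix a ((1 + a) * q + 1 - a)) := by
    refine ProjEquiv.of_diagonal ![1 + a, (1 + a) * q, -(1 + a)] ?_ ?_
    · intro i
      fin_cases i
      exacts [hb, hb.mul huq, hb.neg]
    · intro e he
      rw [Qsing_ground, mem_Icc] at he
      obtain ⟨h1, h2⟩ := he
      interval_cases e
      · refine ⟨b', hub', fun i => ?_⟩
        fin_cases i <;> simp [singMatrix, singColumn, c1]
        · linear_combination -hb'
      · refine ⟨b' * q', hub'.mul huq', fun i => ?_⟩
        fin_cases i <;> simp [singMatrix, singColumn, c2]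
        · linear_combination -(q * q') * hb' - hq
      · refine ⟨b' * a, hub'.mul hua, fun i => ?_⟩
        fin_cases i <;> simp [singMatrix, singColumn, h03, h31, h32]
        · linear_combination -(a * p * q') * hb' - ha'
        · linear_combination a * hb'
      · refine ⟨-b', hub'.neg, fun i => ?_⟩
        fin_cases i <;> simp [singMatrix, singColumn, h40, h14, h42]
        · linear_combination -(q * q') * hb' - hq
        · linear_combination -hb'
      · refine ⟨-b', hub'.neg, fun i => ?_⟩
        fin_cases i <;> simp [singMatrix, singColumn, c5]
        · linear_combination -hb'
      · refine ⟨b' * p', hub'.mul hup', fun i => ?_⟩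
        fin_cases i <;> simp [singMatrix, singColumn, h61, h62, hp6]
        · linear_combination -(p * p') * hb' - hp
        · linear_combination -(q * p') * hb' + ha
      · refine ⟨b', hub', fun i => ?_⟩
        fin_cases i <;> simp [singMatrix, singColumn, h07, h71, h72]
        · linear_combination -hb'
        · linear_combination hb'
      · refine ⟨b' * q', hub'.mul huq', fun i => ?_⟩
        fin_cases i <;> simp [singMatrix, singColumn, h81, h82, hq8]
        · linear_combination -(q * q') * hb' - hq
        · linear_combination -(q * q') * hb' - hq
      · refine ⟨-b' * a, hub'.neg.mul hua, fun i => ?_⟩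
        fin_cases i <;> simp [singMatrix, singColumn, h90, h19, h92]
        · linear_combination -((q * q') * (a * p * q')) * hb' - a * p * q' * hq - ha'
        · linear_combination -a * hb'
      · refine ⟨1 + q - a, hux, fun i => ?_⟩
        fin_cases i <;> simp [singMatrix, singColumn, h010, h102]
        · linear_combination -(1 + a) * hx
        · linear_combination (1 + a) * (-a * hx + A' 1 10 * (1 + q - a) * (p * ha + q * hp))
        · ring
      · refine ⟨1, isUnit_one, fun i => ?_⟩
        fin_cases i <;> simp [singMatrix, singColumn, c11]
      · refine ⟨-a, hua.neg, fun i => ?_⟩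
        fin_cases i <;> simp [singMatrix, singColumn, h012, h112, h122]
        · linear_combination -(1 + a) * ha'
        · linear_combination -(1 + a) * (a * p * q' * hq + ha')
        · ring
  refine ⟨a, (1 + a) * q + 1 - a, ?_, (hAA'.trans hV).symm⟩
  -- The line {3, 10, 12} did not enter the parametrization. Its minor is (1 + a)² (a² - a + 1) v,
  -- and 1 + a is a unit.
  have := (hA'.of_projEquiv hV).det₃_eq_zero 3 10 12 (by decide +kernel)
  simp [singMatrix, singColumn, det₃] at this
  have h2 : (1 + a) ^ 2 * ((a ^ 2 - a + 1) * ((1 + a) * q + 1 - a)) = 0 := by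
    linear_combination this
  exact (hb.pow 2).mul_right_eq_zero.1 h2

/-- Columns 1, 2 and 5 make the row operation diagonal, and column 8 makes its first two entries
equal. Then column 6 recovers `a`, and column 11 recovers `v`, because the unit 1 + a (the minor on
2, 5, 11) forces the total scaling of its first two entries to be 1. -/
theorem singMatrix_ext {T : Type} [CommRing T] {a v a' v' : T}
    (h : IsRep Qsing (singMatrix a v))
    (hp : ProjEquiv Qsing.E (singMatrix a v) (singMatrix a' v')) : a = a' ∧ v = v' := by
  obtain ⟨g, u, -, hp⟩ := hp
  have hu := h.isUnit_det₃ 2 5 11 (by decide +kernel)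
  have E : ∀ e ∈ Finset.Icc 1 12, ∀ i, singColumn a' v' e i =
      (g i 0 * singColumn a v e 0 + g i 1 * singColumn a v e 1 + g i 2 * singColumn a v e 2) *
        u e := fun e he i => by
    have := hp e (by simpa [Qsing_ground] using he) i
    rwa [Matrix.mul_apply, Fin.sum_univ_three] at this
  have e1 := E 1 (by decide)
  have e2 := E 2 (by decide)
  have e5 := E 5 (by decide)
  have e6 := E 6 (by decide)
  have e8 := E 8 (by decide)
  have e11 := E 11 (by decide)
  simp only [Fin.forall_fin_succ, singColumn] at e1 e2 e5 e6 e8 e11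
  simp at e1 e2 e5
  have z : ∀ {x : T} {w : Tˣ}, 0 = x * w → x = 0 := fun {x w} h => by
    rwa [eq_comm, Units.mul_left_eq_zero] at h
  have h01 := z e2.1
  have h02 := z e5.1
  have h10 := z e1.2.1
  have h12 := z e5.2.1
  simp [singMatrix, singColumn, det₃] at hu
  simp [h01, h02, h10, h12] at e8 e6 e11
  have h11 : g 1 1 = g 0 0 := by
    rw [← (u 8).isUnit.mul_left_inj, ← e8.1, ← e8.2.1]
  rw [h11] at e6 e11
  have ha : a = a' := by linear_combination (-1 : T) * e6.2.1 + a * e6.1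
  refine ⟨ha, ?_⟩
  have h1 : g 0 0 * (u 11 : T) = 1 := by
    rw [← hu.mul_left_inj]
    linear_combination (-1 : T) * e11.1 - ha
  linear_combination (-1 : T) * e11.2.1 - (v + a - 1) * h1 - ha

namespace IsModuli

theorem singMatrix {R : Type} [CommRing R] [Algebra ℂ R] [Algebra CurveRing R]
    [IsScalarTower ℂ CurveRing R]
    [IsLocalization (Submonoid.closure
      (baseMinors Qsing (_root_.singMatrix CurveRing.a CurveRing.v))) R] :
    IsModuli Qsing ((_root_.singMatrix CurveRing.a CurveRing.v).map (algebraMap CurveRing R)) := by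
  refine localization _ (fun t ht hB => ?_) (fun T _ _ A hA => ?_) fun T _ _ φ ψ hφ _ h => ?_
  · rw [det_submatrix_eq_det₃]
    exact det₃_singColumn_eq_zero _ _ CurveRing.rel _ _ _ (ht 0) (ht 1) (ht 2)
      fun h => hB ((Qsing_isBase_range_iff t).2 h)
  · obtain ⟨a, v, hav, h⟩ := exists_projEquiv_singMatrix hA
    refine ⟨CurveRing.ev a v hav, ?_⟩
    have := map_singMatrix (CurveRing.ev a v hav : CurveRing →+* T) CurveRing.a CurveRing.v
    simp only [RingHom.coe_coe, CurveRing.ev_a, CurveRing.ev_v] at this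
    rwa [this]
  · have hφ' := map_singMatrix (φ : CurveRing →+* T) CurveRing.a CurveRing.v
    have hψ' := map_singMatrix (ψ : CurveRing →+* T) CurveRing.a CurveRing.v
    simp only [RingHom.coe_coe] at hφ' hψ'
    rw [hφ'] at hφ h
    rw [hψ'] at h
    obtain ⟨h1, h2⟩ := singMatrix_ext hφ h
    exact CurveRing.algHom_ext h1 h2

end IsModuli

theorem hasNodalSingularities_singCircuit :
    HasNodalSingularities (singCircuit.RealizationRing ℂ) := by
  let W := Submonoid.closure (IsModuli.baseMinors Qsing (singMatrix CurveRing.a CurveRing.v))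
  have hfin : (IsModuli.baseMinors Qsing (singMatrix CurveRing.a CurveRing.v)).Finite :=
    finite_baseMinors (Set.finite_Icc 1 12) _
  -- The crossing a = z, v = 0 lies in the realization space, as no base minor vanishes there.
  obtain ⟨z, hz⟩ := IsAlgClosed.exists_root (Polynomial.X ^ 2 - Polynomial.X + 1 : Polynomial ℂ)
    (by
      have : (Polynomial.X ^ 2 - Polynomial.X + 1 : Polynomial ℂ).degree = 2 := by compute_degree!
      rw [this]
      decide)
  have hz0 : z ^ 2 - z + 1 = 0 := by simpa [Polynomial.IsRoot.def] using hz
  have hnode : HasNodalSingularities (Localization W) := by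
    refine CurveRing.hasNodalSingularities W _ hfin rfl z (by rw [mul_zero]) hz0 ?_
    rintro _ ⟨t, -, hB, rfl⟩
    rw [det_submatrix_eq_det₃]
    have := det₃_singColumn_map (CurveRing.ev z 0 (by rw [mul_zero]) : CurveRing →+* ℂ)
      CurveRing.a CurveRing.v (t 0) (t 1) (t 2)
    simp only [RingHom.coe_coe, CurveRing.ev_a, CurveRing.ev_v] at this
    change CurveRing.ev z 0 _ (det₃ (singColumn _ _ _) (singColumn _ _ _) (singColumn _ _ _)) ≠ 0
    rw [← this]
    exact det₃_singColumn_ne_zero hz0 _ _ _ ((Qsing_isBase_range_iff t).1 hB)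
  have hmod : IsModuli Qsing ((singMatrix CurveRing.a CurveRing.v).map
    (algebraMap CurveRing (Localization W))) := IsModuli.singMatrix
  obtain ⟨e⟩ := hmod.nonempty_algEquiv singCircuit.isModuli
  have := singCircuit.finiteType (Set.finite_Icc 1 12)
  have : Algebra.FiniteType ℂ (Localization W) := Algebra.FiniteType.equiv this e.symm
  exact hnode.of_algEquiv e

/-! ### Induction over extensions and the main theorem -/

theorem Matroid.NoLoops.freeExtension {α : Type*} {M : Matroid α} (hM : M.NoLoops) {a : α}
    (ha : a ∉ M.E) (hne : ∃ B, M.IsBase B ∧ B.Nonempty) : (M.freeExtension a).NoLoops := by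
  have key : ∀ B, M.IsBase B → a ∉ B := fun B hB h => ha (hB.subset_ground h)
  rintro e (rfl | he)
  · obtain ⟨B, hB, b, hb⟩ := hne
    have haB : e ∉ B \ {b} := fun h => key B hB h.1
    refine ⟨insert e (B \ {b}), (M.freeExtension_isBase_insert_iff ha haB).2 ⟨b, ?_, ?_⟩,
      mem_insert _ _⟩
    · simp
    · rwa [insert_sdiff_singleton, insert_eq_of_mem hb]
  · obtain ⟨B, hB, heB⟩ := hM e he
    exact ⟨B, (M.freeExtension_isBase_iff_of_notMem ha (key B hB)).2 hB, heB⟩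

theorem Matroid.NoLoops.freeCoextension {α : Type*} {M : Matroid α} (hM : M.NoLoops) {a : α}
    (ha : a ∉ M.E) : (M.freeCoextension a).NoLoops := by
  have key : ∀ B, M.IsBase B → (M.freeCoextension a).IsBase (insert a B) := fun B hB =>
    (Matroid.freeCoextension_isBase_insert_iff ha fun h => ha (hB.subset_ground h)).2 hB
  rintro e (rfl | he)
  · obtain ⟨B, hB⟩ := M.exists_isBase
    exact ⟨_, key B hB, mem_insert _ _⟩
  · obtain ⟨B, hB, heB⟩ := hM e he
    exact ⟨_, key B hB, Or.inr heB⟩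

theorem insert_Icc_one {m n : ℕ} (h : n = m + 1) : insert n (Icc 1 m) = Icc 1 n := by
  ext x
  simp only [mem_insert_iff, mem_Icc]
  omega

theorem notMem_Icc_one {m n : ℕ} (h : n = m + 1) : n ∉ Icc 1 m := by
  simp only [mem_Icc]
  omega

/-- The absence of loops is carried along because the normal form of a coextension depends on it. -/
theorem QsingCoext_spec (k : ℕ) : (QsingCoext k).E = Icc 1 (12 + k) ∧ (QsingCoext k).NoLoops ∧
    ∃ γ : ReferenceCircuit (QsingCoext k) (k + 3), HasNodalSingularities (γ.RealizationRing ℂ) := by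
  induction k with
  | zero => exact ⟨rfl, Qsing_noLoops, singCircuit, hasNodalSingularities_singCircuit⟩
  | succ k ih =>
    obtain ⟨hE, hL, γ, h⟩ := ih
    have ha : 13 + k ∉ (QsingCoext k).E := by
      rw [hE]
      exact notMem_Icc_one (by omega)
    refine ⟨?_, hL.freeCoextension ha, γ.freeCoextension ha,
      γ.hasNodalSingularities_freeCoextension hL ha (hE ▸ finite_Icc _ _) h⟩
    change insert (13 + k) (QsingCoext k).E = _
    rw [hE, insert_Icc_one (by omega)]
    congr 1
    omega

theorem QsingExt_spec (k m : ℕ) : (QsingExt k m).E = Icc 1 (12 + k + m) ∧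
    (QsingExt k m).NoLoops ∧ ∃ γ : ReferenceCircuit (QsingExt k m) (k + 3),
      HasNodalSingularities (γ.RealizationRing ℂ) := by
  induction m with
  | zero => exact QsingCoext_spec k
  | succ m ih =>
    obtain ⟨hE, hL, γ, h⟩ := ih
    have ha : 13 + k + m ∉ (QsingExt k m).E := by
      rw [hE]
      exact notMem_Icc_one (by omega)
    refine ⟨?_, hL.freeExtension ha ⟨_, γ.isBase_range_basis, range_nonempty _⟩,
      γ.freeExtension ha,
      ReferenceCircuit.hasNodalSingularities_freeExtension (k := k + 2) γ ha
        (hE ▸ finite_Icc _ _) h⟩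
    change insert (13 + k + m) (QsingExt k m).E = _
    rw [hE, insert_Icc_one (by omega)]
    congr 1
    omega

/-- Any two reference circuits yield universal representations of the same matroid, hence isomorphic
rings. -/
theorem ReferenceCircuit.hasNodalSingularities_of_hasNodalSingularities {α : Type} {M : Matroid α}
    {d : ℕ} (γ γ' : ReferenceCircuit M d) (hE : M.E.Finite)
    (h : HasNodalSingularities (γ.RealizationRing ℂ)) :
    HasNodalSingularities (γ'.RealizationRing ℂ) := by
  have := γ.finiteType hE
  obtain ⟨e⟩ := γ.isModuli.nonempty_algEquiv γ'.isModuli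
  exact h.of_algEquiv e

theorem QsingDN_spec {d n : ℕ} (hd : 3 ≤ d) (hn : d + 9 ≤ n) :
    (QsingDN d n).E = Icc 1 n ∧ (QsingDN d n).eRank = d ∧ (QsingDN d n).IsConnected ∧
      Nonempty (ReferenceCircuit (QsingDN d n) d) ∧
      ∀ γ : ReferenceCircuit (QsingDN d n) d, HasNodalSingularities (γ.RealizationRing ℂ) := by
  obtain ⟨k, rfl⟩ : ∃ k, d = k + 3 := ⟨d - 3, by omega⟩
  obtain ⟨m, rfl⟩ : ∃ m, n = 12 + k + m := ⟨n - (12 + k), by omega⟩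
  have hQ : QsingDN (k + 3) (12 + k + m) = QsingExt k m := by
    rw [QsingDN]
    congr 1
    omega
  rw [hQ]
  obtain ⟨hE, hL, γ, h⟩ := QsingExt_spec k m
  exact ⟨hE, γ.eRank_eq, γ.isConnected hL, ⟨γ⟩, fun γ' =>
    γ.hasNodalSingularities_of_hasNodalSingularities γ' (hE ▸ finite_Icc _ _) h⟩

theorem mainTheorem2 :
    (∀ d n : ℕ, 3 ≤ d → (d : ℝ) ≤ (n : ℝ) / 2 → (d, n) ∉ exceptionalPairs →
      (QsingDN d n).E = Set.Icc 1 n ∧ (QsingDN d n).eRank = d ∧ (QsingDN d n).IsConnected ∧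
        Nonempty (ReferenceCircuit (QsingDN d n) d) ∧
        ∀ γ : ReferenceCircuit (QsingDN d n) d, HasNodalSingularities (γ.RealizationRing ℂ)) ∧
    (∀ n : ℕ, 12 ≤ n → ∃ M : Matroid ℕ, M.E = Set.Icc 1 n ∧ M.eRank = 3 ∧ M.IsConnected ∧
      Nonempty (ReferenceCircuit M 3) ∧
      ∀ γ : ReferenceCircuit M 3, HasNodalSingularities (γ.RealizationRing ℂ)) := by
  refine ⟨fun d n hd hdn hex => QsingDN_spec hd ?_, fun n hn =>
    ⟨QsingDN 3 n, QsingDN_spec le_rfl hn⟩⟩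
  have h2 : 2 * d ≤ n := by
    have : (2 * d : ℝ) ≤ n := by linarith
    exact_mod_cast this
  -- If n < d + 9, then 2d ≤ n leaves only finitely many pairs, and these are exactly the
  -- exceptional ones.
  by_contra! hlt
  have hd9 : d < 9 := by omega
  have hn18 : n < 18 := by omega
  have key : ∀ d ∈ Finset.range 9, ∀ n ∈ Finset.range 18,
      3 ≤ d → 2 * d ≤ n → n < d + 9 → (d, n) ∈ exceptionalPairs := by
    decide +kernel
  exact hex (key d (Finset.mem_range.2 hd9) n (Finset.mem_range.2 hn18) hd h2 hlt)
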